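/- Let $R$ be a commutative Noetherian ring, $k\in\mathbb N$, $S=R[x_1,\dots,x_k]$, and let $S_n\subseteq S$ be the set of polynomials of total degree at most $n$. Let $\lambda$ be a generalized length function on $R$-modules, that is, a function with values in $[0,\infty]$ that is isomorphism invariant, vanishes on $0$, is additive on short exact sequences, and satisfies $\lambda(M)=\sup\{\lambda(M'): M'\le M \text{ finitely generated}\}$. For an $S$-module $A$, call an $R$-submodule $V\le A$ *admissible* if $\lambda(S_1V/V)<\infty$ and $S_1V/V$ is a finitely generated $R$-module. For monomials with coefficients in $[0,\infty]$ put $rt^n\oplus st^m=rt^n$ if $n>m$, $st^m$ if $n<m$, and $(r+s)t^n$ if $n=m$; the supremum of a family of monomials of bounded degree is the monomial whose degree is the maximum of the degrees and whose coefficient is the supremum of the coefficients of the members of that degree (the supremum of the empty family is $0$; the zero monomial has degree $0$ by convention). (1) For every admissible $V$ there is a unique polynomial $\tilde q_V\in\mathbb R[t]$ with $\lambda(S_{n+1}V/S_nV)=\tilde q_V(n)<\infty$ for all large $n$; it has degree at most $k-1$ (it is $0$ if $k=0$) and nonnegative leading coefficient. Let $\tilde\mu[V]$ be its leading monomial, and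 define $$\tilde\mu(A)=\sup\{\tilde\mu[V] : V\le A \text{ admissible},\ SV \text{ a finitely generated } S\text{-module}\}.$$ (2) If $A$ is a finitely generated $S$-module, then $\tilde\mu(A)=\sup\{\tilde\mu[V]: V\le A\text{ admissible},\ SV=A\}$. (3) For every short exact sequence $0\to A\to B\to C\to 0$ of $S$-modules, $\tilde\mu(B)=\tilde\mu(A)\oplus\tilde\mu(C)$. (4) Moreover $\tilde\mu(0)=0$, $\tilde\mu$ is invariant under isomorphisms of $S$-modules, and $\tilde\mu(A)=\sup\{\tilde\mu(B): B\le A\text{ a finitely generated } S\text{-submodule}\}$ for every $S$-module $A$. (5) For every admissible $V\le A$ the limit $\tilde H(V)=\lim_{n\to\infty} k!\,\lambda(S_nV/V)/n^k$ exists. Let $\tilde h(A)=\sup\{\tilde H(V): V\le A\text{ admissible}\}$ be the intrinsic entropy of $A$. If $k\ge 1$, then $\tilde h(A)$ equals $(k-1)!$ times the coefficient of $t^{k-1}$ in $\tilde\mu(A)$. The function $\tilde h$ is a generalized length function on $S$-modules with values in $[0,\infty]$. -/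

import Mathlib

open Filter Topology
open scoped ENNReal Nat Polynomial

universe u v

/-- A generalized length function on the category of `R`-modules (in a fixed universe), with values
in `[0, ∞]`. -/
structure LengthFunction (R : Type u) [CommRing R] where
  len : ∀ (M : Type v) [AddCommGroup M] [Module R M], ℝ≥0∞
  len_zero : ∀ (M : Type v) [AddCommGroup M] [Module R M] [Subsingleton M], len M = 0
  len_congr : ∀ (M N : Type v) [AddCommGroup M] [Module R M] [AddCommGroup N] [Module R N],
    (M ≃ₗ[R] N) → len M = len N
  len_add : ∀ (A B C : Type v) [AddCommGroup A] [Module R A] [AddCommGroup B] [Module R B]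
    [AddCommGroup C] [Module R C] (f : A →ₗ[R] B) (g : B →ₗ[R] C),
    Function.Injective f → Function.Surjective g → Function.Exact f g → len B = len A + len C
  len_sup : ∀ (M : Type v) [AddCommGroup M] [Module R M],
    len M = ⨆ (N : Submodule R M) (_ : N.FG), len N

/-- The monomial `coeff * t ^ deg`, with `coeff` in `[0, ∞]`. The zero monomial is represented by
`deg = 0`, `coeff = 0`. -/
@[ext]
structure LeadTerm where
  deg : ℕ
  coeff : ℝ≥0∞

namespace LeadTerm

/-- The zero monomial. -/
def zero : LeadTerm := ⟨0, 0⟩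

/-- The leading monomial of a real polynomial with nonnegative leading coefficient
(it is `zero` for the zero polynomial). -/
noncomputable def ofPoly (q : ℝ[X]) : LeadTerm := ⟨q.natDegree, ENNReal.ofReal q.leadingCoeff⟩

/-- The operation `r t ^ n ⊕ s t ^ m`. -/
noncomputable def oplus (a b : LeadTerm) : LeadTerm :=
  if b.deg < a.deg then a
  else if a.deg < b.deg then b
  else ⟨a.deg, a.coeff + b.coeff⟩

/-- The supremum of a family of monomials of bounded degree: the degree is the maximum of the
degrees, the coefficient is the supremum of the coefficients of the members of that degree. The
supremum of the empty family is `zero`. -/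
noncomputable def sup (I : Set LeadTerm) : LeadTerm where
  deg := sSup (deg '' I)
  coeff := sSup {r | ∃ m ∈ I, m.deg = sSup (deg '' I) ∧ m.coeff = r}

end LeadTerm

section Intrinsic

variable {R : Type u} [CommRing R] (lam : LengthFunction.{u, v} R) (k : ℕ)
  {A : Type v} [AddCommGroup A] [Module R A] [Module (MvPolynomial (Fin k) R) A]

/-- The quotient `W / V` of two `R`-submodules `V ≤ W` of `A`. -/
abbrev RelQuot {R : Type u} [CommRing R] {A : Type v} [AddCommGroup A] [Module R A]
    (V W : Submodule R A) : Type v :=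
  ↥W ⧸ V.submoduleOf W

/-- The `R`-submodule `S_n V`, where `S_n` is the set of polynomials in
`S = R[x_1, …, x_k]` of total degree at most `n`. -/
def polyAct (n : ℕ) (V : Submodule R A) : Submodule R A :=
  Submodule.span R
    {m | ∃ s : MvPolynomial (Fin k) R, s.totalDegree ≤ n ∧ ∃ v ∈ V, s • v = m}

/-- `V` is `λ`-inert, i.e. `λ (S_1 V / V) < ∞`, and `S_1 V / V` is a finitely generated
`R`-module. -/
def IsInertFG (V : Submodule R A) : Prop :=
  lam.len (RelQuot V (polyAct k 1 V)) < ∞ ∧ Module.Finite R (RelQuot V (polyAct k 1 V))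

/-- `q` is the intrinsic Hilbert polynomial of `V`: for all large `n`,
`λ (S_{n+1} V / S_n V)` is finite and equal to `q n`. -/
def IsIntrinsicHilbertPoly (V : Submodule R A) (q : ℝ[X]) : Prop :=
  ∀ᶠ n : ℕ in atTop, 0 ≤ q.eval (n : ℝ) ∧
    lam.len (RelQuot (polyAct k n V) (polyAct k (n + 1) V)) = ENNReal.ofReal (q.eval (n : ℝ))

/-- `m` is the leading monomial of the intrinsic Hilbert polynomial of `V`. -/
def IsIntrinsicLeadTerm (V : Submodule R A) (m : LeadTerm) : Prop :=
  ∃ q : ℝ[X], IsIntrinsicHilbertPoly lam k V q ∧ m = LeadTerm.ofPoly q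

variable (A)

/-- The supremum of the leading monomials of the `R`-submodules `V` of `A` that are
`λ`-inert, have `S_1 V / V` finitely generated, and generate `A` as an `S`-module. This is the
definition of the intrinsic invariant for a finitely generated `S`-module `A`. -/
noncomputable def muTildeGen : LeadTerm :=
  LeadTerm.sup {m | ∃ V : Submodule R A, IsInertFG lam k V ∧
    Submodule.span (MvPolynomial (Fin k) R) (V : Set A) = ⊤ ∧ IsIntrinsicLeadTerm lam k V m}

/-- The intrinsic invariant of an arbitrary `S`-module `A`: the supremum of the leading monomials
of the `R`-submodules `V` of `A` that are `λ`-inert, have `S_1 V / V` finitely generated over `R`,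
and `S V` finitely generated over `S`. -/
noncomputable def muTilde : LeadTerm :=
  LeadTerm.sup {m | ∃ V : Submodule R A, IsInertFG lam k V ∧
    (Submodule.span (MvPolynomial (Fin k) R) (V : Set A)).FG ∧ IsIntrinsicLeadTerm lam k V m}

variable {A}

/-- The sequence `k! * λ (S_n V / V) / n ^ k`, whose limit is the intrinsic entropy of the
action of `x_1, …, x_k` along `V`. -/
noncomputable def entropySeq (V : Submodule R A) (n : ℕ) : ℝ≥0∞ :=
  (k ! : ℝ≥0∞) * lam.len (RelQuot V (polyAct k n V)) / (n : ℝ≥0∞) ^ k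

variable (A)

/-- The intrinsic entropy of the `S`-module `A`: the supremum of the intrinsic entropies along the
`λ`-inert `R`-submodules `V` with `S_1 V / V` finitely generated. -/
noncomputable def intrinsicEntropy : ℝ≥0∞ :=
  ⨆ (V : Submodule R A) (_ : IsInertFG lam k V), limsup (entropySeq lam k V) atTop

end Intrinsic

/-! Write E = R + R x_1 + ... + R x_k, so that S_n V = E^n V. If V is admissible, the graded
R[x]-module with pieces E^(n+1) V / E^n V is generated in degree 0 by a finitely generated R-module.
The Hilbert–Serre induction on the number of variables uses only Noetherianity and the additivity of
λ, so it yields the Hilbert polynomial (`exists_hilbertPoly`). The length of E^n V / V is its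
discrete integral, whose coefficient of degree k gives the entropy when k is positive.

Let 0 → A → B → C → 0 be exact. One half of additivity is elementary: for V in B the modules E^n V ∩
A are, for large n, of the form E^m X with X inert, and lengths split exactly along B → C
(`IsInert.exists_hilbertLead_eq_oplus`).

The other half has to glue V in A and V' in C. Write E V = V + F and E V' = V' + F' with F, F'
finitely generated, and lift F' to a finitely generated L in B. What is needed is an inert W in B
that contains F + L and swallows none of the growth of V: E^n W meets the union of the E^c V inside
a single E^b V. Then F grows relative to W as fast as V does, up to a bounded length.
`IsInert.exists_extension` produces such a W. It serves twice: for gluing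
(`IsInert.exists_oplus_le`) and for enlarging an inert submodule of a finitely generated module to a
generating one (`IsInert.exists_generating`).

The construction of W is geometry at infinity. For y among finitely many generators of E, the
fractions b / y^n form modules over the ring generated by the e / y, where τ = 1 / y is the local
equation of the boundary. Let I_n be the set of elements of E^n multiplying F into V. The module W
is assembled from the products I_p^N E^q G, where G is the finitely generated module to be contained
in W. It is large enough: an ideal c that kills F modulo V, and whose cyclic quotients have finite
length, has a power carrying E^(d+1) into I_(d+1), which makes E W / W of finite length. It is small
enough: on each chart I_n gives an ideal J_n with J_n V ⊆ τ^(n-b1) V for a constant b1, and a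
uniform Artin–Rees lemma (`exists_uniform_artinRees`), proved by power series expansion in τ, bounds
the intersection of V with J_n^N D by a constant independent of n. Saturation glues the charts, and
Noetherian arguments show that the saturated family is generated by G in large degrees. -/

/-! ### Relative finite generation -/

section RelFG

variable {R : Type*} [CommRing R] {A B : Type*} [AddCommGroup A] [Module R A]
  [AddCommGroup B] [Module R B]

/-- `V / (U ⊓ V)` is a finitely generated module. -/
def RelFG (U V : Submodule R A) : Prop := ∃ F : Submodule R A, F.FG ∧ F ≤ V ∧ V ≤ U ⊔ F

theorem relFG_iff_finite {U V : Submodule R A} :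
    RelFG U V ↔ Module.Finite R (RelQuot U V) := by
  constructor
  · rintro ⟨F, hF, hFV, hV⟩
    have : Module.Finite R F := Module.Finite.iff_fg.2 hF
    refine Module.Finite.of_surjective
      ((U.submoduleOf V).mkQ ∘ₗ Submodule.inclusion hFV) ?_
    intro y
    obtain ⟨⟨y, hy⟩, rfl⟩ := Submodule.mkQ_surjective _ y
    obtain ⟨a, ha, b, hb, rfl⟩ := Submodule.mem_sup.1 (hV hy)
    refine ⟨⟨b, hb⟩, ?_⟩
    simp only [LinearMap.comp_apply]
    rw [← sub_eq_zero, ← map_sub, Submodule.mkQ_apply, Submodule.Quotient.mk_eq_zero]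
    simpa [Submodule.submoduleOf] using ha
  · intro h
    obtain ⟨s, hs⟩ := h.fg_top
    classical
    choose g hg using Submodule.mkQ_surjective (U.submoduleOf V)
    refine ⟨Submodule.span R ((fun y => (g y : A)) '' (s : Set _)),
      ⟨s.image (fun y => (g y : A)), by simp⟩, ?_, ?_⟩
    · rw [Submodule.span_le]
      rintro _ ⟨y, -, rfl⟩
      exact (g y).2
    · intro x hx
      -- All representatives z of the class y are allowed, because the chosen section `g` of the
      -- quotient map is not additive.
      have key : ∀ y : RelQuot U V, ∀ z : V, (U.submoduleOf V).mkQ z = y →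
          (z : A) ∈ U ⊔ Submodule.span R ((fun y => (g y : A)) '' (s : Set _)) := by
        intro y
        have hy : y ∈ Submodule.span R (s : Set (RelQuot U V)) := by rw [hs]; trivial
        induction hy using Submodule.span_induction with
        | mem y hy =>
          intro z hz
          have h1 : z - g y ∈ U.submoduleOf V := by
            rw [← Submodule.Quotient.mk_eq_zero, ← Submodule.mkQ_apply, map_sub, hz, hg, sub_self]
          have : (z : A) = ((z - g y : V) : A) + (g y : A) := by simp
          rw [this]
          exact Submodule.add_mem_sup h1 (Submodule.subset_span ⟨y, hy, rfl⟩)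
        | zero =>
          intro z hz
          exact Submodule.mem_sup_left ((Submodule.Quotient.mk_eq_zero (U.submoduleOf V)).1 hz)
        | add y1 y2 _ _ h1 h2 =>
          intro z hz
          have h3 := h1 (g y1) (hg _)
          have h4 := h2 (z - g y1) (by rw [map_sub, hz, hg]; abel)
          simpa using add_mem h3 h4
        | smul a y _ h =>
          intro z hz
          have h3 := Submodule.smul_mem _ a (h (g y) (hg _))
          have h1 : z - a • g y ∈ U.submoduleOf V := by
            rw [← Submodule.Quotient.mk_eq_zero, ← Submodule.mkQ_apply, map_sub, hz, map_smul, hg,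
              sub_self]
          have : (z : A) = ((z - a • g y : V) : A) + a • (g y : A) := by simp
          rw [this]
          exact add_mem (Submodule.mem_sup_left h1) h3
      exact key _ ⟨x, hx⟩ rfl

/-- The generators of F need not lie in V. By Noetherianity F ∩ (U + V) is finitely generated, and
each of its generators can be corrected by an element of U to lie in V. -/
theorem RelFG.of_le_sup [IsNoetherianRing R] {U V F : Submodule R A} (hF : F.FG)
    (h : V ≤ U ⊔ F) : RelFG U V := by
  have : IsNoetherian R F := isNoetherian_of_fg_of_noetherian F hF
  let G : Submodule R A := F ⊓ (U ⊔ V)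
  have hG : G.FG := by
    have := (IsNoetherian.noetherian (G.submoduleOf F)).map F.subtype
    rwa [Submodule.submoduleOf, Submodule.map_comap_subtype, inf_eq_right.2 inf_le_left] at this
  obtain ⟨s, hs⟩ := hG
  have h1 : ∀ y : s, ∃ v ∈ V, (y : A) - v ∈ U := by
    intro y
    have : (y : A) ∈ G := hs ▸ Submodule.subset_span y.2
    obtain ⟨a, ha, b, hb, hab⟩ := Submodule.mem_sup.1 this.2
    exact ⟨b, hb, by rw [← hab]; simpa using ha⟩
  choose g hgV hgU using h1
  refine ⟨Submodule.span R (Set.range g), Submodule.fg_span (Set.finite_range g), ?_, ?_⟩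
  · rw [Submodule.span_le]; rintro _ ⟨y, rfl⟩; exact hgV y
  · intro v hv
    obtain ⟨a, ha, b, hb, rfl⟩ := Submodule.mem_sup.1 (h hv)
    have hbG : b ∈ G := ⟨hb, by
      have := (U ⊔ V).sub_mem (Submodule.mem_sup_right hv) (Submodule.mem_sup_left ha)
      simpa using this⟩
    refine add_mem (Submodule.mem_sup_left ha) ?_
    have hle : G ≤ U ⊔ Submodule.span R (Set.range g) := by
      rw [← hs, Submodule.span_le]
      intro y hy
      have : y = (y - g ⟨y, hy⟩) + g ⟨y, hy⟩ := by abel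
      rw [this]
      exact add_mem (Submodule.mem_sup_left (hgU ⟨y, hy⟩))
        (Submodule.mem_sup_right (Submodule.subset_span ⟨_, rfl⟩))
    exact hle hbG

theorem RelFG.mono [IsNoetherianRing R] {U U' V V' : Submodule R A} (h : RelFG U V)
    (hU : U ≤ U') (hV : V' ≤ V) : RelFG U' V' := by
  obtain ⟨F, hF, -, hle⟩ := h
  exact .of_le_sup hF (hV.trans (hle.trans (sup_le_sup_right hU F)))

theorem RelFG.trans [IsNoetherianRing R] {U V W : Submodule R A} (h : RelFG U V)
    (h' : RelFG V W) : RelFG U W := by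
  obtain ⟨F, hF, -, hle⟩ := h
  obtain ⟨F', hF', -, hle'⟩ := h'
  refine .of_le_sup (hF.sup hF') (hle'.trans (sup_le (hle.trans ?_) ?_))
  · exact sup_le_sup_left le_sup_left _
  · exact le_sup_of_le_right le_sup_right

theorem RelFG.map {U V : Submodule R A} (f : A →ₗ[R] B) (h : RelFG U V) :
    RelFG (U.map f) (V.map f) := by
  obtain ⟨F, hF, hle, hle'⟩ := h
  exact ⟨F.map f, hF.map f, Submodule.map_mono hle, by
    rw [← Submodule.map_sup]; exact Submodule.map_mono hle'⟩

/-- The kernel of f lies in the preimage of U, so lifts of finitely many generators suffice even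
when the kernel is not finitely generated. -/
theorem RelFG.comap [IsNoetherianRing R] {U V : Submodule R B} (f : A →ₗ[R] B) (h : RelFG U V) :
    RelFG (U.comap f) (V.comap f) := by
  have h1 : RelFG U ((V.comap f).map f) := h.mono le_rfl (Submodule.map_comap_le f V)
  obtain ⟨F, ⟨s, rfl⟩, hle, hle'⟩ := h1
  have hs : ∀ y : s, ∃ z ∈ V.comap f, f z = y := fun y => hle (Submodule.subset_span y.2)
  choose g hg hgs using hs
  refine ⟨Submodule.span R (Set.range g), Submodule.fg_span (Set.finite_range g), ?_, ?_⟩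
  · rw [Submodule.span_le]; rintro _ ⟨y, rfl⟩; exact hg y
  · intro v hv
    obtain ⟨a, ha, b, hb, hab⟩ := Submodule.mem_sup.1 (hle' ⟨v, hv, rfl⟩)
    have hle2 : Submodule.span R (s : Set B) ≤ (Submodule.span R (Set.range g)).map f := by
      rw [Submodule.span_le]
      intro y hy
      exact ⟨g ⟨y, hy⟩, Submodule.subset_span ⟨_, rfl⟩, hgs _⟩
    obtain ⟨c, hc, rfl⟩ := hle2 hb
    have : v = (v - c) + c := by abel
    rw [this]
    refine add_mem (Submodule.mem_sup_left ?_) (Submodule.mem_sup_right hc)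
    rw [Submodule.mem_comap, map_sub, ← hab]
    simpa using ha

end RelFG

/-! ### Relative length -/

section rho

variable {R : Type u} [CommRing R] (lam : LengthFunction.{u, v} R)
  {A B : Type v} [AddCommGroup A] [Module R A] [AddCommGroup B] [Module R B]

/-- The length of `V / (U ⊓ V)`. -/
noncomputable def relLen (U V : Submodule R A) : ℝ≥0∞ := lam.len (RelQuot U V)

/-- The map V → f(V) / (P ∩ f(V)) is onto with kernel V ∩ f⁻¹(P). No containment between P and f(V)
is needed; with f a quotient map this gives `relLen_sup_left`. -/
theorem relLen_map (f : A →ₗ[R] B) (P : Submodule R B) (V : Submodule R A) :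
    relLen lam P (V.map f) = relLen lam (P.comap f) V := by
  let g : V →ₗ[R] RelQuot P (V.map f) := (P.submoduleOf (V.map f)).mkQ ∘ₗ f.submoduleMap V
  have hg : Function.Surjective g :=
    (Submodule.mkQ_surjective _).comp (f.submoduleMap_surjective V)
  have hker : LinearMap.ker g = (P.comap f).submoduleOf V := by
    rw [LinearMap.ker_comp, Submodule.ker_mkQ]
    ext x
    rfl
  exact lam.len_congr _ _ ((Submodule.quotEquivOfEq _ _ hker).symm.trans
    (g.quotKerEquivOfSurjective hg)).symm

theorem relLen_inf (U V : Submodule R A) : relLen lam (U ⊓ V) V = relLen lam U V := by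
  unfold relLen
  refine lam.len_congr _ _ (Submodule.quotEquivOfEq _ _ ?_)
  ext x; simp [Submodule.submoduleOf]

theorem relLen_congr_inf {U U' V : Submodule R A} (h : U ⊓ V = U' ⊓ V) :
    relLen lam U V = relLen lam U' V := by
  rw [← relLen_inf, h, relLen_inf]

theorem relLen_eq_zero {U V : Submodule R A} (h : V ≤ U) : relLen lam U V = 0 := by
  have : Subsingleton (RelQuot U V) := by
    refine Submodule.Quotient.subsingleton_iff.2 ?_
    ext x; simpa [Submodule.submoduleOf] using h x.2
  exact lam.len_zero _

theorem relLen_sup_left (U V : Submodule R A) : relLen lam U (U ⊔ V) = relLen lam U V := by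
  have h := relLen_map lam U.mkQ ⊥ V
  have h2 := relLen_map lam U.mkQ ⊥ (U ⊔ V)
  have h3 : (U ⊔ V).map U.mkQ = V.map U.mkQ := by
    rw [Submodule.map_sup]; simp
  have h4 : (⊥ : Submodule R (A ⧸ U)).comap U.mkQ = U := by
    rw [Submodule.comap_bot, Submodule.ker_mkQ]
  rw [h4] at h h2
  rw [← h, ← h2, h3]

theorem relLen_add {U V W : Submodule R A} (hUV : U ≤ V) (hVW : V ≤ W) :
    relLen lam U W = relLen lam U V + relLen lam V W := by
  unfold relLen
  let i := Submodule.inclusion hVW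
  have hi : U.submoduleOf V = (U.submoduleOf W).comap i := by ext x; rfl
  let f : RelQuot U V →ₗ[R] RelQuot U W := Submodule.mapQ _ _ i hi.le
  have hle : U.submoduleOf W ≤ (V.submoduleOf W).comap LinearMap.id := fun x hx => hUV hx
  let g : RelQuot U W →ₗ[R] RelQuot V W := Submodule.mapQ _ _ LinearMap.id hle
  refine lam.len_add _ _ _ f g ?_ ?_ ?_
  · rw [← LinearMap.ker_eq_bot, Submodule.ker_mapQ, ← hi, Submodule.mkQ_map_self]
  · intro y
    obtain ⟨y, rfl⟩ := Submodule.mkQ_surjective _ y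
    exact ⟨Submodule.Quotient.mk y, rfl⟩
  · intro y
    obtain ⟨y, rfl⟩ := Submodule.mkQ_surjective _ y
    constructor
    · intro h
      have h2 : y ∈ V.submoduleOf W := (Submodule.Quotient.mk_eq_zero _).1 h
      exact ⟨Submodule.Quotient.mk ⟨y, h2⟩, rfl⟩
    · rintro ⟨z, hz⟩
      obtain ⟨z, rfl⟩ := Submodule.mkQ_surjective _ z
      rw [← hz]
      exact (Submodule.Quotient.mk_eq_zero _).2 z.2

theorem relLen_mono_right {U V W : Submodule R A} (h : V ≤ W) :
    relLen lam U V ≤ relLen lam U W := by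
  rw [← relLen_sup_left lam U V, ← relLen_sup_left lam U W,
    relLen_add lam (le_sup_left : U ≤ U ⊔ V) (sup_le_sup_left h U)]
  exact le_self_add

theorem relLen_anti_left {U U' V : Submodule R A} (h : U ≤ U') :
    relLen lam U' V ≤ relLen lam U V := by
  rw [← relLen_inf lam U' V, ← relLen_inf lam U V,
    relLen_add lam (inf_le_inf_right V h) inf_le_right]
  exact le_add_self

theorem relLen_sup_le (U V W : Submodule R A) :
    relLen lam U (V ⊔ W) ≤ relLen lam U V + relLen lam U W := by
  have h1 : relLen lam U (V ⊔ W) = relLen lam U V + relLen lam (U ⊔ V) W := by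
    rw [← relLen_sup_left lam U (V ⊔ W), ← relLen_sup_left lam U V,
      relLen_add lam (le_sup_left : U ≤ U ⊔ V) (sup_le_sup_left le_sup_left U),
      ← sup_assoc, relLen_sup_left, relLen_sup_left]
  rw [h1]
  exact add_le_add_right (relLen_anti_left lam le_sup_left) _

theorem relLen_iSup_le {ι : Type*} (s : Finset ι) (U : Submodule R A) (V : ι → Submodule R A) :
    relLen lam U (⨆ i ∈ s, V i) ≤ ∑ i ∈ s, relLen lam U (V i) := by
  classical
  induction s using Finset.induction_on with
  | empty => simp [relLen_eq_zero]
  | insert i s hi ih =>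
    rw [Finset.iSup_insert, Finset.sum_insert hi]
    exact (relLen_sup_le lam _ _ _).trans (add_le_add_right ih _)

theorem relLen_triangle (U V W : Submodule R A) :
    relLen lam U W ≤ relLen lam U V + relLen lam V W := by
  calc relLen lam U W ≤ relLen lam U (U ⊔ V ⊔ W) := relLen_mono_right lam le_sup_right
    _ = relLen lam U (U ⊔ V) + relLen lam (U ⊔ V) (U ⊔ V ⊔ W) :=
        relLen_add lam le_sup_left le_sup_left
    _ ≤ _ := by
        rw [relLen_sup_left, relLen_sup_left]
        exact add_le_add_right (relLen_anti_left lam le_sup_right) _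

/-- Additivity along a linear map. -/
theorem relLen_eq_add_of_map (f : A →ₗ[R] B) {U V : Submodule R A} (h : U ≤ V) :
    relLen lam U V = relLen lam (U.map f) (V.map f) +
      relLen lam (U ⊓ LinearMap.ker f) (V ⊓ LinearMap.ker f) := by
  rw [relLen_map, Submodule.comap_map_eq]
  -- Modular law: as U ≤ V, (U + ker f) ∩ V = U + (V ∩ ker f).
  have h1 : relLen lam (U ⊔ LinearMap.ker f) V = relLen lam (U ⊔ (V ⊓ LinearMap.ker f)) V := by
    apply relLen_congr_inf
    rw [sup_inf_assoc_of_le _ h, sup_inf_assoc_of_le _ h, inf_comm V, inf_assoc, inf_idem]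
  rw [h1, relLen_add lam (le_sup_left : U ≤ U ⊔ (V ⊓ LinearMap.ker f)) (sup_le h inf_le_left),
    relLen_sup_left, add_comm]
  congr 1
  apply relLen_congr_inf
  simp only [inf_comm V, inf_assoc, inf_left_idem]

end rho

/-! ### Noetherianity of graded modules -/

section Graded

variable {R S A : Type*} [CommRing R] [CommRing S] [Algebra R S] [AddCommGroup A] [Module R A]
  [Module S A] [IsScalarTower R S A]

variable (R A) in
/-- Multiplication by a scalar, as a linear map over the base ring. -/
abbrev smulBy (s : S) : A →ₗ[R] A := Algebra.lsmul R R A s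

/-- The polynomials whose `n`-th coefficient lies in `N n`, as a module over a polynomial ring
acting through `x`. -/
def gradedSubmodule {j : ℕ} (x : Fin j → S) [Module (MvPolynomial (Fin j) R) (PolynomialModule S A)]
    (hX : ∀ i (p : PolynomialModule S A),
      (MvPolynomial.X i : MvPolynomial (Fin j) R) • p = Polynomial.monomial 1 (x i) • p)
    (hC : ∀ (r : R) (p : PolynomialModule S A),
      (MvPolynomial.C r : MvPolynomial (Fin j) R) • p =
        Polynomial.monomial 0 (algebraMap R S r) • p)
    (N : ℕ → Submodule R A) (hN : ∀ n i, ∀ a ∈ N n, x i • a ∈ N (n + 1)) :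
    Submodule (MvPolynomial (Fin j) R) (PolynomialModule S A) where
  carrier := {p | ∀ n, p.coeff n ∈ N n}
  zero_mem' := fun n => (N n).zero_mem
  add_mem' := fun {p q} hp hq n => (N n).add_mem (hp n) (hq n)
  smul_mem' := by
    intro t
    induction t using MvPolynomial.induction_on with
    | C r =>
      intro p hp n
      rw [hC, PolynomialModule.monomial_smul_apply, if_pos (Nat.zero_le n), algebraMap_smul]
      exact (N n).smul_mem r (hp n)
    | add t t' h h' =>
      intro p hp n
      rw [add_smul]
      exact (N n).add_mem (h hp n) (h' hp n)
    | mul_X t i h =>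
      intro p hp
      rw [mul_smul]
      refine h ?_
      intro n
      rw [hX, PolynomialModule.monomial_smul_apply]
      split_ifs with h1
      · have := hN (n - 1) i _ (hp (n - 1))
        rwa [Nat.sub_add_cancel h1] at this
      · exact (N n).zero_mem

/-- Hilbert's basis theorem for the graded module ⊕ V n / U n over R[X_1, ..., X_j], where X_i acts
as x_i and raises the degree by one. It is finitely generated, hence so is its graded submodule ⊕ N
n / U n, and above the degrees of the generators N is obtained by multiplying by the variables. This
is the Noetherian input of all later finiteness statements. -/
theorem exists_graded_generation [IsNoetherianRing R] {j : ℕ} (x : Fin j → S)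
    (U N V : ℕ → Submodule R A) (hUN : ∀ n, U n ≤ N n) (hNV : ∀ n, N n ≤ V n)
    (xU : ∀ n i, ∀ a ∈ U n, x i • a ∈ U (n + 1)) (xN : ∀ n i, ∀ a ∈ N n, x i • a ∈ N (n + 1))
    (xV : ∀ n i, ∀ a ∈ V n, x i • a ∈ V (n + 1)) (hfg : ∀ n, RelFG (U n) (V n)) (n0 : ℕ)
    (hgen : ∀ n ≥ n0, V (n + 1) ≤ U (n + 1) ⊔ ⨆ i, (V n).map (smulBy R A (x i))) :
    ∃ n1, ∀ n ≥ n1, N (n + 1) ≤ U (n + 1) ⊔ ⨆ i, (N n).map (smulBy R A (x i)) := by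
  classical
  let ev : MvPolynomial (Fin j) R →ₐ[R] S[X] :=
    MvPolynomial.aeval (fun i => Polynomial.monomial 1 (x i))
  let : Module (MvPolynomial (Fin j) R) (PolynomialModule S A) := Module.compHom _ ev.toRingHom
  have hsmul : ∀ (t : MvPolynomial (Fin j) R) (p : PolynomialModule S A), t • p = ev t • p :=
    fun _ _ => rfl
  have hX : ∀ i (p : PolynomialModule S A),
      (MvPolynomial.X i : MvPolynomial (Fin j) R) • p = Polynomial.monomial 1 (x i) • p := by
    intro i p; rw [hsmul, MvPolynomial.aeval_X]
  have hC : ∀ (r : R) (p : PolynomialModule S A),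
      (MvPolynomial.C r : MvPolynomial (Fin j) R) • p =
        Polynomial.monomial 0 (algebraMap R S r) • p := by
    intro r p
    rw [hsmul, ← MvPolynomial.algebraMap_eq, AlgHom.commutes]; rfl
  let gr := gradedSubmodule x hX hC
  have hgr : ∀ N hN p, p ∈ gr N hN ↔ ∀ n, p.coeff n ∈ N n := fun _ _ _ => Iff.rfl
  have hsingle : ∀ N hN n a, a ∈ N n → PolynomialModule.single S n a ∈ gr N hN := by
    intro N hN n a ha m
    rw [PolynomialModule.coeff_single, Finsupp.single_apply]
    split_ifs with h
    · exact h ▸ ha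
    · exact (N m).zero_mem
  -- Generators: the one-term polynomials carrying generators of V n modulo U n, for n ≤ n0.
  have hrel : RelFG (gr U xU) (gr V xV) := by
    choose F hF hFV hVF using hfg
    choose s hs using hF
    let G : Submodule (MvPolynomial (Fin j) R) (PolynomialModule S A) :=
      Submodule.span _ (((Finset.range (n0 + 1)).biUnion
        fun n => (s n).image (PolynomialModule.single S n) :) : Set (PolynomialModule S A))
    have hG : G.FG := ⟨_, rfl⟩
    have hCs : ∀ (r : R) n (a : A), PolynomialModule.single S n (r • a) =
        (MvPolynomial.C r : MvPolynomial (Fin j) R) • PolynomialModule.single S n a := by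
      intro r n a
      rw [hC, PolynomialModule.monomial_smul_single, zero_add, algebraMap_smul]
    have hXs : ∀ i n (a : A), PolynomialModule.single S (n + 1) (x i • a) =
        (MvPolynomial.X i : MvPolynomial (Fin j) R) • PolynomialModule.single S n a := by
      intro r n a
      rw [hX, PolynomialModule.monomial_smul_single, add_comm]
    have hbase : ∀ n ≤ n0, ∀ a ∈ V n, PolynomialModule.single S n a ∈ gr U xU ⊔ G := by
      intro n hn a ha
      obtain ⟨b, hb, c, hc, rfl⟩ := Submodule.mem_sup.1 (hVF n ha)
      rw [PolynomialModule.single_add]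
      refine add_mem (Submodule.mem_sup_left (hsingle _ _ _ _ hb)) (Submodule.mem_sup_right ?_)
      clear hVF hFV ha
      rw [← hs n] at hc
      induction hc using Submodule.span_induction with
      | mem y hy =>
        refine Submodule.subset_span ?_
        simp only [Finset.coe_biUnion, Set.mem_iUnion, Finset.coe_image]
        exact ⟨n, by simpa using Nat.lt_succ_of_le hn, y, hy, rfl⟩
      | zero => rw [PolynomialModule.single_zero]; exact zero_mem _
      | add y z _ _ h1 h2 => rw [PolynomialModule.single_add]; exact add_mem h1 h2
      | smul r y _ h1 => rw [hCs]; exact G.smul_mem _ h1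
    have hall : ∀ n, ∀ a ∈ V n, PolynomialModule.single S n a ∈ gr U xU ⊔ G := by
      intro n
      induction n with
      | zero => exact hbase 0 (Nat.zero_le _)
      | succ n ih =>
        intro a ha
        rcases Nat.lt_or_ge n n0 with h | h
        · exact hbase _ h a ha
        · obtain ⟨b, hb, c, hc, rfl⟩ := Submodule.mem_sup.1 (hgen n h ha)
          rw [PolynomialModule.single_add]
          refine add_mem (Submodule.mem_sup_left (hsingle _ _ _ _ hb)) ?_
          have : ∀ c ∈ ⨆ i, (V n).map (smulBy R A (x i)),
              PolynomialModule.single S (n + 1) c ∈ gr U xU ⊔ G := by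
            intro c hc
            induction hc using Submodule.iSup_induction' with
            | mem i c hc =>
              obtain ⟨d, hd, rfl⟩ := hc
              have : (smulBy R A (x i)) d = x i • d := rfl
              rw [this, hXs]
              exact Submodule.smul_mem _ _ (ih d hd)
            | zero => rw [PolynomialModule.single_zero]; exact zero_mem _
            | add c d _ _ h1 h2 => rw [PolynomialModule.single_add]; exact add_mem h1 h2
          exact this c hc
    refine RelFG.of_le_sup hG ?_
    intro p hp
    have hp' : p = ∑ n ∈ p.coeff.support, PolynomialModule.single S n (p.coeff n) := by
      apply PolynomialModule.coeff_injective
      rw [PolynomialModule.coeff_sum]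
      exact (Finsupp.sum_single p.coeff).symm
    rw [hp']
    exact sum_mem fun n _ => hall n _ (hp n)
  obtain ⟨F, ⟨s, rfl⟩, hFN, hNF⟩ := hrel.mono (U' := gr U xU) (V' := gr N xN) le_rfl
    (fun p hp n => hNV n (hp n))
  -- The largest exponent occurring in the chosen generators of N modulo U.
  let n1 := s.sup fun p => p.coeff.support.sup id
  have hn1 : ∀ p ∈ s, ∀ n, n1 < n → p.coeff n = 0 := by
    intro p hp n hn
    by_contra h
    have h1 : n ≤ p.coeff.support.sup id := Finset.le_sup (f := id) (Finsupp.mem_support_iff.2 h)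
    exact absurd (h1.trans (Finset.le_sup (f := fun p => p.coeff.support.sup id) hp)) (not_le.2 hn)
  -- Q keeps N up to degree n1 and only what is generated from the previous degree afterwards. It is
  -- stable under the x_i and contains U and all generators of N, so it contains N; reading off
  -- degree n + 1 gives the claim.
  let Q : ℕ → Submodule R A := fun n =>
    if n ≤ n1 then N n else U n ⊔ ⨆ i, (N (n - 1)).map (smulBy R A (x i))
  have hUQ : ∀ n, U n ≤ Q n := by
    intro n; simp only [Q]; split_ifs
    · exact hUN n
    · exact le_sup_left
  have hxi : ∀ n i, ∀ a ∈ N n, x i • a ∈ Q (n + 1) := by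
    intro n i a ha; simp only [Q]; split_ifs
    · exact xN n i a ha
    · exact Submodule.mem_sup_right (Submodule.mem_iSup_of_mem i ⟨a, ha, rfl⟩)
  have hQN : ∀ n, Q n ≤ N n := by
    intro n; simp only [Q]; split_ifs with h
    · exact le_rfl
    · refine sup_le (hUN n) (iSup_le fun i => ?_)
      rintro _ ⟨a, ha, rfl⟩
      have := xN (n - 1) i a ha
      rwa [Nat.sub_add_cancel (by omega)] at this
  have xQ : ∀ n i, ∀ a ∈ Q n, x i • a ∈ Q (n + 1) := fun n i a ha => hxi n i a (hQN n ha)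
  have hNQ : gr N xN ≤ gr Q xQ := by
    refine hNF.trans (sup_le (fun p hp n => hUQ n (hp n)) ?_)
    rw [Submodule.span_le]
    intro p hp n
    by_cases hn : n ≤ n1
    · have := hFN (Submodule.subset_span hp) n
      simpa only [Q, if_pos hn] using this
    · rw [hn1 p hp n (not_le.1 hn)]; exact zero_mem _
  refine ⟨n1, fun n hn a ha => ?_⟩
  have := hNQ (hsingle N xN (n + 1) a ha) (n + 1)
  rw [PolynomialModule.coeff_single, Finsupp.single_apply, if_pos rfl] at this
  simpa only [Q, if_neg (not_le.2 (Nat.lt_succ_of_le hn)), Nat.add_sub_cancel] using this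

end Graded

/-! ### A uniform Artin–Rees lemma via power series -/

section ArtinRees

/-- The Artin-Rees lemma, modulo a submodule. -/
theorem exists_artinRees_relative {P F : Type*} [CommRing P] [IsNoetherianRing P] [AddCommGroup F]
    [Module P F] [Module.Finite P F] (I : Ideal P) (K N : Submodule P F) :
    ∃ k, ∀ n, (I ^ n • ⊤ ⊔ K) ⊓ N ≤ I ^ (n - k) • N ⊔ K := by
  -- The usual Artin–Rees lemma for the image of N in F / K.
  obtain ⟨k, hk⟩ := Ideal.exists_pow_inf_eq_pow_smul I (N.map K.mkQ)
  refine ⟨k, fun n => ?_⟩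
  rcases le_or_gt k n with h | h
  · intro y hy
    have h1 : K.mkQ y ∈ I ^ n • ⊤ ⊓ N.map K.mkQ := by
      refine ⟨?_, ⟨y, hy.2, rfl⟩⟩
      obtain ⟨a, ha, b, hb, rfl⟩ := Submodule.mem_sup.1 hy.1
      have : K.mkQ b = 0 := (Submodule.Quotient.mk_eq_zero _).2 hb
      rw [map_add, this, add_zero]
      have h2 : (I ^ n • ⊤ : Submodule P F).map K.mkQ ≤ I ^ n • ⊤ := by
        rw [Submodule.map_smul'']
        exact smul_mono_right _ le_top
      exact h2 ⟨a, ha, rfl⟩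
    rw [hk n h] at h1
    have h2 : I ^ (n - k) • (I ^ k • ⊤ ⊓ N.map K.mkQ) ≤ (I ^ (n - k) • N).map K.mkQ := by
      rw [Submodule.map_smul'']
      exact smul_mono_right _ inf_le_right
    obtain ⟨z, hz, hzy⟩ := h2 h1
    have h3 : y - z ∈ K := by
      rw [← Submodule.Quotient.mk_eq_zero, Submodule.Quotient.mk_sub, sub_eq_zero]
      exact hzy.symm
    have : y = z + (y - z) := by abel
    rw [this]
    exact Submodule.add_mem_sup hz h3
  · rw [Nat.sub_eq_zero_of_le h.le, pow_zero, Ideal.one_eq_top, Submodule.top_smul]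
    exact inf_le_right.trans le_sup_left

variable {O : Type*} [CommRing O] (τ : O)

/-- The value at `τ` of the truncation of a power series. -/
noncomputable def truncEval (n : ℕ) (s : PowerSeries O) : O := (s.trunc n).eval τ

theorem truncEval_eq_sum (n : ℕ) (s : PowerSeries O) :
    truncEval τ n s = ∑ i ∈ Finset.range n, PowerSeries.coeff i s * τ ^ i := by
  rw [truncEval, Polynomial.eval, PowerSeries.eval₂_trunc_eq_sum_range]
  simp

theorem truncEval_add (n : ℕ) (s t : PowerSeries O) :
    truncEval τ n (s + t) = truncEval τ n s + truncEval τ n t := by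
  simp [truncEval]

theorem dvd_eval_sub_truncEval (n : ℕ) (q : O[X]) :
    τ ^ n ∣ q.eval τ - truncEval τ n (q : PowerSeries O) := by
  have : Polynomial.X ^ n ∣ q - (q : PowerSeries O).trunc n := by
    rw [Polynomial.X_pow_dvd_iff]
    intro d hd
    rw [Polynomial.coeff_sub, PowerSeries.coeff_trunc, if_pos hd, Polynomial.coeff_coe, sub_self]
  have h := map_dvd (Polynomial.evalRingHom τ) this
  simpa [truncEval] using h

/-- A power series has no value at τ in O; its truncations do, and they are multiplicative up to
τ^n, which is enough for τ-adic statements. -/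
theorem dvd_truncEval_mul (n : ℕ) (s t : PowerSeries O) :
    τ ^ n ∣ truncEval τ n s * truncEval τ n t - truncEval τ n (s * t) := by
  have h := dvd_eval_sub_truncEval τ n (s.trunc n * t.trunc n)
  rw [Polynomial.eval_mul, Polynomial.coe_mul] at h
  rwa [truncEval, truncEval, truncEval, ← PowerSeries.trunc_trunc_mul_trunc]

theorem dvd_truncEval_X_pow (n j : ℕ) :
    τ ^ n ∣ τ ^ j - truncEval τ n (PowerSeries.X ^ j : PowerSeries O) := by
  simpa using dvd_eval_sub_truncEval τ n (Polynomial.X ^ j)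

theorem dvd_truncEval_C (n : ℕ) (t : O) :
    τ ^ n ∣ t - truncEval τ n (PowerSeries.C t : PowerSeries O) := by
  simpa using dvd_eval_sub_truncEval τ n (Polynomial.C t)

variable {M : Type*} [AddCommGroup M] [Module O M] {ι : Type*} [Fintype ι] (D : Submodule O M)
  (d : ι → M)

/-- The vector `p` of power series, evaluated at `τ` and paired with `d`, converges to `m` in the
`τ`-adic topology of `D`. -/
def IsSeriesLift (p : ι → PowerSeries O) (m : M) : Prop :=
  ∀ n, ∃ y ∈ D, m - ∑ a, truncEval τ n (p a) • d a = τ ^ n • y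

variable {τ D d}

theorem IsSeriesLift.add {p q : ι → PowerSeries O} {m m' : M} (h : IsSeriesLift τ D d p m)
    (h' : IsSeriesLift τ D d q m') : IsSeriesLift τ D d (p + q) (m + m') := by
  intro n
  obtain ⟨y, hy, e⟩ := h n
  obtain ⟨z, hz, e'⟩ := h' n
  refine ⟨y + z, D.add_mem hy hz, ?_⟩
  simp only [Pi.add_apply, truncEval_add, add_smul, Finset.sum_add_distrib, smul_add, ← e, ← e']
  abel

theorem IsSeriesLift.zero : IsSeriesLift τ D d 0 0 :=
  fun n => ⟨0, D.zero_mem, by simp [truncEval]⟩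

/-- A single level n of `IsSeriesLift.smul`. Fixing n lets t depend on it: `seriesRelations` takes t
to be the n-th truncation of s, as s itself has no value. -/
theorem exists_sub_sum_truncEval_smul (hd : ∀ a, d a ∈ D) {p : ι → PowerSeries O} {m : M} (n : ℕ)
    (h : ∃ y ∈ D, m - ∑ a, truncEval τ n (p a) • d a = τ ^ n • y) (s : PowerSeries O) (t : O)
    (hm : m ∈ D) (hs : τ ^ n ∣ t - truncEval τ n s) :
    ∃ y ∈ D, t • m - ∑ a, truncEval τ n ((s • p) a) • d a = τ ^ n • y := by
  obtain ⟨y, hy, e⟩ := h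
  obtain ⟨c, hc⟩ := hs
  choose b hb using fun a => dvd_truncEval_mul τ n s (p a)
  refine ⟨truncEval τ n s • y + c • m + ∑ a, b a • d a, add_mem (add_mem (D.smul_mem _ hy)
    (D.smul_mem _ hm)) (sum_mem fun a _ => D.smul_mem _ (hd a)), ?_⟩
  have h1 : ∀ a, truncEval τ n ((s • p) a) =
      truncEval τ n s * truncEval τ n (p a) - τ ^ n * b a := by
    intro a; rw [← hb]; simp
  have h2 : t = truncEval τ n s + τ ^ n * c := by rw [← hc]; ring
  have h3 : m = τ ^ n • y + ∑ a, truncEval τ n (p a) • d a := by rw [← e]; abel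
  simp only [h1, sub_smul, Finset.sum_sub_distrib, smul_add, Finset.smul_sum, smul_smul]
  have h4 : t • m = (truncEval τ n s * τ ^ n) • y +
      ∑ a, (truncEval τ n s * truncEval τ n (p a)) • d a + (τ ^ n * c) • m := by
    conv_lhs => rw [h2, add_smul]
    nth_rewrite 1 [h3]
    simp only [smul_add, Finset.smul_sum, smul_smul]
  rw [h4, mul_comm (τ ^ n) (truncEval τ n s)]
  abel

/-- Multiplication by a power series `s` is compatible with multiplication by a scalar `t` that
is the value of `s` at `τ`. -/
theorem IsSeriesLift.smul (hd : ∀ a, d a ∈ D) {p : ι → PowerSeries O} {m : M}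
    (h : IsSeriesLift τ D d p m) (s : PowerSeries O) (t : O)
    (hm : m ∈ D) (hs : ∀ n, τ ^ n ∣ t - truncEval τ n s) :
    IsSeriesLift τ D d (s • p) (t • m) :=
  fun n => exists_sub_sum_truncEval_smul hd n (h n) s t hm (hs n)

variable (τ) in
/-- Power-series expansion of the elements of `D`, along generators of `D` modulo `τ`. -/
theorem exists_isSeriesLift (s : Finset ι) (V : Submodule O M)
    (hV : ∀ v ∈ V, ∃ r : ι → O, ∃ v' ∈ V, v = ∑ a ∈ s, r a • d a + τ • v') {v : M} (hv : v ∈ V) :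
    ∃ p : ι → PowerSeries O, (∀ a ∉ s, p a = 0) ∧ IsSeriesLift τ V d p v := by
  classical
  choose r f hf hrf using fun v : V => hV v v.2
  let g : V → V := fun v => ⟨f v, hf v⟩
  let w : V := ⟨v, hv⟩
  -- Iterate v = Σ r(v)_a d_a + τ g(v): the i-th coefficient is r at the i-th iterate, and the
  -- remainder after n steps is τ^n times the n-th iterate.
  refine ⟨fun a => if a ∈ s then PowerSeries.mk fun i => r (g^[i] w) a else 0,
    fun a ha => if_neg ha, fun n => ⟨g^[n] w, (g^[n] w).2, ?_⟩⟩
  induction n with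
  | zero => simp [truncEval, w]
  | succ n ih =>
    have h1 : ((g^[n] w : V) : M) = ∑ a ∈ s, r (g^[n] w) a • d a + τ • ((g^[n + 1] w : V) : M) := by
      conv_lhs => rw [hrf (g^[n] w)]
      rw [Function.iterate_succ_apply']
    have h2 : ∀ a, truncEval τ (n + 1) (if a ∈ s then PowerSeries.mk fun i => r (g^[i] w) a else 0)
        = truncEval τ n (if a ∈ s then PowerSeries.mk fun i => r (g^[i] w) a else 0) +
          if a ∈ s then r (g^[n] w) a * τ ^ n else 0 := by
      intro a
      rw [truncEval_eq_sum, truncEval_eq_sum, Finset.sum_range_succ]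
      split_ifs <;> simp
    simp only [h2, add_smul, Finset.sum_add_distrib, ← sub_sub, ih]
    rw [h1, smul_add, Finset.smul_sum, smul_smul, ← pow_succ]
    simp only [ite_smul, zero_smul, Finset.sum_ite_mem, Finset.univ_inter, smul_smul,
      mul_comm _ (τ ^ n)]
    abel

variable (τ D d) in
/-- The relations between the generators `d` of the `τ`-adic completion of `D`. -/
def seriesRelations (hd : ∀ a, d a ∈ D) : Submodule (PowerSeries O) (ι → PowerSeries O) where
  carrier := {p | IsSeriesLift τ D d p 0}
  zero_mem' := .zero
  add_mem' h h' := by simpa using h.add h'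
  smul_mem' s p h := by
    intro n
    obtain ⟨y, hy, e⟩ := exists_sub_sum_truncEval_smul hd n (h n) s (truncEval τ n s) D.zero_mem
      (by simp)
    exact ⟨y, hy, by simpa using e⟩

theorem IsSeriesLift.mono {V : Submodule O M} (hV : V ≤ D) {p : ι → PowerSeries O} {m : M}
    (h : IsSeriesLift τ V d p m) : IsSeriesLift τ D d p m := by
  intro n
  obtain ⟨y, hy, e⟩ := h n
  exact ⟨y, hV hy, e⟩

theorem IsSeriesLift.sub_mem (hd : ∀ a, d a ∈ D) {p q : ι → PowerSeries O} {m : M} (hm : m ∈ D)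
    (h : IsSeriesLift τ D d p m) (h' : IsSeriesLift τ D d q m) :
    p - q ∈ seriesRelations τ D d hd := by
  have := h.add (h'.smul hd (PowerSeries.C (-1)) (-1) hm (fun n => dvd_truncEval_C τ n _))
  have e : p + (PowerSeries.C (-1) : PowerSeries O) • q = p - q := by
    rw [map_neg, map_one, neg_smul, one_smul, sub_eq_add_neg]
  rw [e, neg_smul, one_smul, add_neg_cancel] at this
  exact this

theorem truncEval_X_pow_mul (n : ℕ) (s : PowerSeries O) :
    truncEval τ n (PowerSeries.X ^ n * s) = 0 := by
  rw [truncEval_eq_sum]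
  refine Finset.sum_eq_zero fun i hi => ?_
  rw [PowerSeries.coeff_X_pow_mul', if_neg (by simpa using hi), zero_mul]

theorem isSeriesLift_single [DecidableEq ι] (hd : ∀ a, d a ∈ D) (a : ι) :
    IsSeriesLift τ D d (Pi.single a 1) (d a) := by
  intro n
  obtain ⟨c, hc⟩ := dvd_truncEval_C τ n 1
  refine ⟨c • d a, D.smul_mem _ (hd a), ?_⟩
  rw [Finset.sum_eq_single a, Pi.single_eq_same, smul_smul, ← hc, sub_smul, one_smul, map_one]
  · intro b _ hb
    rw [Pi.single_eq_of_ne hb]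
    simp [truncEval]
  · simp

theorem Ideal.sup_pow_le_pow_sup {P : Type*} [CommRing P] (I J : Ideal P) (n : ℕ) :
    (I ⊔ J) ^ n ≤ I ^ n ⊔ J := by
  induction n with
  | zero => simp
  | succ n ih =>
    rw [pow_succ, pow_succ]
    refine (Ideal.mul_mono ih le_rfl).trans ?_
    rw [Ideal.sup_mul, Ideal.mul_sup, Ideal.mul_sup]
    refine sup_le (sup_le le_sup_left ?_) (sup_le ?_ ?_)
    · exact le_sup_of_le_right (Ideal.mul_le_right (I := I ^ n) (J := J))
    · exact le_sup_of_le_right (Ideal.mul_le_left (I := J) (J := I))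
    · exact le_sup_of_le_right (Ideal.mul_le_left (I := J) (J := J))

/-- Vectors supported in `s`. -/
def supportedVectors (P : Type*) [CommRing P] {ι : Type*} (s : Finset ι) :
    Submodule P (ι → P) where
  carrier := {p | ∀ a ∉ s, p a = 0}
  zero_mem' := fun _ _ => rfl
  add_mem' := fun {p q} hp hq a ha => by rw [Pi.add_apply, hp a ha, hq a ha, add_zero]
  smul_mem' := fun c p hp a ha => by rw [Pi.smul_apply, hp a ha, smul_zero]

/-- The annihilator, modulo `K`, of a family of vectors. -/
def conductorIdeal {P F κ : Type*} [CommRing P] [AddCommGroup F] [Module P F] (K : Submodule P F)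
    (e : κ → F) : Ideal P where
  carrier := {c | ∀ a, c • e a ∈ K}
  zero_mem' := fun a => by rw [zero_smul]; exact K.zero_mem
  add_mem' := fun {c c'} h h' a => by rw [add_smul]; exact K.add_mem (h a) (h' a)
  smul_mem' := fun c c' h a => by rw [smul_assoc]; exact K.smul_mem c (h a)

/-- The part of the standard basis with indices in `s`. -/
def partialBasis (P : Type*) [CommRing P] {ι : Type*} [DecidableEq ι] (s : Finset ι) (a : ι) :
    ι → P := if a ∈ s then Pi.single a 1 else 0

theorem smul_mem_of_mem_conductorIdeal {P : Type*} [CommRing P] [DecidableEq ι] (s : Finset ι)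
    (K : Submodule P (ι → P)) {c : P} (hc : c ∈ conductorIdeal K (partialBasis P s)) {f : ι → P}
    (hf : f ∈ supportedVectors P s) : c • f ∈ K := by
  have : c • f = ∑ a, f a • (c • partialBasis P s a) := by
    ext1 a'
    rw [Finset.sum_apply, Finset.sum_eq_single a']
    · by_cases ha : a' ∈ s
      · simp [partialBasis, ha, mul_comm]
      · simp [partialBasis, ha, hf a' ha]
    · intro b _ hb
      by_cases ha : b ∈ s
      · simp [partialBasis, ha, hb.symm]
      · simp [partialBasis, ha]
    · simp
  rw [this]
  exact sum_mem fun a _ => K.smul_mem _ (hc a)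

/-- With exponent one above the Artin–Rees constant, the intersection lies in J · (vectors supported
in s) + K for the conductor J, and J carries these vectors into K by definition. -/
theorem exists_conductorIdeal_pow_inf_le {P : Type*} [CommRing P] [IsNoetherianRing P] [DecidableEq ι]
    (s : Finset ι) (K : Submodule P (ι → P)) :
    ∃ N, (conductorIdeal K (partialBasis P s) ^ N • ⊤ ⊔ K) ⊓ supportedVectors P s ≤ K := by
  obtain ⟨c, hc⟩ := exists_artinRees_relative (conductorIdeal K (partialBasis P s)) K
    (supportedVectors P s)
  refine ⟨c + 1, (hc (c + 1)).trans (sup_le ?_ le_rfl)⟩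
  rw [Nat.add_sub_cancel_left, pow_one, Submodule.smul_le]
  exact fun r hr f hf => smul_mem_of_mem_conductorIdeal s K hr hf

/-- With P = O[[X]] and X acting as τ, elements of D are expanded as vectors in P^ι modulo the
relations K, and elements of V as vectors supported in s. The ideals J vary with n, but over P each
of them is contained, modulo a power of X, in one fixed ideal, the conductor J'. Only finitely many
applications of Artin–Rees over the Noetherian ring P are then needed, and none of them sees n or J.
-/
theorem exists_uniform_artinRees_aux [IsNoetherianRing O] [DecidableEq ι] (τ : O)
    (D V : Submodule O M) (hVD : V ≤ D) (hd : ∀ a, d a ∈ D) (s : Finset ι)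
    (hdV : ∀ a ∈ s, d a ∈ V)
    (hliftD : ∀ y ∈ D, ∃ p : ι → PowerSeries O, IsSeriesLift τ D d p y)
    (hliftV : ∀ y ∈ V, ∃ p ∈ supportedVectors (PowerSeries O) s, IsSeriesLift τ D d p y)
    (hpure : ∀ n : ℕ, ∀ y ∈ D, τ ^ n • y ∈ V → y ∈ V) :
    ∃ N : ℕ, ∀ h0 : ℕ, ∃ b : ℕ, ∀ n : ℕ, ∀ J : Ideal O,
      (∀ t ∈ J, ∀ v ∈ V, ∃ v' ∈ V, t • v = τ ^ n • v') →
      ∀ a ∈ V, a ∈ J ^ N • D ⊔ D.map (LinearMap.lsmul O M (τ ^ (n - h0))) →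
        ∃ v' ∈ V, a = τ ^ (n - b) • v' := by
  set K := seriesRelations τ D d hd with hK
  set J' := conductorIdeal K (partialBasis (PowerSeries O) s) with hJ'
  set I : Ideal (PowerSeries O) := Ideal.span {PowerSeries.X} with hI
  have hIn : ∀ n : ℕ, I ^ n = Ideal.span {(PowerSeries.X : PowerSeries O) ^ n} := fun n =>
    Ideal.span_singleton_pow _ _
  obtain ⟨N, hN⟩ := exists_conductorIdeal_pow_inf_le s K
  obtain ⟨h1, hh1⟩ := exists_artinRees_relative I (Submodule.pi Set.univ fun _ : ι => K)
    (Submodule.span (PowerSeries O) {partialBasis (PowerSeries O) s})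
  obtain ⟨h2, hh2⟩ := exists_artinRees_relative I (J' ^ N • ⊤ ⊔ K)
    (supportedVectors (PowerSeries O) s)
  refine ⟨N, fun h0 => ⟨max h0 h1 + h2, fun n J hJ a haV ha => ?_⟩⟩
  -- The conditions t e_a ∈ X^n P^ι + K for all a in s are one condition on the single vector
  -- (e_a)_a, which spans a cyclic submodule of (P^ι)^ι. Artin–Rees there gives one u ∈ (X)^(n - h1)
  -- with (t - u) e_a ∈ K for every a.
  have step1 : ∀ t ∈ J, PowerSeries.C t ∈ J' ⊔ I ^ (n - h1) := by
    intro t ht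
    have h3 : (PowerSeries.C t : PowerSeries O) • partialBasis (PowerSeries O) s ∈
        (I ^ n • ⊤ ⊔ Submodule.pi Set.univ fun _ : ι => K) ⊓
          Submodule.span (PowerSeries O) {partialBasis (PowerSeries O) s} := by
      refine ⟨?_, Submodule.smul_mem _ _ (Submodule.subset_span rfl)⟩
      have : ∀ a, ∃ w : ι → PowerSeries O,
          (PowerSeries.C t : PowerSeries O) • partialBasis (PowerSeries O) s a -
            (PowerSeries.X ^ n : PowerSeries O) • w ∈ K := by
        intro a
        by_cases has : a ∈ s
        · obtain ⟨v', hv', e⟩ := hJ t ht (d a) (hdV a has)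
          obtain ⟨w, hw⟩ := hliftD v' (hVD hv')
          refine ⟨w, ?_⟩
          have h4 := (isSeriesLift_single hd a).smul hd (PowerSeries.C t) t (hd a)
            (fun n => dvd_truncEval_C τ n t)
          have h5 := hw.smul hd (PowerSeries.X ^ n) (τ ^ n) (hVD hv')
            (fun m => dvd_truncEval_X_pow τ m n)
          rw [partialBasis, if_pos has]
          rw [← e] at h5
          exact h4.sub_mem hd (D.smul_mem _ (hd a)) h5
        · refine ⟨0, ?_⟩
          rw [partialBasis, if_neg has, smul_zero, smul_zero, sub_zero]
          exact K.zero_mem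
      choose w hw using this
      have e : (PowerSeries.C t : PowerSeries O) • partialBasis (PowerSeries O) s =
          (PowerSeries.X ^ n : PowerSeries O) • w +
          ((PowerSeries.C t : PowerSeries O) • partialBasis (PowerSeries O) s -
            (PowerSeries.X ^ n : PowerSeries O) • w) := by abel
      rw [e]
      refine Submodule.add_mem_sup (Submodule.smul_mem_smul ?_ trivial) ?_
      · rw [hIn]; exact Ideal.mem_span_singleton_self _
      · exact fun a _ => hw a
    obtain ⟨y, hy, z, hz, e⟩ := Submodule.mem_sup.1 (hh1 n h3)
    rw [hIn] at hy
    obtain ⟨u, hu, rfl⟩ := Submodule.mem_smul_span_singleton.1 hy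
    have h4 : PowerSeries.C t - u ∈ J' := by
      intro a
      rw [sub_smul, sub_mem_comm_iff]
      have := congrFun e a
      rw [Pi.add_apply, Pi.smul_apply, Pi.smul_apply] at this
      rw [← this, sub_add_cancel_left]
      exact K.neg_mem (hz a trivial)
    have h5 : PowerSeries.C t = (PowerSeries.C t - u) + u := by ring
    rw [h5]
    refine Submodule.add_mem_sup h4 ?_
    rwa [hIn]
  have step2 : ∀ t ∈ J ^ N, PowerSeries.C t ∈ J' ^ N ⊔ I ^ (n - h1) := by
    intro t ht
    have h3 : (J ^ N).map (PowerSeries.C (R := O)) ≤ J' ^ N ⊔ I ^ (n - h1) := by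
      rw [Ideal.map_pow]
      refine le_trans (Ideal.pow_right_mono ?_ N) (Ideal.sup_pow_le_pow_sup _ _ N)
      rw [Ideal.map_le_iff_le_comap]
      exact step1
    exact h3 (Ideal.mem_map_of_mem _ ht)
  have step3 : ∀ z ∈ J ^ N • D, z ∈ D ∧ ∃ p ∈ (J' ^ N ⊔ I ^ (n - h1)) •
      (⊤ : Submodule (PowerSeries O) (ι → PowerSeries O)),
      IsSeriesLift τ D d p z := by
    intro z hz
    induction hz using Submodule.smul_induction_on' with
    | smul t ht y hy =>
      obtain ⟨p, hp⟩ := hliftD y hy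
      exact ⟨D.smul_mem _ hy, _, Submodule.smul_mem_smul (step2 t ht) trivial,
        hp.smul hd _ _ hy fun m => dvd_truncEval_C τ m t⟩
    | add y _ z _ h h' =>
      obtain ⟨h3, p, hp, h4⟩ := h
      obtain ⟨h3', p', hp', h4'⟩ := h'
      exact ⟨add_mem h3 h3', _, add_mem hp hp', h4.add h4'⟩
  obtain ⟨ã, haS, hã⟩ := hliftV a haV
  obtain ⟨z, hz, _, ⟨y, hy, rfl⟩, e⟩ := Submodule.mem_sup.1 ha
  obtain ⟨-, p, hp, hpz⟩ := step3 z hz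
  obtain ⟨q, hq⟩ := hliftD y hy
  have h5 := hq.smul hd (PowerSeries.X ^ (n - h0)) (τ ^ (n - h0)) hy
    (fun m => dvd_truncEval_X_pow τ m _)
  have h6 : IsSeriesLift τ D d (p + (PowerSeries.X ^ (n - h0) : PowerSeries O) • q) a := by
    rw [← e]; exact hpz.add h5
  have h7 := hã.sub_mem hd (hVD haV) h6
  have hImono : ∀ m, n - max h0 h1 ≤ m → I ^ m ≤ I ^ (n - max h0 h1) := fun m hm =>
    Ideal.pow_le_pow_right hm
  have h8 : ã ∈ (I ^ (n - max h0 h1) • ⊤ ⊔ (J' ^ N • ⊤ ⊔ K)) ⊓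
      supportedVectors (PowerSeries O) s := by
    refine ⟨?_, haS⟩
    have e : ã = (p + (PowerSeries.X ^ (n - h0) : PowerSeries O) • q) +
      (ã - (p + (PowerSeries.X ^ (n - h0) : PowerSeries O) • q)) := by abel
    rw [e]
    refine add_mem (add_mem ?_ ?_) (Submodule.mem_sup_right (Submodule.mem_sup_right h7))
    · rw [Submodule.sup_smul] at hp
      have h9 : J' ^ N • (⊤ : Submodule _ (ι → PowerSeries O)) ⊔ I ^ (n - h1) • ⊤ ≤
          I ^ (n - max h0 h1) • ⊤ ⊔ (J' ^ N • ⊤ ⊔ K) :=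
        sup_le (le_sup_left.trans le_sup_right)
          ((Submodule.smul_mono_left (hImono _ (by omega))).trans le_sup_left)
      exact h9 hp
    · refine Submodule.mem_sup_left (Submodule.smul_mem_smul (hImono _ (by omega)
        (?_ : _ ∈ I ^ (n - h0))) trivial)
      rw [hIn]; exact Ideal.mem_span_singleton_self _
  obtain ⟨f, hf, g, hg, e2⟩ := Submodule.mem_sup.1 (hh2 _ h8)
  have hm : n - max h0 h1 - h2 = n - (max h0 h1 + h2) := by omega
  rw [hm] at hf
  set m := n - (max h0 h1 + h2)
  -- Both ã and f are supported in s, hence so is g, and the choice of N applies.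
  have hgK : g ∈ K := by
    refine hN ⟨hg, ?_⟩
    have : g = ã - f := by rw [← e2]; abel
    rw [this]
    exact sub_mem haS (Submodule.smul_le_right hf)
  rw [hIn, Submodule.ideal_span_singleton_smul] at hf
  obtain ⟨f', -, rfl⟩ := hf
  obtain ⟨y1, hy1, e3⟩ := hã m
  obtain ⟨y2, hy2, e4⟩ := hgK m
  have h10 : a = τ ^ m • (y1 - y2) := by
    rw [smul_sub, ← e3, ← e4, ← e2]
    have : ∀ a, truncEval τ m (((DistribSMul.toLinearMap (PowerSeries O) (ι → PowerSeries O)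
      (PowerSeries.X ^ m : PowerSeries O)) f' + g) a) = truncEval τ m (g a) := by
      intro a
      rw [Pi.add_apply, truncEval_add]
      simp [truncEval_X_pow_mul]
    simp only [this]
    abel
  -- The quotient of a by τ^m is found only in D; purity moves it into V.
  exact ⟨_, hpure m _ (sub_mem hy1 hy2) (h10 ▸ haV), h10⟩

/-- A uniform Artin-Rees lemma for the ideals `J n = (τ ^ n V : V)`. -/
theorem exists_uniform_artinRees [IsNoetherianRing O] (τ : O) (D V : Submodule O M) (hVD : V ≤ D)
    (hD : RelFG (D.map (LinearMap.lsmul O M τ)) D) (hV : RelFG (V.map (LinearMap.lsmul O M τ)) V)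
    (hpure : ∀ n : ℕ, ∀ y ∈ D, τ ^ n • y ∈ V → y ∈ V) :
    ∃ N : ℕ, ∀ h0 : ℕ, ∃ b : ℕ, ∀ n : ℕ, ∀ J : Ideal O,
      (∀ t ∈ J, ∀ v ∈ V, ∃ v' ∈ V, t • v = τ ^ n • v') →
      ∀ a ∈ V, a ∈ J ^ N • D ⊔ D.map (LinearMap.lsmul O M (τ ^ (n - h0))) →
        ∃ v' ∈ V, a = τ ^ (n - b) • v' := by
  classical
  obtain ⟨_, ⟨sD, rfl⟩, hsD, hD⟩ := hD
  obtain ⟨_, ⟨sV, rfl⟩, hsV, hV⟩ := hV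
  -- One index set for generators of both D and V modulo τ; s marks those that come from V.
  let d : ↥(sV ∪ sD) → M := fun a => a
  let s : Finset ↥(sV ∪ sD) := Finset.univ.filter fun a => (a : M) ∈ sV
  have hd : ∀ a, d a ∈ D := by
    rintro ⟨a, ha⟩
    rcases Finset.mem_union.1 ha with h | h
    · exact hVD (hsV (Submodule.subset_span h))
    · exact hsD (Submodule.subset_span h)
  have hdV : ∀ a ∈ s, d a ∈ V := fun a ha =>
    hsV (Submodule.subset_span (Finset.mem_filter.1 ha).2)
  have hspan : ∀ (t : Finset ↥(sV ∪ sD)) (u : Finset M), (∀ y ∈ u, ∃ a ∈ t, d a = y) →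
      ∀ y ∈ Submodule.span O (u : Set M), ∃ r : ↥(sV ∪ sD) → O, ∑ a ∈ t, r a • d a = y := by
    intro t u hu y hy
    have : Submodule.span O (u : Set M) ≤ Submodule.span O (d '' (t : Set _)) := by
      refine Submodule.span_mono fun y hy => ?_
      obtain ⟨a, ha, rfl⟩ := hu y hy
      exact ⟨a, ha, rfl⟩
    exact (Submodule.mem_span_image_finset_iff_exists_fun' O).1 (this hy)
  have hlift : ∀ (t : Finset ↥(sV ∪ sD)) (u : Finset M) (W : Submodule O M),
      (∀ y ∈ u, ∃ a ∈ t, d a = y) →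
      W ≤ W.map (LinearMap.lsmul O M τ) ⊔ Submodule.span O (u : Set M) → ∀ v ∈ W,
      ∃ p : ↥(sV ∪ sD) → PowerSeries O, (∀ a ∉ t, p a = 0) ∧ IsSeriesLift τ W d p v := by
    intro t u W hu hW v hv
    refine exists_isSeriesLift τ t W (fun v hv => ?_) hv
    obtain ⟨_, ⟨v', hv', rfl⟩, y, hy, rfl⟩ := Submodule.mem_sup.1 (hW hv)
    obtain ⟨r, rfl⟩ := hspan t u hu y hy
    exact ⟨r, v', hv', add_comm _ _⟩
  refine exists_uniform_artinRees_aux τ D V hVD hd s hdV (fun y hy => ?_) (fun y hy => ?_) hpure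
  · obtain ⟨p, -, hp⟩ := hlift Finset.univ sD D
      (fun y hy => ⟨⟨y, Finset.mem_union_right _ hy⟩, Finset.mem_univ _, rfl⟩) hD y hy
    exact ⟨p, hp⟩
  · obtain ⟨p, hp', hp⟩ := hlift s sV V
      (fun y hy => ⟨⟨y, Finset.mem_union_left _ hy⟩,
        Finset.mem_filter.2 ⟨Finset.mem_univ _, hy⟩, rfl⟩) hV y hy
    exact ⟨p, hp', hp.mono hVD⟩

end ArtinRees

/-! ### Finite differences of polynomials -/

section Difference

/-- The forward difference of a polynomial. -/
noncomputable def forwardDiff (q : ℝ[X]) : ℝ[X] := q.comp (Polynomial.X + 1) - q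

theorem forwardDiff_eval (q : ℝ[X]) (t : ℝ) :
    (forwardDiff q).eval t = q.eval (t + 1) - q.eval t := by
  simp [forwardDiff]

theorem forwardDiff_add (p q : ℝ[X]) : forwardDiff (p + q) = forwardDiff p + forwardDiff q := by
  simp only [forwardDiff, Polynomial.add_comp]; ring

theorem coeff_forwardDiff_monomial (d m : ℕ) (c : ℝ) :
    (forwardDiff (Polynomial.C c * Polynomial.X ^ d)).coeff m =
      if m < d then c * (d.choose m : ℝ) else 0 := by
  simp only [forwardDiff, Polynomial.mul_comp, Polynomial.C_comp, Polynomial.pow_comp,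
    Polynomial.X_comp, ← mul_sub, Polynomial.coeff_C_mul, Polynomial.coeff_sub,
    Polynomial.coeff_X_add_one_pow, Polynomial.coeff_X_pow]
  rcases lt_trichotomy m d with h | h | h
  · simp [h, h.ne]
  · simp [h]
  · simp [h.ne', Nat.choose_eq_zero_of_lt h, h.not_gt]

/-- Discrete integration: the difference of t^(d+1) has leading term (d+1) t^d, so a multiple of
t^(d+1) removes the top coefficient and lowers the degree. -/
theorem exists_forwardDiff_eq (d : ℕ) (q : ℝ[X]) (hq : q.degree < d) :
    ∃ Q : ℝ[X], Q.degree < (d + 1 : ℕ) ∧ forwardDiff Q = q := by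
  induction d generalizing q with
  | zero =>
    have : q = 0 := by simpa using hq
    exact ⟨0, by simp, by simp [forwardDiff, this]⟩
  | succ d ih =>
    set Q1 : ℝ[X] := Polynomial.C (q.coeff d / (d + 1)) * Polynomial.X ^ (d + 1) with hQ1
    have h1 : (q - forwardDiff Q1).degree < d := by
      rw [Polynomial.degree_lt_iff_coeff_zero]
      intro m hm
      rw [Polynomial.coeff_sub, coeff_forwardDiff_monomial]
      rcases hm.eq_or_lt with rfl | h
      · have : ((d : ℝ) + 1) ≠ 0 := by positivity
        rw [if_pos (Nat.lt_succ_self _), Nat.choose_succ_self_right]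
        push_cast
        field_simp
        ring
      · rw [if_neg (by omega), Polynomial.coeff_eq_zero_of_degree_lt (hq.trans_le (by
          exact_mod_cast h)), sub_zero]
    obtain ⟨Q2, h2, h3⟩ := ih _ h1
    refine ⟨Q1 + Q2, ?_, by rw [forwardDiff_add, h3]; ring⟩
    refine (Polynomial.degree_add_le _ _).trans_lt (max_lt ?_ (h2.trans ?_))
    · refine (Polynomial.degree_C_mul_X_pow_le _ _).trans_lt ?_
      exact_mod_cast Nat.lt_succ_self _
    · exact_mod_cast Nat.lt_succ_self _

theorem coeff_forwardDiff {q : ℝ[X]} {d : ℕ} (hq : q.natDegree ≤ d + 1) :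
    (forwardDiff q).coeff d = (d + 1) * q.coeff (d + 1) ∧ (forwardDiff q).natDegree ≤ d := by
  have key : ∀ m ≥ d, (forwardDiff q).coeff m = if m = d then (d + 1) * q.coeff (d + 1) else 0 := by
    intro m hm
    have h : forwardDiff q = ∑ i ∈ Finset.range (d + 2),
        forwardDiff (Polynomial.C (q.coeff i) * Polynomial.X ^ i) := by
      conv_lhs => rw [q.as_sum_range_C_mul_X_pow' (Nat.lt_succ_of_le hq)]
      let f : ℝ[X] →+ ℝ[X] := ⟨⟨forwardDiff, by simp [forwardDiff]⟩, forwardDiff_add⟩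
      exact map_sum f _ _
    rw [h, Polynomial.finsetSum_coeff]
    simp only [coeff_forwardDiff_monomial]
    rw [Finset.sum_eq_single (d + 1)]
    · split_ifs with h1 h2 h2
      · subst h2; rw [Nat.choose_succ_self_right]; push_cast; ring
      · omega
      · omega
      · rfl
    · intro b hb hbd
      rw [if_neg]
      have := Finset.mem_range.1 hb
      omega
    · simp
  refine ⟨by simpa using key d le_rfl, ?_⟩
  rw [Polynomial.natDegree_le_iff_coeff_eq_zero]
  intro m hm
  rw [key m hm.le, if_neg hm.ne']

theorem leadingCoeff_forwardDiff_nonneg {q : ℝ[X]} (hq : 0 ≤ q.leadingCoeff) :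
    0 ≤ (forwardDiff q).leadingCoeff := by
  rcases Nat.eq_zero_or_pos q.natDegree with h | h
  · rw [Polynomial.eq_C_of_natDegree_eq_zero h]
    simp [forwardDiff]
  · obtain ⟨d, hd⟩ := Nat.exists_eq_add_of_lt h
    rw [zero_add] at hd
    obtain ⟨h1, h2⟩ := coeff_forwardDiff hd.le
    have h3 : (forwardDiff q).coeff d ≠ 0 := by
      rw [h1, ← hd]
      refine mul_ne_zero (by positivity) ?_
      intro h0
      rw [Polynomial.coeff_natDegree, Polynomial.leadingCoeff_eq_zero] at h0
      simp [h0] at h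
    have h4 : (forwardDiff q).natDegree = d := le_antisymm h2 (Polynomial.le_natDegree_of_ne_zero h3)
    rw [Polynomial.leadingCoeff, h4, h1, ← hd, Polynomial.coeff_natDegree]
    positivity

theorem leadingCoeff_nonneg_of_eventually {q : ℝ[X]} (h : ∀ᶠ n : ℕ in atTop, 0 ≤ q.eval (n : ℝ)) :
    0 ≤ q.leadingCoeff := by
  by_contra hneg
  push Not at hneg
  rcases Nat.eq_zero_or_pos q.natDegree with hd | hd
  · obtain ⟨n, hn⟩ := h.exists
    rw [Polynomial.eq_C_of_natDegree_eq_zero hd] at hn hneg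
    simp at hn hneg
    linarith
  · have h1 := (q.tendsto_atBot_of_leadingCoeff_nonpos
      (Polynomial.natDegree_pos_iff_degree_pos.1 hd) hneg.le).comp tendsto_natCast_atTop_atTop
    obtain ⟨n, hn, hn'⟩ := (h.and (h1.eventually (eventually_lt_atBot 0))).exists
    exact absurd hn (not_le.2 hn')

theorem polynomial_eq_of_eventually {p q : ℝ[X]}
    (h : ∀ᶠ n : ℕ in atTop, p.eval (n : ℝ) = q.eval (n : ℝ)) : p = q := by
  refine Polynomial.eq_of_infinite_eval_eq p q ?_
  obtain ⟨n0, hn0⟩ := eventually_atTop.1 h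
  refine ((Set.Ici_infinite n0).image (f := fun n : ℕ => (n : ℝ))
    (Nat.cast_injective.injOn)).mono ?_
  rintro _ ⟨n, hn, rfl⟩
  exact hn0 n hn

end Difference

/-! ### The Hilbert–Serre theorem for length functions -/

section Hilbert

/-- The sequence `a` is finite and given by the polynomial `q` in large degrees. -/
def IsEventuallyPoly (a : ℕ → ℝ≥0∞) (q : ℝ[X]) : Prop :=
  ∀ᶠ n : ℕ in atTop, 0 ≤ q.eval (n : ℝ) ∧ a n = ENNReal.ofReal (q.eval (n : ℝ))

theorem IsEventuallyPoly.toReal {a : ℕ → ℝ≥0∞} {q : ℝ[X]} (h : IsEventuallyPoly a q) :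
    ∀ᶠ n : ℕ in atTop, (a n).toReal = q.eval (n : ℝ) := by
  filter_upwards [h] with n hn
  rw [hn.2, ENNReal.toReal_ofReal hn.1]

theorem IsEventuallyPoly.of_toReal {a : ℕ → ℝ≥0∞} {q : ℝ[X]} (ha : ∀ᶠ n in atTop, a n ≠ ∞)
    (h : ∀ᶠ n : ℕ in atTop, (a n).toReal = q.eval (n : ℝ)) : IsEventuallyPoly a q := by
  filter_upwards [ha, h] with n hn hn'
  rw [← hn', ENNReal.ofReal_toReal hn]
  exact ⟨ENNReal.toReal_nonneg, rfl⟩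

/-- The recursion is written without subtraction because the values lie in [0, ∞]. All terms being
finite, it becomes a(n+1) - a(n) = p(n) - r(n) over the reals for large n, and a is a discrete
integral up to a constant. -/
theorem exists_isEventuallyPoly_of_diff {a b c : ℕ → ℝ≥0∞} (ha : ∀ n, a n ≠ ∞)
    {p r : ℝ[X]} {d : ℕ} (hp : p.degree < d) (hr : r.degree < d) (hb : IsEventuallyPoly b p)
    (hc : IsEventuallyPoly c r) (hb' : ∀ n, b n ≠ ∞) (hc' : ∀ n, c n ≠ ∞)
    (h : ∀ n, a (n + 1) + c n = a n + b n) :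
    ∃ q : ℝ[X], q.degree < (d + 1 : ℕ) ∧ forwardDiff q = p - r ∧ IsEventuallyPoly a q := by
  obtain ⟨Q, hQ, hQ'⟩ := exists_forwardDiff_eq d (p - r)
    ((Polynomial.degree_sub_le _ _).trans_lt (max_lt hp hr))
  obtain ⟨n0, hn0⟩ := eventually_atTop.1 (hb.toReal.and hc.toReal)
  have h1 : ∀ n ≥ n0, (a n).toReal = Q.eval (n : ℝ) + ((a n0).toReal - Q.eval (n0 : ℝ)) := by
    intro n hn
    induction n, hn using Nat.le_induction with
    | base => ring
    | succ n hn ih =>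
      have h2 := congrArg ENNReal.toReal (h n)
      rw [ENNReal.toReal_add (ha _) (hc' _), ENNReal.toReal_add (ha _) (hb' _), (hn0 n hn).1,
        (hn0 n hn).2] at h2
      have h3 := forwardDiff_eval Q (n : ℝ)
      rw [hQ', Polynomial.eval_sub] at h3
      push_cast
      linarith
  refine ⟨Q + Polynomial.C ((a n0).toReal - Q.eval (n0 : ℝ)), ?_, ?_, ?_⟩
  · refine (Polynomial.degree_add_le _ _).trans_lt (max_lt hQ
      (Polynomial.degree_C_le.trans_lt ?_))
    exact_mod_cast Nat.succ_pos d
  · rw [forwardDiff_add, hQ']; simp [forwardDiff]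
  · refine .of_toReal (.of_forall ha) (eventually_atTop.2 ⟨n0, fun n hn => ?_⟩)
    rw [h1 n hn]; simp

variable {R : Type u} {S : Type*} {A : Type v} [CommRing R] [IsNoetherianRing R] [CommRing S]
  [Algebra R S] [AddCommGroup A] [Module R A] [Module S A] [IsScalarTower R S A]
  (lam : LengthFunction.{u, v} R)

/-- The Hilbert-Serre theorem for generalized length functions. -/
theorem exists_hilbertPoly {j : ℕ} (x : Fin j → S) (U V : ℕ → Submodule R A)
    (hUV : ∀ n, U n ≤ V n) (xU : ∀ n i, ∀ a ∈ U n, x i • a ∈ U (n + 1))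
    (xV : ∀ n i, ∀ a ∈ V n, x i • a ∈ V (n + 1)) (hfg : ∀ n, RelFG (U n) (V n)) (n0 : ℕ)
    (hgen : ∀ n ≥ n0, V (n + 1) ≤ U (n + 1) ⊔ ⨆ i, (V n).map (smulBy R A (x i)))
    (hlen : ∀ n, relLen lam (U n) (V n) ≠ ∞) :
    ∃ q : ℝ[X], q.degree < j ∧ IsEventuallyPoly (fun n => relLen lam (U n) (V n)) q := by
  induction j generalizing U V n0 with
  | zero =>
    refine ⟨0, by simp, eventually_atTop.2 ⟨n0 + 1, fun n hn => ?_⟩⟩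
    obtain ⟨m, rfl⟩ := Nat.exists_eq_add_of_lt hn
    have := hgen (n0 + m) (by omega)
    simp only [iSup_of_empty, sup_bot_eq] at this
    simp only [Polynomial.eval_zero, le_refl, ENNReal.ofReal_zero, true_and]
    exact relLen_eq_zero lam this
  | succ j ih =>
    let y := x (Fin.last j)
    let x' : Fin j → S := fun i => x i.castSucc
    -- K n / U n is the kernel of the last variable y on the graded module V / U, and V (n+1) / U' n
    -- below is its cokernel. On both y acts as zero, so the remaining variables generate and
    -- induction applies.
    let K : ℕ → Submodule R A := fun n => V n ⊓ (U (n + 1)).comap (smulBy R A y)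
    have hUK : ∀ n, U n ≤ K n := fun n => le_inf (hUV n) fun a ha => xU n _ a ha
    have xK : ∀ n i, ∀ a ∈ K n, x i • a ∈ K (n + 1) := by
      rintro n i a ⟨h1, h2⟩
      refine ⟨xV n i a h1, ?_⟩
      change y • (x i • a) ∈ U (n + 1 + 1)
      rw [smul_comm]
      exact xU _ i _ h2
    obtain ⟨n1, hn1⟩ := exists_graded_generation x U K V hUK (fun n => inf_le_left) xU xK xV hfg
      n0 hgen
    have hsup : ∀ (W : Submodule R A), ⨆ i, W.map (smulBy R A (x i)) =
        (⨆ i, W.map (smulBy R A (x' i))) ⊔ W.map (smulBy R A y) := by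
      intro W
      refine le_antisymm (iSup_le fun i => ?_) (sup_le (iSup_le fun i => ?_) ?_)
      · induction i using Fin.lastCases with
        | last => exact le_sup_right
        | cast i => exact le_sup_of_le_left (le_iSup (fun i => W.map (smulBy R A (x' i))) i)
      · exact le_iSup (fun i => W.map (smulBy R A (x i))) i.castSucc
      · exact le_iSup (fun i => W.map (smulBy R A (x i))) (Fin.last j)
    have hK1 : ∀ n, relLen lam (U n) (V n) = relLen lam (U n) (K n) + relLen lam (K n) (V n) :=
      fun n => relLen_add lam (hUK n) inf_le_left
    obtain ⟨r, hr, hr'⟩ := ih x' U K hUK (fun n i => xU n _) (fun n i => xK n _)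
      (fun n => (hfg n).mono le_rfl inf_le_left) n1 (fun n hn => by
        refine (hn1 n hn).trans ?_
        rw [hsup]
        refine sup_le le_sup_left (sup_le le_sup_right (le_sup_of_le_left ?_))
        rintro _ ⟨a, ha, rfl⟩
        exact ha.2)
      (fun n h => hlen n (by rw [hK1, h, top_add]))
    let U' : ℕ → Submodule R A := fun n => U (n + 1) ⊔ (V n).map (smulBy R A y)
    have hyV : ∀ n, (V n).map (smulBy R A y) ≤ V (n + 1) := by
      rintro n _ ⟨a, ha, rfl⟩; exact xV n _ a ha
    have hU'V : ∀ n, U' n ≤ V (n + 1) := fun n => sup_le (hUV _) (hyV n)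
    have hU1 : ∀ n, relLen lam (U (n + 1)) (V (n + 1)) =
        relLen lam (K n) (V n) + relLen lam (U' n) (V (n + 1)) := by
      intro n
      rw [relLen_add lam (le_sup_left : U (n + 1) ≤ U' n) (hU'V n), relLen_sup_left, relLen_map,
        ← relLen_inf lam _ (V n), inf_comm]
    obtain ⟨p, hp, hp'⟩ := ih x' U' (fun n => V (n + 1)) hU'V (fun n i a ha => by
        obtain ⟨b, hb, _, ⟨c, hc, rfl⟩, rfl⟩ := Submodule.mem_sup.1 ha
        rw [smul_add]
        refine Submodule.add_mem_sup (xU _ _ b hb) ⟨x' i • c, xV _ _ c hc, ?_⟩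
        change y • x' i • c = x' i • y • c
        rw [smul_comm])
      (fun n i => xV _ _) (fun n => (hfg (n + 1)).mono le_sup_left le_rfl) n0 (fun n hn => by
        refine (hgen (n + 1) (by omega)).trans ?_
        rw [hsup]
        exact sup_le (le_sup_left.trans le_sup_left) (sup_le le_sup_right
          (le_sup_right.trans le_sup_left)))
      (fun n h => hlen (n + 1) (by rw [hU1, h, add_top]))
    -- The common term, the length of V n / K n, cancels: ℓ(n+1) + ker(n) = ℓ(n) + coker(n).
    obtain ⟨q, hq, -, hq'⟩ := exists_isEventuallyPoly_of_diff hlen hp hr hp' hr'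
      (fun n h => hlen (n + 1) (by rw [hU1, h, add_top]))
      (fun n h => hlen n (by rw [hK1, h, top_add])) (fun n => by rw [hU1, hK1]; ring)
    exact ⟨q, hq, hq'⟩

end Hilbert

set_option linter.unusedSectionVars false

/-! ### Products of submodules of S with submodules of modules -/

section SubmoduleSMul

variable {R S A B : Type*} [CommRing R] [CommRing S] [Algebra R S] [AddCommGroup A] [Module R A]
  [Module S A] [IsScalarTower R S A] [AddCommGroup B] [Module R B] [Module S B]
  [IsScalarTower R S B]

theorem Submodule.mul_smul_eq (I J : Submodule R S) (N : Submodule R A) :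
    (I * J) • N = I • J • N := by
  apply le_antisymm
  · rw [Submodule.smul_le]
    intro r hr n hn
    induction hr using Submodule.mul_induction_on' with
    | mem_mul_mem a ha b hb =>
      rw [mul_smul]
      exact Submodule.smul_mem_smul ha (Submodule.smul_mem_smul hb hn)
    | add a _ b _ h h' => rw [add_smul]; exact add_mem h h'
  · rw [Submodule.smul_le]
    intro r hr n hn
    induction hn using Submodule.smul_induction_on' with
    | smul a ha b hb =>
      rw [← mul_smul]
      exact Submodule.smul_mem_smul (Submodule.mul_mem_mul hr ha) hb
    | add a _ b _ h h' => rw [smul_add]; exact add_mem h h'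

theorem Submodule.pow_add_smul (I : Submodule R S) (m n : ℕ) (N : Submodule R A) :
    I ^ (m + n) • N = I ^ m • I ^ n • N := by
  rw [_root_.pow_add, Submodule.mul_smul_eq]

theorem Submodule.pow_succ_smul (I : Submodule R S) (n : ℕ) (N : Submodule R A) :
    I ^ (n + 1) • N = I • I ^ n • N := by
  rw [add_comm, Submodule.pow_add_smul, _root_.pow_one]

theorem Submodule.smul_comm_eq (I J : Submodule R S) (N : Submodule R A) :
    I • J • N = J • I • N := by
  rw [← Submodule.mul_smul_eq, mul_comm, Submodule.mul_smul_eq]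

theorem Submodule.le_smul_of_one_le {I : Submodule R S} (h : 1 ≤ I) (N : Submodule R A) :
    N ≤ I • N := by
  conv_lhs => rw [← Submodule.one_smul (A := S) N]
  exact Submodule.smul_mono_left h

theorem Submodule.pow_smul_mono {I : Submodule R S} (h : 1 ≤ I) {m n : ℕ} (hmn : m ≤ n)
    {N P : Submodule R A} (hNP : N ≤ P) : I ^ m • N ≤ I ^ n • P :=
  Submodule.smul_mono (pow_le_pow_right₀ h hmn) hNP

theorem Submodule.map_smul_eq (I : Submodule R S) (N : Submodule R A) (f : A →ₗ[S] B) :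
    (I • N).map (f.restrictScalars R) = I • N.map (f.restrictScalars R) := by
  apply le_antisymm
  · rw [Submodule.map_le_iff_le_comap, Submodule.smul_le]
    intro r hr n hn
    rw [Submodule.mem_comap, LinearMap.restrictScalars_apply, map_smul]
    exact Submodule.smul_mem_smul hr ⟨n, hn, rfl⟩
  · rw [Submodule.smul_le]
    rintro r hr _ ⟨n, hn, rfl⟩
    exact ⟨r • n, Submodule.smul_mem_smul hr hn, map_smul f r n⟩

theorem Submodule.span_smul_eq_iSup {ι : Type*} (s : ι → S) (N : Submodule R A) :
    Submodule.span R (Set.range s) • N = ⨆ i, N.map (smulBy R A (s i)) := by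
  apply le_antisymm
  · rw [Submodule.smul_le]
    intro r hr n hn
    induction hr using Submodule.span_induction with
    | mem r hr =>
      obtain ⟨i, rfl⟩ := hr
      exact Submodule.mem_iSup_of_mem i ⟨n, hn, rfl⟩
    | zero => rw [zero_smul]; exact zero_mem _
    | add a b _ _ h h' => rw [add_smul]; exact add_mem h h'
    | smul c a _ h => rw [smul_assoc]; exact Submodule.smul_mem _ c h
  · refine iSup_le fun i => ?_
    rintro _ ⟨n, hn, rfl⟩
    exact Submodule.smul_mem_smul (Submodule.subset_span ⟨i, rfl⟩) hn

theorem Submodule.FG.smul_eq_iSup {I : Submodule R S} (hI : I.FG) :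
    ∃ s : Finset S, (↑s ⊆ (I : Set S)) ∧
      ∀ N : Submodule R A, I • N = ⨆ i ∈ s, N.map (smulBy R A i) := by
  obtain ⟨s, rfl⟩ := hI
  refine ⟨s, Submodule.subset_span, fun N => ?_⟩
  have : (s : Set S) = Set.range (fun i : s => (i : S)) := by simp
  rw [this, Submodule.span_smul_eq_iSup, iSup_subtype]

theorem Submodule.smul_fg {I : Submodule R S} (hI : I.FG) {N : Submodule R A} (hN : N.FG) :
    (I • N).FG := by
  obtain ⟨s, -, hs⟩ := hI.smul_eq_iSup (A := A)
  rw [hs]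
  exact Submodule.fg_biSup s _ fun i _ => hN.map _

theorem RelFG.smul [IsNoetherianRing R] {I : Submodule R S} (hI : I.FG) {U V : Submodule R A}
    (h : RelFG U V) : RelFG (I • U) (I • V) := by
  obtain ⟨F, hF, -, hle⟩ := h
  refine .of_le_sup (Submodule.smul_fg hI hF) ?_
  rw [← Submodule.smul_sup]
  exact Submodule.smul_mono le_rfl hle

end SubmoduleSMul

section relLen

variable {R : Type u} {S : Type*} {A : Type v} [CommRing R] [CommRing S]
  [Algebra R S] [AddCommGroup A] [Module R A] [Module S A] [IsScalarTower R S A]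
  (lam : LengthFunction.{u, v} R)

/-- I V is a finite sum of images i V with i in I, and multiplication by i carries U into I U, so
each summand contributes at most the length of V relative to U. -/
theorem relLen_smul_ne_top {I : Submodule R S} (hI : I.FG) {U V : Submodule R A}
    (h : relLen lam U V ≠ ∞) : relLen lam (I • U) (I • V) ≠ ∞ := by
  obtain ⟨s, hsI, hs⟩ := hI.smul_eq_iSup (A := A)
  rw [hs V]
  refine ne_top_of_le_ne_top ?_ (relLen_iSup_le lam s _ _)
  refine ENNReal.sum_ne_top.2 fun i hi => ?_
  rw [relLen_map]
  refine ne_top_of_le_ne_top h (relLen_anti_left lam fun a ha => ?_)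
  exact Submodule.smul_mem_smul (hsI hi) ha

theorem relLen_trans_ne_top {U V W : Submodule R A} (h : relLen lam U V ≠ ∞)
    (h' : relLen lam V W ≠ ∞) : relLen lam U W ≠ ∞ :=
  ne_top_of_le_ne_top (ENNReal.add_ne_top.2 ⟨h, h'⟩) (relLen_triangle lam U V W)

end relLen

section LinForms

variable (R : Type*) {S : Type*} [CommRing R] [CommRing S] [Algebra R S] {k : ℕ} (x : Fin k → S)

/-- The polynomials of degree at most `1` in the elements `x i`. -/
def linForms : Submodule R S := Submodule.span R (insert 1 (Set.range x))

theorem one_le_linForms : 1 ≤ linForms R x :=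
  Submodule.one_le.2 (Submodule.subset_span (Set.mem_insert _ _))

theorem mem_linForms (i : Fin k) : x i ∈ linForms R x :=
  Submodule.subset_span (Set.mem_insert_of_mem _ ⟨i, rfl⟩)

theorem linForms_fg : (linForms R x).FG :=
  Submodule.fg_span ((Set.finite_range x).insert 1)

theorem linForms_eq : linForms R x = 1 ⊔ Submodule.span R (Set.range x) := by
  rw [linForms, Submodule.span_insert, Submodule.one_eq_span]

variable {A : Type*} [AddCommGroup A] [Module R A] [Module S A] [IsScalarTower R S A]

theorem linForms_smul (V : Submodule R A) :
    linForms R x • V = V ⊔ ⨆ i, V.map (smulBy R A (x i)) := by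
  rw [linForms_eq, Submodule.sup_smul, Submodule.one_smul, Submodule.span_smul_eq_iSup]

end LinForms

/-! ### Inert submodules and their Hilbert polynomials -/

section Inert

variable {R : Type u} {S : Type*} {A : Type v} [CommRing R] [IsNoetherianRing R] [CommRing S]
  [Algebra R S] [AddCommGroup A] [Module R A] [Module S A] [IsScalarTower R S A]
  (lam : LengthFunction.{u, v} R) {k : ℕ} (x : Fin k → S)

/-- `(E V) / V` has finite length and is finitely generated, where `E` is spanned by `1` and the
`x i`. -/
def IsInert (V : Submodule R A) : Prop :=
  relLen lam V (linForms R x • V) ≠ ∞ ∧ RelFG V (linForms R x • V)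

variable {lam x} {V : Submodule R A}

theorem le_linForms_pow_smul (n : ℕ) (V : Submodule R A) : V ≤ linForms R x ^ n • V :=
  Submodule.le_smul_of_one_le (one_le_pow₀ (one_le_linForms R x)) V

theorem pow_smul_le_pow_smul {m n : ℕ} (h : m ≤ n) (V : Submodule R A) :
    linForms R x ^ m • V ≤ linForms R x ^ n • V :=
  Submodule.pow_smul_mono (one_le_linForms R x) h le_rfl

theorem RelFG.pow_smul (h : RelFG V (linForms R x • V)) (n : ℕ) :
    RelFG (linForms R x ^ n • V) (linForms R x ^ (n + 1) • V) := by
  have := h.smul ((linForms_fg R x).pow n)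
  rwa [← Submodule.mul_smul_eq, ← pow_succ] at this

theorem IsInert.pow_smul (h : IsInert lam x V) (n : ℕ) : IsInert lam x (linForms R x ^ n • V) := by
  constructor
  · have := relLen_smul_ne_top lam ((linForms_fg R x).pow n) h.1
    rwa [Submodule.smul_comm_eq] at this
  · have := h.2.smul ((linForms_fg R x).pow n)
    rwa [Submodule.smul_comm_eq] at this

theorem IsInert.relLen_succ_ne_top (h : IsInert lam x V) (n : ℕ) :
    relLen lam (linForms R x ^ n • V) (linForms R x ^ (n + 1) • V) ≠ ∞ := by
  have := (h.pow_smul n).1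
  rwa [← Submodule.pow_succ_smul] at this

theorem IsInert.relLen_ne_top (h : IsInert lam x V) (n : ℕ) :
    relLen lam V (linForms R x ^ n • V) ≠ ∞ := by
  induction n with
  | zero => rw [relLen_eq_zero lam (by simp [Submodule.one_smul])]; exact ENNReal.zero_ne_top
  | succ n ih => exact relLen_trans_ne_top lam ih (h.relLen_succ_ne_top n)

theorem isInert_bot : IsInert lam x (⊥ : Submodule R A) := by
  rw [IsInert, Submodule.smul_bot, relLen_eq_zero lam le_rfl]
  exact ⟨ENNReal.zero_ne_top, ⟨⊥, Submodule.fg_bot, le_rfl, by simp⟩⟩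

/-- The family `E ^ n V` is stable under the `x i`. -/
theorem smul_mem_pow_smul {n : ℕ} {a : A} (ha : a ∈ linForms R x ^ n • V) (i : Fin k) :
    x i • a ∈ linForms R x ^ (n + 1) • V := by
  rw [Submodule.pow_succ_smul]
  exact Submodule.smul_mem_smul (mem_linForms R x i) ha

theorem pow_succ_smul_le (n : ℕ) (V : Submodule R A) : linForms R x ^ (n + 1) • V ≤
    linForms R x ^ n • V ⊔ ⨆ i, (linForms R x ^ n • V).map (smulBy R A (x i)) := by
  rw [Submodule.pow_succ_smul, linForms_smul]

variable (lam x V) in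
/-- `q` is the intrinsic Hilbert polynomial of `V`. -/
def IsHilbertPoly (q : ℝ[X]) : Prop :=
  IsEventuallyPoly (fun n => relLen lam (linForms R x ^ n • V) (linForms R x ^ (n + 1) • V)) q

theorem IsHilbertPoly.leadingCoeff_nonneg {q : ℝ[X]} (h : IsHilbertPoly lam x V q) :
    0 ≤ q.leadingCoeff :=
  leadingCoeff_nonneg_of_eventually (h.mono fun _ h => h.1)

theorem IsHilbertPoly.unique {p q : ℝ[X]} (hp : IsHilbertPoly lam x V p)
    (hq : IsHilbertPoly lam x V q) : p = q :=
  polynomial_eq_of_eventually (by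
    filter_upwards [hp.toReal, hq.toReal] with n h1 h2
    rw [← h1, ← h2])

/-- Hilbert–Serre for the families E^n V ≤ E^(n+1) V: the graded quotient is generated in degree 0,
as E adds to a submodule only its multiples by the x_i. -/
theorem IsInert.exists_isHilbertPoly (h : IsInert lam x V) :
    ∃ q : ℝ[X], q.degree < k ∧ IsHilbertPoly lam x V q := by
  refine exists_hilbertPoly lam x (fun n => linForms R x ^ n • V)
    (fun n => linForms R x ^ (n + 1) • V) (fun n => pow_smul_le_pow_smul n.le_succ V)
    (fun n i a ha => smul_mem_pow_smul ha i) (fun n i a ha => smul_mem_pow_smul ha i)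
    (fun n => h.2.pow_smul n) 0 (fun n _ => ?_) (fun n => h.relLen_succ_ne_top n)
  exact pow_succ_smul_le (n + 1) V

/-- The total length of `E ^ n V / V`, as a recursion. -/
theorem relLen_pow_succ (V : Submodule R A) (n : ℕ) :
    relLen lam V (linForms R x ^ (n + 1) • V) = relLen lam V (linForms R x ^ n • V) +
      relLen lam (linForms R x ^ n • V) (linForms R x ^ (n + 1) • V) :=
  relLen_add lam (le_linForms_pow_smul n V) (pow_smul_le_pow_smul n.le_succ V)

/-- The sum of the Hilbert polynomial. -/
theorem IsInert.exists_sum_isEventuallyPoly (h : IsInert lam x V) {q : ℝ[X]}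
    (hq : IsHilbertPoly lam x V q) (hk : q.degree < k) :
    ∃ Q : ℝ[X], Q.degree < (k + 1 : ℕ) ∧ forwardDiff Q = q ∧
      IsEventuallyPoly (fun n => relLen lam V (linForms R x ^ n • V)) Q := by
  have h0 : IsEventuallyPoly (fun _ => 0) (0 : ℝ[X]) := .of_forall fun n => by simp
  have := exists_isEventuallyPoly_of_diff (a := fun n => relLen lam V (linForms R x ^ n • V))
    h.relLen_ne_top hk (by simp [bot_lt_iff_ne_bot]) hq h0 h.relLen_succ_ne_top (by simp)
    (fun n => by rw [relLen_pow_succ, add_zero])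
  simpa using this

end Inert

/-! ### Charts of the projective closure -/

section Chart

variable {R S S' B B' : Type*} [CommRing R] [CommRing S] [CommRing S'] [Algebra R S] [Algebra S S']
  [Algebra R S'] [IsScalarTower R S S'] [AddCommGroup B] [Module R B] [Module S B]
  [IsScalarTower R S B] [AddCommGroup B'] [Module S B'] [Module S' B'] [IsScalarTower S S' B']

/-- The fraction `b / y ^ n`, where `τ` is the inverse of `y`. -/
def chartFrac (ι : B →ₗ[S] B') (τ : S') (n : ℕ) (b : B) : B' := τ ^ n • ι b

/-- The coordinate ring of the chart of the projective closure in which `y = 1 / τ` does not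
vanish. -/
abbrev chartRing (R : Type*) {S S' : Type*} [CommRing R] [CommRing S] [CommRing S'] [Algebra R S]
    [Algebra S S'] [Algebra R S'] (s : Finset S) (τ : S') : Subalgebra R S' :=
  Algebra.adjoin R ((fun e : S => τ * algebraMap S S' e) '' s)

section

variable {ι : B →ₗ[S] B'} {τ : S'} {y : S} (hy : τ * algebraMap S S' y = 1)
  {s : Finset S} {E : Submodule R S} (hE : Submodule.span R (s : Set S) = E)

include hy in
theorem chartFrac_smul (n j : ℕ) (b : B) :
    chartFrac ι τ (n + j) (y ^ j • b) = chartFrac ι τ n b := by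
  rw [chartFrac, chartFrac, map_smul, ← algebraMap_smul S' (y ^ j) (ι b), smul_smul, pow_add,
    map_pow, mul_assoc, ← mul_pow, hy, one_pow, mul_one]

include hy in
theorem exists_smul_eq_of_chartFrac_eq (hker : ∀ b, ι b = 0 → ∃ j : ℕ, y ^ j • b = 0) {n p : ℕ}
    {a b : B} (h : chartFrac ι τ n a = chartFrac ι τ p b) :
    ∃ j : ℕ, y ^ (j + p) • a = y ^ (j + n) • b := by
  rw [← chartFrac_smul hy n p a, ← chartFrac_smul hy p n b, add_comm p n] at h
  have h1 : ι (y ^ p • a - y ^ n • b) = 0 := by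
    have h2 : τ ^ (n + p) • ι (y ^ p • a - y ^ n • b) = 0 := by
      rw [map_sub, smul_sub, sub_eq_zero]; exact h
    have h3 : (algebraMap S S' y ^ (n + p) * τ ^ (n + p)) • ι (y ^ p • a - y ^ n • b) = 0 := by
      rw [mul_smul, h2, smul_zero]
    rwa [← mul_pow, mul_comm _ τ, hy, one_pow, one_smul] at h3
  obtain ⟨j, hj⟩ := hker _ h1
  refine ⟨j, ?_⟩
  rw [smul_sub, sub_eq_zero, smul_smul, smul_smul, ← pow_add, ← pow_add] at hj
  exact hj

include hE in
theorem mul_algebraMap_mem_chartRing {d : ℕ} {e : S} (he : e ∈ E ^ d) :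
    τ ^ d * algebraMap S S' e ∈ chartRing R s τ := by
  induction d generalizing e with
  | zero =>
    rw [pow_zero] at he
    obtain ⟨r, rfl⟩ := Submodule.mem_one.1 he
    rw [pow_zero, one_mul, ← IsScalarTower.algebraMap_apply]
    exact Subalgebra.algebraMap_mem _ r
  | succ d ih =>
    rw [pow_succ] at he
    induction he using Submodule.mul_induction_on' with
    | mem_mul_mem a ha b hb =>
      have h1 : τ * algebraMap S S' b ∈ chartRing R s τ := by
        rw [← hE] at hb
        induction hb using Submodule.span_induction with
        | mem b hb => exact Algebra.subset_adjoin ⟨b, hb, rfl⟩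
        | zero => rw [map_zero, mul_zero]; exact zero_mem _
        | add b c _ _ h h' => rw [map_add, mul_add]; exact add_mem h h'
        | smul r b _ h =>
          rw [Algebra.smul_def, map_mul, mul_left_comm, ← IsScalarTower.algebraMap_apply]
          exact mul_mem (Subalgebra.algebraMap_mem _ r) h
      have := mul_mem (ih ha) h1
      rw [pow_succ, map_mul]
      convert this using 1
      ring
    | add a _ b _ h h' => rw [map_add, mul_add]; exact add_mem h h'

include hy hE in
theorem exists_of_mem_chartRing (hyE : y ∈ E) {o : S'} (ho : o ∈ chartRing R s τ) :
    ∃ d, ∃ e ∈ E ^ d, o = τ ^ d * algebraMap S S' e := by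
  induction ho using Algebra.adjoin_induction with
  | mem o ho =>
    obtain ⟨e, he, rfl⟩ := ho
    exact ⟨1, e, by rw [pow_one, ← hE]; exact Submodule.subset_span he, by rw [pow_one]⟩
  | algebraMap r =>
    refine ⟨0, algebraMap R S r, ?_, ?_⟩
    · rw [pow_zero]; exact Submodule.mem_one.2 ⟨r, rfl⟩
    · rw [pow_zero, one_mul, ← IsScalarTower.algebraMap_apply]
  | add a b _ _ h h' =>
    obtain ⟨d, e, he, rfl⟩ := h
    obtain ⟨d', e', he', rfl⟩ := h'
    refine ⟨d + d', e * y ^ d' + e' * y ^ d, add_mem ?_ ?_, ?_⟩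
    · rw [pow_add]; exact Submodule.mul_mem_mul he (Submodule.pow_mem_pow _ hyE _)
    · rw [add_comm, pow_add]; exact Submodule.mul_mem_mul he' (Submodule.pow_mem_pow _ hyE _)
    · have h1 : ∀ n, τ ^ n * algebraMap S S' y ^ n = 1 := fun n => by
        rw [← mul_pow, hy, one_pow]
      simp only [map_add, map_mul, map_pow, pow_add]
      linear_combination (-τ ^ d * algebraMap S S' e) * h1 d' -
        (τ ^ d' * algebraMap S S' e') * h1 d
  | mul a b _ _ h h' =>
    obtain ⟨d, e, he, rfl⟩ := h
    obtain ⟨d', e', he', rfl⟩ := h'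
    refine ⟨d + d', e * e', by rw [pow_add]; exact Submodule.mul_mem_mul he he', ?_⟩
    rw [map_mul, pow_add]; ring

end

/-- The module on a chart, given by a family of submodules compatible with the filtration by
the powers of `E`. -/
def chartSubmodule (ι : B →ₗ[S] B') {τ : S'} {y : S} (hy : τ * algebraMap S S' y = 1)
    {s : Finset S} {E : Submodule R S} (hE : Submodule.span R (s : Set S) = E) (hyE : y ∈ E)
    (X : ℕ → Submodule R B) (hX : ∀ n, E • X n ≤ X (n + 1)) :
    Submodule (chartRing R s τ) B' where
  carrier := {z | ∃ n, ∃ b ∈ X n, z = chartFrac ι τ n b}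
  zero_mem' := ⟨0, 0, zero_mem _, by simp [chartFrac]⟩
  add_mem' := by
    rintro _ _ ⟨n, b, hb, rfl⟩ ⟨m, c, hc, rfl⟩
    have h : ∀ n j, ∀ b ∈ X n, y ^ j • b ∈ X (n + j) := by
      intro n j b hb
      induction j with
      | zero => simpa using hb
      | succ j ih =>
        rw [pow_succ', mul_smul]
        exact hX _ (Submodule.smul_mem_smul hyE ih)
    refine ⟨n + m, y ^ m • b + y ^ n • c, add_mem (h n m b hb) (add_comm m n ▸ h m n c hc), ?_⟩
    rw [← chartFrac_smul hy n m b, ← chartFrac_smul hy m n c, add_comm m n]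
    simp only [chartFrac, map_add, smul_add]
  smul_mem' := by
    rintro ⟨o, ho⟩ _ ⟨n, b, hb, rfl⟩
    obtain ⟨d, e, he, rfl⟩ := exists_of_mem_chartRing hy hE hyE ho
    have h : ∀ d, E ^ d • X n ≤ X (d + n) := by
      intro d
      induction d with
      | zero => rw [pow_zero, Submodule.one_smul, zero_add]
      | succ d ih =>
        rw [Submodule.pow_succ_smul, add_right_comm]
        exact (Submodule.smul_mono le_rfl ih).trans (hX _)
    refine ⟨d + n, e • b, h d (Submodule.smul_mem_smul he hb), ?_⟩
    change (τ ^ d * algebraMap S S' e) • τ ^ n • ι b = τ ^ (d + n) • ι (e • b)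
    rw [map_smul, ← algebraMap_smul S' e, smul_smul, smul_smul, pow_add]
    congr 1; ring

variable {ι : B →ₗ[S] B'} {τ : S'} {y : S} (hy : τ * algebraMap S S' y = 1)
  {s : Finset S} {E : Submodule R S} (hE : Submodule.span R (s : Set S) = E) (hyE : y ∈ E)

theorem chartFrac_mem_chartSubmodule {X : ℕ → Submodule R B} (hX : ∀ n, E • X n ≤ X (n + 1)) {n : ℕ}
    {b : B} (hb : b ∈ X n) : chartFrac ι τ n b ∈ chartSubmodule ι hy hE hyE X hX :=
  ⟨n, b, hb, rfl⟩

theorem chartSubmodule_mono {X Y : ℕ → Submodule R B} (hX : ∀ n, E • X n ≤ X (n + 1))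
    (hY : ∀ n, E • Y n ≤ Y (n + 1)) (h : ∀ n, X n ≤ Y n) :
    chartSubmodule ι hy hE hyE X hX ≤ chartSubmodule ι hy hE hyE Y hY := by
  rintro _ ⟨n, b, hb, rfl⟩
  exact ⟨n, b, h n hb, rfl⟩

theorem pow_smul_family (G : Submodule R B) (n : ℕ) : E • E ^ n • G ≤ E ^ (n + 1) • G := by
  rw [← Submodule.pow_succ_smul]

include hE in
theorem smul_chartFrac_mem {d n : ℕ} {e : S} (he : e ∈ E ^ d) (b : B)
    (N : Submodule (chartRing R s τ) B') (hb : chartFrac ι τ n b ∈ N) :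
    chartFrac ι τ (d + n) (e • b) ∈ N := by
  have := N.smul_mem ⟨_, mul_algebraMap_mem_chartRing hE (τ := τ) he⟩ hb
  have h2 : chartFrac ι τ (d + n) (e • b) = (τ ^ d * algebraMap S S' e) • chartFrac ι τ n b := by
    rw [chartFrac, chartFrac, map_smul, ← algebraMap_smul S' e, smul_smul, smul_smul, pow_add]
    congr 1; ring
  rw [h2]
  exact this

theorem chartFrac_add (n : ℕ) (a b : B) :
    chartFrac ι τ n (a + b) = chartFrac ι τ n a + chartFrac ι τ n b := by
  rw [chartFrac, map_add, smul_add]; rfl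

include hE in
/-- The module on a chart generated by a submodule. -/
theorem chartFrac_mem_of_mem_pow_smul {G : Submodule R B} {m : ℕ}
    (N : Submodule (chartRing R s τ) B') (hN : ∀ g ∈ G, chartFrac ι τ m g ∈ N) (n : ℕ) {b : B}
    (hb : b ∈ E ^ n • G) : chartFrac ι τ (n + m) b ∈ N := by
  induction hb using Submodule.smul_induction_on' with
  | smul e he g hg => exact smul_chartFrac_mem hE he g N (hN g hg)
  | add a _ b _ h h' => rw [chartFrac_add]; exact add_mem h h'

theorem chartSubmodule_fg {G : Submodule R B} (hG : G.FG) :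
    (chartSubmodule ι hy hE hyE (fun n => E ^ n • G) (pow_smul_family G)).FG := by
  classical
  obtain ⟨t, rfl⟩ := hG
  refine ⟨t.image (chartFrac ι τ 0), le_antisymm ?_ ?_⟩
  · rw [Submodule.span_le]
    rintro z hz
    obtain ⟨g, hg, rfl⟩ := Finset.mem_image.1 (Finset.mem_coe.1 hz)
    refine chartFrac_mem_chartSubmodule hy hE hyE _ ?_
    rw [pow_zero, Submodule.one_smul]
    exact Submodule.subset_span hg
  · rintro _ ⟨n, b, hb, rfl⟩
    refine chartFrac_mem_of_mem_pow_smul (m := 0) hE _ ?_ n hb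
    intro g hg
    induction hg using Submodule.span_induction with
    | mem g hg => exact Submodule.subset_span (Finset.mem_coe.2 (Finset.mem_image_of_mem _ hg))
    | zero => simp [chartFrac]
    | add a b _ _ h h' => rw [chartFrac_add]; exact add_mem h h'
    | smul r b _ h =>
      have h1 : algebraMap R S r ∈ E ^ 0 := by
        rw [pow_zero]; exact Submodule.mem_one.2 ⟨r, rfl⟩
      rw [← algebraMap_smul S r b]
      exact smul_chartFrac_mem hE (n := 0) h1 b _ h

theorem pow_smul_mem_family {X : ℕ → Submodule R B} (hX : ∀ n, E • X n ≤ X (n + 1)) (hyE : y ∈ E)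
    {n : ℕ} (j : ℕ) {b : B} (hb : b ∈ X n) : y ^ j • b ∈ X (n + j) := by
  induction j with
  | zero => simpa using hb
  | succ j ih =>
    rw [pow_succ', mul_smul]
    exact hX _ (Submodule.smul_mem_smul hyE ih)

/-- The submodules by which a filtration is extended from a submodule. -/
def extensionFamily (E : Submodule R S) (G : Submodule R B) (I : ℕ → Submodule R S) (d N M : ℕ) :
    Submodule R B :=
  E ^ (M + d) • G ⊔ ⨆ (p : ℕ × ℕ) (_ : d ≤ p.1 ∧ (N - 1) * p.1 + p.2 ≤ M),
    I p.1 ^ N • E ^ p.2 • G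

set_option maxHeartbeats 1000000 in
include hy hE hyE in
-- The uniform Artin–Rees lemma, transported to the chart y ≠ 0: an element of some T c that lies in
-- the extension family on this chart lies in T there, after a shift b independent of m and of the
-- element. The shape of `extensionFamily` is dictated by the chart. Fractions e / y^p with e in I_p
-- generate an ideal J_p, and an element of I_p^N E^q G divided by y^M falls, after multiplication
-- by τ^p, into J_p^N L as soon as p N + q ≤ p + M, that is (N - 1) p + q ≤ M.
theorem exists_chart_bound [IsNoetherianRing R] (hE1 : 1 ≤ E)
    (hker : ∀ b, ι b = 0 → ∃ j : ℕ, y ^ j • b = 0) (T : ℕ → Submodule R B)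
    (hTmono : ∀ n, T n ≤ T (n + 1)) (hET : ∀ n, E • T n ≤ T (n + 1)) {F G : Submodule R B}
    (hF : F.FG) (hG : G.FG) (hTF : ∀ n, T (n + 1) ≤ T n ⊔ E ^ n • F) (d : ℕ)
    (I : ℕ → Submodule R S) (hIE : ∀ n, I n ≤ E ^ n)
    (hI : ∀ n ≥ d, E * I n ≤ I (n + 1) ⊔ E ^ d) (hIT : ∀ n p, n ≤ p → I n • T p ≤ T p) :
    ∃ N0, ∀ N ≥ N0, ∃ b : ℕ, ∀ m : ℕ, ∀ a : B, (∃ c, a ∈ T c) →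
      (∃ j, y ^ j • a ∈ extensionFamily E G I d N (m + j)) → ∃ j, y ^ j • a ∈ T (m + b + j) := by
  have hτ1 : τ ∈ chartRing R s τ := by
    have := mul_algebraMap_mem_chartRing (S' := S') (τ := τ) (d := 1) (e := 1) hE
      (by rw [pow_one]; exact Submodule.one_le.1 hE1)
    simpa using this
  have hτu : ∀ n : ℕ, ∀ z z' : B', τ ^ n • z = τ ^ n • z' → z = z' := by
    intro n z z' h
    have := congrArg (fun w => algebraMap S S' y ^ n • w) h
    simpa only [smul_smul, ← mul_pow, mul_comm (algebraMap S S' y) τ, hy, one_pow, one_smul]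
      using this
  have hτfrac : ∀ n p b, τ ^ n • chartFrac ι τ p b = chartFrac ι τ (n + p) b := by
    intro n p b; rw [chartFrac, chartFrac, smul_smul, pow_add]
  let t : chartRing R s τ := ⟨τ, hτ1⟩
  have ht : ∀ (n : ℕ) (z : B'), t ^ n • z = τ ^ n • z := fun n z => rfl
  have : IsNoetherianRing (chartRing R s τ) := by
    classical
    have h : (chartRing R s τ).FG :=
      ⟨s.image fun e : S => τ * algebraMap S S' e, by rw [Finset.coe_image]⟩
    have := (chartRing R s τ).fg_iff_finiteType.1 h
    exact Algebra.FiniteType.isNoetherianRing R _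
  have hTle : ∀ {m n}, m ≤ n → T m ≤ T n := fun {m n} h => monotone_nat_of_le_succ hTmono h
  let A : Submodule R B := ⨆ n, T n
  have hA : ∀ a, a ∈ A ↔ ∃ n, a ∈ T n := fun a =>
    Submodule.mem_iSup_of_directed _ (monotone_nat_of_le_succ hTmono).directed_le
  have hEA : E • A ≤ A := by
    rw [Submodule.smul_le]
    intro e he a ha
    obtain ⟨n, hn⟩ := (hA a).1 ha
    exact (hA _).2 ⟨n + 1, hET n (Submodule.smul_mem_smul he hn)⟩
  -- VV, AA and LL are the modules on the chart given by the filtration T, by its union with no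
  -- bound on the denominator, and by G.
  let VV := chartSubmodule ι hy hE hyE T hET
  let AA := chartSubmodule ι hy hE hyE (fun _ => A) (fun _ => hEA)
  let LL := chartSubmodule ι hy hE hyE (fun n => E ^ n • G) (pow_smul_family G)
  have hLL : LL.FG := chartSubmodule_fg hy hE hyE hG
  have hVA : VV ≤ AA := chartSubmodule_mono hy hE hyE _ _ fun n a ha => (hA a).2 ⟨n, ha⟩
  -- VV is enlarged so that D ∩ AA = Vv. Since τ is invertible on AA, this makes Vv pure in D; the
  -- price is a bounded power t^b1.
  let Vv := VV ⊔ LL ⊓ AA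
  let D := LL ⊔ VV
  have hVvA : Vv ≤ AA := sup_le hVA inf_le_right
  have hDA : D ⊓ AA ≤ Vv := by
    rintro z ⟨hz, hzA⟩
    obtain ⟨l, hl, v, hv, rfl⟩ := Submodule.mem_sup.1 hz
    refine add_mem (Submodule.mem_sup_right ⟨hl, ?_⟩) (Submodule.mem_sup_left hv)
    have := sub_mem hzA (hVA hv)
    simpa using this
  have hLA : (LL ⊓ AA).FG := by
    have := isNoetherian_of_fg_of_noetherian LL hLL
    exact Submodule.FG.of_le hLL inf_le_left
  -- A fraction with numerator in T n and denominator y^(n+1) is τ times an element of VV, so modulo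
  -- τ only the part from F survives.
  have hVVτ : VV ≤ VV.map (LinearMap.lsmul (chartRing R s τ) B' t) ⊔
      (chartSubmodule ι hy hE hyE (fun n => E ^ n • F) (pow_smul_family F)) := by
    have key : ∀ n, ∀ b ∈ T (n + 1), chartFrac ι τ (n + 1) b ∈
        VV.map (LinearMap.lsmul (chartRing R s τ) B' t) ⊔
        (chartSubmodule ι hy hE hyE (fun n => E ^ n • F) (pow_smul_family F)) := by
      intro n b hb
      obtain ⟨b1, hb1, b2, hb2, rfl⟩ := Submodule.mem_sup.1 (hTF n hb)
      rw [chartFrac_add]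
      refine Submodule.add_mem_sup ⟨chartFrac ι τ n b1,
        chartFrac_mem_chartSubmodule hy hE hyE _ hb1, ?_⟩ ?_
      · change τ • chartFrac ι τ n b1 = _
        have := hτfrac 1 n b1
        rw [pow_one] at this
        rw [this, add_comm]
      · have h1 := (chartSubmodule ι hy hE hyE (fun n => E ^ n • F) (pow_smul_family F)).smul_mem t
          (chartFrac_mem_chartSubmodule hy hE hyE (pow_smul_family F) hb2)
        have h2 : t • chartFrac ι τ n b2 = chartFrac ι τ (n + 1) b2 := by
          change τ • chartFrac ι τ n b2 = _
          have := hτfrac 1 n b2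
          rw [pow_one] at this
          rw [this, add_comm]
        rwa [h2] at h1
    rintro _ ⟨n, b, hb, rfl⟩
    rcases n with _ | n
    · rw [← chartFrac_smul hy 0 1 b]
      exact key 0 _ (pow_smul_mem_family hET hyE 1 hb)
    · exact key n b hb
  have hFFg := chartSubmodule_fg (ι := ι) hy hE hyE hF
  have hmapmono : ∀ {P Q : Submodule (chartRing R s τ) B'}, P ≤ Q →
      P.map (LinearMap.lsmul (chartRing R s τ) B' t) ≤
        Q.map (LinearMap.lsmul (chartRing R s τ) B' t) := fun h => Submodule.map_mono h
  have hDfg : RelFG (D.map (LinearMap.lsmul (chartRing R s τ) B' t)) D := by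
    refine .of_le_sup (hLL.sup hFFg) (sup_le (le_sup_left.trans le_sup_right) (hVVτ.trans ?_))
    exact sup_le_sup (hmapmono le_sup_right) le_sup_right
  have hVfg : RelFG (Vv.map (LinearMap.lsmul (chartRing R s τ) B' t)) Vv := by
    refine .of_le_sup (hLA.sup hFFg) (sup_le (hVVτ.trans ?_) (le_sup_left.trans le_sup_right))
    exact sup_le_sup (hmapmono le_sup_left) le_sup_right
  have hVD : Vv ≤ D := sup_le le_sup_right (inf_le_left.trans le_sup_left)
  have hpure : ∀ n : ℕ, ∀ z ∈ D, t ^ n • z ∈ Vv → z ∈ Vv := by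
    intro n z hz hzn
    refine hDA ⟨hz, ?_⟩
    obtain ⟨q, a, ha, e⟩ := hVvA hzn
    refine ⟨q, y ^ n • a, ?_, ?_⟩
    · exact pow_smul_mem_family (X := fun _ => A) (n := 0) (fun _ => hEA) hyE n ha
    · apply hτu n
      rw [← ht, e, hτfrac, add_comm, chartFrac_smul hy]
  -- LL ∩ AA is finitely generated, and each of its elements enters VV after multiplication by a
  -- power of t.
  obtain ⟨b1, hb1⟩ : ∃ b1 : ℕ, ∀ z ∈ Vv, t ^ b1 • z ∈ VV := by
    have hgen : ∀ z ∈ LL ⊓ AA, ∃ b1 : ℕ, t ^ b1 • z ∈ VV := by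
      rintro z ⟨-, q, a, ha, rfl⟩
      obtain ⟨c, hc⟩ := (hA a).1 ha
      refine ⟨c, ?_⟩
      have : t ^ c • chartFrac ι τ q a = t ^ q • chartFrac ι τ c a := by
        rw [ht, ht, hτfrac, hτfrac, add_comm]
      rw [this]
      exact VV.smul_mem _ (chartFrac_mem_chartSubmodule hy hE hyE _ hc)
    obtain ⟨g, hg⟩ := hLA
    have hg' : ∀ z : g, ∃ b1 : ℕ, t ^ b1 • (z : B') ∈ VV := fun z =>
      hgen z (hg ▸ Submodule.subset_span z.2)
    choose f hf using hg'
    refine ⟨Finset.univ.sup f, ?_⟩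
    have hle : Vv ≤ VV.comap (LinearMap.lsmul (chartRing R s τ) B' (t ^ Finset.univ.sup f)) := by
      refine sup_le (fun z hz => VV.smul_mem _ hz) ?_
      rw [← hg, Submodule.span_le]
      intro z hz
      obtain ⟨q, hq⟩ := Nat.exists_eq_add_of_le
        (Finset.le_sup (f := f) (Finset.mem_univ (⟨z, hz⟩ : g)))
      change t ^ Finset.univ.sup f • z ∈ VV
      rw [hq, add_comm, pow_add, mul_smul]
      exact VV.smul_mem _ (hf ⟨z, hz⟩)
    exact fun z hz => hle hz
  obtain ⟨N0, hN0⟩ := exists_uniform_artinRees t D Vv hVD hDfg hVfg hpure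
  refine ⟨max N0 1, fun N hN => ?_⟩
  obtain ⟨b2, hb2⟩ := hN0 d
  let J : ℕ → Ideal (chartRing R s τ) := fun n =>
    Ideal.span {o | ∃ e ∈ I n, (o : S') = τ ^ n * algebraMap S S' e}
  -- On VV one has J n · VV ⊆ t^n VV because I n preserves T p for p ≥ n. Passing from Vv to VV
  -- first costs b1.
  have hJV : ∀ n ≥ b1, ∀ o ∈ J n, ∀ v ∈ Vv, ∃ v' ∈ Vv, o • v = t ^ (n - b1) • v' := by
    have h1 : ∀ n, ∀ o ∈ J n, ∀ v ∈ VV, ∃ v' ∈ VV, o • v = t ^ n • v' := by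
      intro n o ho v hv
      induction ho using Submodule.span_induction with
      | mem o ho =>
        obtain ⟨e, he, ho⟩ := ho
        obtain ⟨p, b, hb, rfl⟩ := hv
        rw [← chartFrac_smul hy p n b]
        refine ⟨chartFrac ι τ (p + n) (e • y ^ n • b), chartFrac_mem_chartSubmodule hy hE hyE _
          (hIT n (p + n) (by omega) (Submodule.smul_mem_smul he
            (pow_smul_mem_family hET hyE n hb))), ?_⟩
        change (o : S') • chartFrac ι τ (p + n) (y ^ n • b) = τ ^ n • _
        rw [ho, chartFrac, chartFrac, map_smul ι e, ← algebraMap_smul S' e (ι (y ^ n • b)),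
          smul_smul, smul_smul, smul_smul]
        congr 1; ring
      | zero => exact ⟨0, zero_mem _, by simp⟩
      | add a b _ _ h h' =>
        obtain ⟨v1, hv1, e1⟩ := h
        obtain ⟨v2, hv2, e2⟩ := h'
        exact ⟨v1 + v2, add_mem hv1 hv2, by rw [add_smul, e1, e2, smul_add]⟩
      | smul r a _ h =>
        obtain ⟨v1, hv1, e1⟩ := h
        exact ⟨r • v1, VV.smul_mem r hv1, by rw [smul_assoc, e1, smul_comm]⟩
    intro n hn o ho v hv
    obtain ⟨v', hv', e⟩ := h1 n o ho _ (hb1 v hv)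
    refine ⟨v', Submodule.mem_sup_left hv', ?_⟩
    apply hτu b1
    rw [← ht, ← ht, smul_comm, e, smul_smul, ← pow_add, Nat.add_sub_cancel' hn]
  -- For e in I n the product y e lies in I (n+1) + E^d; the E^d part, over the denominator y^(n+1),
  -- is divisible by t^(n+1-d).
  have hJsucc : ∀ n ≥ d, J n ≤ J (n + 1) ⊔ Ideal.span {t ^ (n + 1 - d)} := by
    intro n hn
    rw [Submodule.span_le]
    rintro o ⟨e, he, ho⟩
    obtain ⟨e1, he1, e2, he2, e3⟩ := Submodule.mem_sup.1 (hI n hn (Submodule.mul_mem_mul hyE he))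
    have hm1 := mul_algebraMap_mem_chartRing (S' := S') (τ := τ) hE (hIE _ he1)
    have hm2 := mul_algebraMap_mem_chartRing (S' := S') (τ := τ) hE he2
    have e4 : o = ⟨_, hm1⟩ + ⟨_, hm2⟩ * t ^ (n + 1 - d) := by
      apply Subtype.ext
      change (o : S') = τ ^ (n + 1) * algebraMap S S' e1 +
        τ ^ d * algebraMap S S' e2 * τ ^ (n + 1 - d)
      have e5 : τ ^ d * τ ^ (n + 1 - d) = τ ^ (n + 1) := by
        rw [← pow_add, Nat.add_sub_cancel' (by omega)]
      have e6 := congrArg (algebraMap S S') e3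
      rw [map_add, map_mul] at e6
      rw [ho]
      linear_combination (-τ ^ (n + 1)) * e6 - τ ^ n * algebraMap S S' e * hy -
        algebraMap S S' e2 * e5
    rw [e4]
    exact Submodule.add_mem_sup (Submodule.subset_span ⟨e1, he1, rfl⟩)
      (Ideal.mul_mem_left _ _ (Ideal.mem_span_singleton_self _))
  have hJpow : ∀ n, ∀ e ∈ I n ^ N, ∃ o ∈ J n ^ N, (o : S') = τ ^ (n * N) * algebraMap S S' e := by
    intro n
    clear hN hb2 hN0
    induction N with
    | zero =>
      intro e he
      rw [pow_zero] at he
      obtain ⟨r, rfl⟩ := Submodule.mem_one.1 he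
      refine ⟨algebraMap R _ r, by simp, ?_⟩
      rw [mul_zero, pow_zero, one_mul, ← IsScalarTower.algebraMap_apply]
      rfl
    | succ N ih =>
      intro e he
      rw [pow_succ] at he
      induction he using Submodule.mul_induction_on' with
      | mem_mul_mem a ha b hb =>
        obtain ⟨o, ho, e1⟩ := ih a ha
        have hm := mul_algebraMap_mem_chartRing (S' := S') (τ := τ) hE (hIE _ hb)
        refine ⟨o * ⟨_, hm⟩, ?_, ?_⟩
        · rw [pow_succ]
          exact Ideal.mul_mem_mul ho (Submodule.subset_span ⟨b, hb, rfl⟩)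
        · change (o : S') * (τ ^ n * algebraMap S S' b) = _
          rw [e1, map_mul]; ring
      | add a _ b _ h h' =>
        obtain ⟨o, ho, e1⟩ := h
        obtain ⟨o', ho', e1'⟩ := h'
        refine ⟨o + o', add_mem ho ho', ?_⟩
        change (o : S') + o' = _
        rw [e1, e1', map_add]; ring
  -- An element of the family is a sum of terms with different p. Each term satisfies the claim
  -- first at its own n (namely p, or d for the part from G), and `hJsucc` carries it to all larger
  -- n, where the terms can be added.
  have hW : ∀ M, ∀ w ∈ extensionFamily E G I d N M, ∃ n0, ∀ n ≥ n0,
      t ^ n • chartFrac ι τ M w ∈ J n ^ N • LL ⊔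
        LL.map (LinearMap.lsmul (chartRing R s τ) B' (t ^ (n - d))) := by
    intro M
    let Q : ℕ → Submodule (chartRing R s τ) B' := fun n => J n ^ N • LL ⊔
        LL.map (LinearMap.lsmul (chartRing R s τ) B' (t ^ (n - d)))
    have hQadd : ∀ w w', (∃ n0, ∀ n ≥ n0, t ^ n • chartFrac ι τ M w ∈ Q n) →
        (∃ n0, ∀ n ≥ n0, t ^ n • chartFrac ι τ M w' ∈ Q n) →
        ∃ n0, ∀ n ≥ n0, t ^ n • chartFrac ι τ M (w + w') ∈ Q n := by
      rintro w w' ⟨n0, h⟩ ⟨n1, h'⟩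
      refine ⟨max n0 n1, fun n hn => ?_⟩
      rw [chartFrac_add, smul_add]
      exact add_mem (h n (le_of_max_le_left hn)) (h' n (le_of_max_le_right hn))
    have hQsucc : ∀ n ≥ d, ∀ z, z ∈ Q n → t • z ∈ Q (n + 1) := by
      intro n hn z hz
      obtain ⟨z1, hz1, _, ⟨z2, hz2, rfl⟩, rfl⟩ := Submodule.mem_sup.1 hz
      rw [smul_add]
      refine add_mem ?_ (Submodule.mem_sup_right ⟨z2, hz2, ?_⟩)
      · have h1 := (Submodule.smul_mono_left ((pow_le_pow_left' (hJsucc n hn) N).trans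
          (Ideal.sup_pow_le_pow_sup _ _ N)) : J n ^ N • LL ≤ _) hz1
        rw [Submodule.sup_smul, Submodule.ideal_span_singleton_smul] at h1
        obtain ⟨z3, hz3, _, ⟨z4, hz4, rfl⟩, rfl⟩ := Submodule.mem_sup.1 h1
        rw [smul_add]
        refine Submodule.add_mem_sup (Submodule.smul_mem _ _ hz3) ⟨t • z4, LL.smul_mem _ hz4, ?_⟩
        change t ^ (n + 1 - d) • t • z4 = t • t ^ (n + 1 - d) • z4
        rw [smul_comm]
      · change t ^ (n + 1 - d) • z2 = t • t ^ (n - d) • z2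
        rw [smul_smul, ← pow_succ']
        congr 2; omega
    have hQ : ∀ w n0, d ≤ n0 → t ^ n0 • chartFrac ι τ M w ∈ Q n0 →
        ∃ n0, ∀ n ≥ n0, t ^ n • chartFrac ι τ M w ∈ Q n := by
      intro w n0 hd h
      refine ⟨n0, fun n hn => ?_⟩
      induction n, hn using Nat.le_induction with
      | base => exact h
      | succ n hn ih =>
        rw [pow_succ', mul_smul]
        exact hQsucc n (hd.trans hn) _ ih
    have hQzero : ∃ n0, ∀ n ≥ n0, t ^ n • chartFrac ι τ M 0 ∈ Q n :=
      ⟨0, fun n _ => by rw [chartFrac, map_zero, smul_zero, smul_zero]; exact zero_mem _⟩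
    intro w hw
    obtain ⟨w1, hw1, w2, hw2, rfl⟩ := Submodule.mem_sup.1 hw
    refine hQadd _ _ ?_ ?_
    · refine hQ w1 d le_rfl (Submodule.mem_sup_right ⟨_, chartFrac_mem_chartSubmodule hy hE hyE
        (pow_smul_family G) hw1, ?_⟩)
      change t ^ (d - d) • chartFrac ι τ (M + d) w1 = _
      rw [Nat.sub_self, pow_zero, one_smul, ht, hτfrac, add_comm]
    · clear hw
      induction hw2 using Submodule.iSup_induction' with
      | zero => exact hQzero
      | add a b _ _ h h' => exact hQadd _ _ h h'
      | mem p w hw =>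
        induction hw using Submodule.iSup_induction' with
        | zero => exact hQzero
        | add a b _ _ h h' => exact hQadd _ _ h h'
        | mem hp w hw =>
          induction hw using Submodule.smul_induction_on' with
          | add a _ b _ h h' => exact hQadd _ _ h h'
          | smul e he g hg =>
            refine hQ _ p.1 hp.1 (Submodule.mem_sup_left ?_)
            obtain ⟨o, ho, e1⟩ := hJpow _ e he
            -- The defining inequality of the family, rewritten as p N + q ≤ p + M; this uses N ≥ 1.
            obtain ⟨q, hq⟩ : ∃ q, p.1 + M = q + (p.1 * N + p.2) := by
              obtain ⟨N', rfl⟩ : ∃ N', N = N' + 1 := ⟨N - 1, by omega⟩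
              refine ⟨p.1 + M - (p.1 * (N' + 1) + p.2), ?_⟩
              have := hp.2
              rw [Nat.add_sub_cancel, mul_comm] at this
              rw [mul_add, mul_one]
              omega
            have e2 : t ^ p.1 • chartFrac ι τ M (e • g) = o • t ^ q • chartFrac ι τ p.2 g := by
              rw [ht, ht, hτfrac, hq]
              change _ = (o : S') • (τ ^ q • chartFrac ι τ p.2 g)
              rw [e1, chartFrac, chartFrac, map_smul, ← algebraMap_smul S' e, smul_smul, smul_smul,
                smul_smul]
              congr 1; ring
            rw [e2]
            exact Submodule.smul_mem_smul ho (LL.smul_mem _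
              (chartFrac_mem_chartSubmodule hy hE hyE (pow_smul_family G) hg))
  have hshift : ∀ n ≥ b1 + d, LL.map (LinearMap.lsmul (chartRing R s τ) B' (t ^ (n - d))) ≤
      D.map (LinearMap.lsmul (chartRing R s τ) B' (t ^ (n - b1 - d))) := by
    rintro n hn _ ⟨z, hz, rfl⟩
    refine ⟨t ^ b1 • z, D.smul_mem _ (Submodule.mem_sup_left hz), ?_⟩
    change t ^ (n - b1 - d) • t ^ b1 • z = t ^ (n - d) • z
    rw [smul_smul, ← pow_add]
    congr 2; omega
  -- b1 is lost in `hJV` and again when returning from Vv to VV; b2 is the Artin–Rees constant.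
  refine ⟨2 * b1 + b2, fun m a ⟨c, hc⟩ ⟨j, hj⟩ => ?_⟩
  obtain ⟨n0, hn0⟩ := hW _ _ hj
  set n := n0 + c + b1 + b2 + d with hn
  have h1 : t ^ n • chartFrac ι τ (m + j) (y ^ j • a) = t ^ (n + m - c) • chartFrac ι τ c a := by
    rw [chartFrac_smul hy, ht, ht, hτfrac, hτfrac]
    congr 1; omega
  have hVa : t ^ (n + m - c) • chartFrac ι τ c a ∈ Vv := Submodule.mem_sup_left
    (VV.smul_mem _ (chartFrac_mem_chartSubmodule hy hE hyE _ hc))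
  obtain ⟨v', hv', e⟩ := hb2 (n - b1) (J n) (hJV n (by omega)) _ hVa (by
    rw [← h1]
    have hle : J n ^ N • LL ⊔ LL.map (LinearMap.lsmul (chartRing R s τ) B' (t ^ (n - d))) ≤
        J n ^ N0 • D ⊔ D.map (LinearMap.lsmul (chartRing R s τ) B' (t ^ (n - b1 - d))) := by
      refine sup_le_sup (Submodule.smul_mono (Ideal.pow_le_pow_right (le_of_max_le_left hN))
        le_sup_left) ?_
      exact hshift n (by omega)
    exact hle (hn0 n (by omega)))
  obtain ⟨p, v, hv, e1⟩ := hb1 v' hv'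
  have e2 : chartFrac ι τ (m + (2 * b1 + b2)) a = chartFrac ι τ p v := by
    apply hτu (n - b1 - b2)
    rw [← e1, ← ht, ← ht, smul_comm, ← e, ht, ht, ht, hτfrac, smul_smul, ← pow_add, hτfrac]
    congr 1; omega
  obtain ⟨q, hq⟩ := exists_smul_eq_of_chartFrac_eq hy hker e2
  refine ⟨q + p, ?_⟩
  rw [hq]
  have := pow_smul_mem_family hET hyE (q + (m + (2 * b1 + b2))) hv
  convert this using 2; omega

end Chart

/-! ### Saturation and gluing of charts -/

section Saturation

variable {R S B : Type*} [CommRing R] [CommRing S] [Algebra R S] [AddCommGroup B] [Module R B]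
  [Module S B] [IsScalarTower R S B]

theorem Submodule.smul_pow_le_add {E : Submodule R S} {X : ℕ → Submodule R B}
    (hX : ∀ n, E • X n ≤ X (n + 1)) (j n : ℕ) : E ^ j • X n ≤ X (n + j) := by
  induction j with
  | zero => rw [pow_zero, Submodule.one_smul, add_zero]
  | succ j ih =>
    rw [Submodule.pow_succ_smul]
    exact (Submodule.smul_mono le_rfl ih).trans (hX _)

theorem Submodule.pow_smul_le_of_le {E : Submodule R S} {X : ℕ → Submodule R B}
    (hX : ∀ n, E • X n ≤ X (n + 1)) {P : Submodule R B} {m i j : ℕ} (h : E ^ j • P ≤ X (m + j))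
    (hij : j ≤ i) : E ^ i • P ≤ X (m + i) := by
  obtain ⟨q, rfl⟩ := Nat.exists_eq_add_of_le hij
  rw [add_comm j q, Submodule.pow_add_smul]
  refine (Submodule.smul_mono le_rfl h).trans ((Submodule.smul_pow_le_add hX q _).trans (le_of_eq ?_))
  congr 1; omega

/-- The elements that are eventually multiplied into `X (m + j)` by `E ^ j`. -/
def saturation (E : Submodule R S) (X : ℕ → Submodule R B) (hX : ∀ n, E • X n ≤ X (n + 1))
    (m : ℕ) : Submodule R B where
  carrier := {b | ∃ j, E ^ j • (Submodule.span R {b}) ≤ X (m + j)}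
  zero_mem' := ⟨0, by simp⟩
  add_mem' := by
    rintro a b ⟨i, hi⟩ ⟨j, hj⟩
    refine ⟨max i j, le_trans (Submodule.smul_mono le_rfl (?_ : _ ≤ Submodule.span R {a} ⊔
      Submodule.span R {b})) ?_⟩
    · rw [Submodule.span_singleton_le_iff_mem]
      exact Submodule.add_mem_sup (Submodule.mem_span_singleton_self a)
        (Submodule.mem_span_singleton_self b)
    · rw [Submodule.smul_sup]
      exact sup_le (Submodule.pow_smul_le_of_le hX hi (le_max_left _ _))
        (Submodule.pow_smul_le_of_le hX hj (le_max_right _ _))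
  smul_mem' := by
    rintro r b ⟨j, hj⟩
    refine ⟨j, (Submodule.smul_mono le_rfl ?_).trans hj⟩
    rw [Submodule.span_singleton_le_iff_mem]
    exact Submodule.smul_mem _ r (Submodule.mem_span_singleton_self b)

variable {E : Submodule R S} {X : ℕ → Submodule R B} (hX : ∀ n, E • X n ≤ X (n + 1))

theorem le_saturation (m : ℕ) : X m ≤ saturation E X hX m := by
  intro b hb
  exact ⟨0, by rwa [pow_zero, Submodule.one_smul, Submodule.span_singleton_le_iff_mem, add_zero]⟩

theorem smul_saturation_le (m : ℕ) : E • saturation E X hX m ≤ saturation E X hX (m + 1) := by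
  rw [Submodule.smul_le]
  rintro e he b ⟨j, hj⟩
  refine ⟨j, ?_⟩
  have h1 : Submodule.span R {e • b} ≤ E • Submodule.span R {b} := by
    rw [Submodule.span_singleton_le_iff_mem]
    exact Submodule.smul_mem_smul he (Submodule.mem_span_singleton_self b)
  refine (Submodule.smul_mono le_rfl h1).trans ?_
  rw [Submodule.smul_comm_eq]
  refine (Submodule.smul_mono le_rfl hj).trans ((hX _).trans (le_of_eq ?_))
  congr 1; omega

theorem exists_pow_smul_le_of_le_saturation {F : Submodule R B} (hF : F.FG) {m : ℕ}
    (h : F ≤ saturation E X hX m) : ∃ j, E ^ j • F ≤ X (m + j) := by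
  obtain ⟨t, rfl⟩ := hF
  have h1 : ∀ b : t, ∃ j, E ^ j • (Submodule.span R {(b : B)}) ≤ X (m + j) := fun b =>
    h (Submodule.subset_span b.2)
  choose f hf using h1
  refine ⟨Finset.univ.sup f, ?_⟩
  have h2 : Submodule.span R (t : Set B) ≤ ⨆ b : t, Submodule.span R {(b : B)} := by
    rw [Submodule.span_le]
    intro b hb
    exact Submodule.mem_iSup_of_mem ⟨b, hb⟩ (Submodule.mem_span_singleton_self b)
  refine (Submodule.smul_mono le_rfl h2).trans ?_
  rw [Submodule.smul_iSup]
  exact iSup_le fun b => Submodule.pow_smul_le_of_le hX (hf b) (Finset.le_sup (Finset.mem_univ b))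

theorem mem_saturation_of_smul_le (hE : E.FG) {m : ℕ} {b : B}
    (h : E • Submodule.span R {b} ≤ saturation E X hX (m + 1)) : b ∈ saturation E X hX m := by
  obtain ⟨j, hj⟩ := exists_pow_smul_le_of_le_saturation hX
    (Submodule.smul_fg hE (Submodule.fg_span_singleton b)) h
  refine ⟨j + 1, ?_⟩
  rw [Submodule.pow_add_smul, pow_one]
  exact hj.trans (le_of_eq (by congr 1; omega))

/-- Pigeonhole: a product of p + q factors taken from Y or K has at least p factors in Y or at least
q in K. -/
theorem Submodule.sup_pow_add_le {Y K : Submodule R S} (hY : Y ≤ E) (hK : K ≤ E) (p q : ℕ) :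
    (Y ⊔ K) ^ (p + q) ≤ Y ^ p * E ^ q ⊔ E ^ p * K ^ q := by
  have hYK : Y ⊔ K ≤ E := sup_le hY hK
  induction hn : p + q generalizing p q with
  | zero =>
    obtain ⟨rfl, rfl⟩ : p = 0 ∧ q = 0 := by omega
    simp
  | succ n ih =>
    rcases p with _ | p
    · rw [pow_zero, one_mul, ← hn, zero_add]
      exact le_sup_of_le_left (pow_le_pow_left' hYK q)
    rcases q with _ | q
    · rw [pow_zero, mul_one, ← hn, add_zero]
      exact le_sup_of_le_right (by simpa using pow_le_pow_left' hYK (p + 1))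
    rw [pow_succ', Submodule.sup_mul]
    refine sup_le ?_ ?_
    · refine (mul_le_mul' le_rfl (ih p (q + 1) (by omega))).trans ?_
      rw [Submodule.mul_sup, ← mul_assoc, ← mul_assoc, ← pow_succ', pow_succ' E p]
      exact sup_le_sup le_rfl (mul_le_mul' (mul_le_mul' hY le_rfl) le_rfl)
    · refine (mul_le_mul' le_rfl (ih (p + 1) q (by omega))).trans ?_
      rw [Submodule.mul_sup, pow_succ' E q, pow_succ' K q, mul_left_comm K, mul_left_comm K]
      exact sup_le_sup (mul_le_mul' le_rfl (mul_le_mul' hK le_rfl)) le_rfl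

/-- The charts cover: by pigeonhole a large power of E is generated by products that contain a high
power of some y in t, so conditions on the separate powers y^j control all of E^j. -/
theorem mem_saturation_of_pow_smul_mem (t : Finset S) (ht : Submodule.span R (t : Set S) = E)
    {m : ℕ} {a : B} (h : ∀ y ∈ t, ∃ j, y ^ j • a ∈ X (m + j)) : a ∈ saturation E X hX m := by
  classical
  have key : ∀ u : Finset S, u ⊆ t →
      ∃ j, Submodule.span R (u : Set S) ^ j • Submodule.span R {a} ≤ X (m + j) := by
    intro u
    induction u using Finset.induction_on with
    -- The exponent is 1, not 0: the zeroth power of the zero submodule is 1.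
    | empty => intro _; exact ⟨1, by simp⟩
    | insert y u hyu ih =>
      intro hu
      obtain ⟨q, hq⟩ := ih fun z hz => hu (Finset.mem_insert_of_mem hz)
      obtain ⟨p, hp⟩ := h y (hu (Finset.mem_insert_self _ _))
      refine ⟨p + q, ?_⟩
      have hyE : Submodule.span R {y} ≤ E := by
        rw [← ht]
        exact Submodule.span_mono (by simpa using hu (Finset.mem_insert_self _ _))
      have huE : Submodule.span R (u : Set S) ≤ E := by
        rw [← ht]
        exact Submodule.span_mono fun z hz => hu (Finset.mem_insert_of_mem hz)
      rw [Finset.coe_insert, Submodule.span_insert]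
      refine (Submodule.smul_mono_left (Submodule.sup_pow_add_le hyE huE p q)).trans ?_
      rw [Submodule.sup_smul]
      refine sup_le ?_ ?_
      · rw [mul_comm, Submodule.mul_smul_eq, Submodule.span_pow, Set.singleton_pow, ← add_assoc]
        refine (Submodule.smul_mono le_rfl ?_).trans (Submodule.smul_pow_le_add hX q (m + p))
        rw [Submodule.smul_le]
        intro r hr b hb
        obtain ⟨c, rfl⟩ := Submodule.mem_span_singleton.1 hr
        obtain ⟨d, rfl⟩ := Submodule.mem_span_singleton.1 hb
        rw [smul_assoc, smul_comm (y ^ p) d a]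
        exact Submodule.smul_mem _ _ (Submodule.smul_mem _ _ hp)
      · rw [Submodule.mul_smul_eq, add_comm p q, ← add_assoc]
        exact (Submodule.smul_mono le_rfl hq).trans (Submodule.smul_pow_le_add hX p (m + q))
  obtain ⟨j, hj⟩ := key t le_rfl
  exact ⟨j, by rwa [ht] at hj⟩

end Saturation

/-! ### Torsion and generation of saturated families -/

section Torsion

variable {R S B : Type*} [CommRing R] [IsNoetherianRing R] [CommRing S] [Algebra R S]
  [AddCommGroup B] [Module R B] [Module S B] [IsScalarTower R S B] {k : ℕ} (x : Fin k → S)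

theorem pow_smul_stable (V : Submodule R B) (n : ℕ) :
    linForms R x • linForms R x ^ n • V ≤ linForms R x ^ (n + 1) • V := by
  rw [← Submodule.pow_succ_smul]

theorem iSup_map_smulBy_le {X : Submodule R B} :
    ⨆ i, X.map (smulBy R B (x i)) ≤ linForms R x • X := by
  rw [linForms_smul]; exact le_sup_right

/-- The torsion of the associated graded module of the filtration `E ^ n V` has bounded degree. -/
theorem exists_saturation_inf_le {V : Submodule R B} (hV : RelFG V (linForms R x • V)) :
    ∃ n0, ∀ n ≥ n0, linForms R x ^ (n + 1) • V ⊓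
      saturation (linForms R x) (fun n => linForms R x ^ n • V) (pow_smul_stable x V) n ≤
        linForms R x ^ n • V := by
  set E := linForms R x with hE
  set X : ℕ → Submodule R B := fun n => E ^ n • V with hX
  have hst : ∀ n, E • X n ≤ X (n + 1) := pow_smul_stable x V
  set N : ℕ → Submodule R B := fun n => X (n + 1) ⊓ saturation E X hst n with hN
  have hmono : ∀ n, X n ≤ X (n + 1) := fun n => pow_smul_le_pow_smul n.le_succ V
  have hxmem : ∀ i, x i ∈ E := mem_linForms R x
  obtain ⟨n1, hn1⟩ := exists_graded_generation x X N (fun n => X (n + 1))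
    (fun n => le_inf (hmono n) (le_saturation hst n)) (fun n => inf_le_left)
    (fun n i a ha => hst n (Submodule.smul_mem_smul (hxmem i) ha))
    (fun n i a ha => ⟨hst _ (Submodule.smul_mem_smul (hxmem i) ha.1),
      smul_saturation_le hst n (Submodule.smul_mem_smul (hxmem i) ha.2)⟩)
    (fun n i a ha => hst _ (Submodule.smul_mem_smul (hxmem i) ha))
    (fun n => hV.pow_smul n) 0 (fun n _ => pow_succ_smul_le (n + 1) V)
  -- N n / X n is the torsion in degree n. From degree n1 on it is generated by N n1, which is
  -- finitely generated modulo X n1 and therefore carried into X by one power E^j; hence it vanishes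
  -- from degree n1 + j on.
  obtain ⟨F, hF, hFN, hNF⟩ := (hV.pow_smul n1).mono (U' := X n1) (V' := N n1) le_rfl inf_le_left
  obtain ⟨j, hj⟩ := exists_pow_smul_le_of_le_saturation hst hF (hFN.trans inf_le_right)
  have hj' : E ^ j • N n1 ≤ X (n1 + j) := by
    refine (Submodule.smul_mono le_rfl hNF).trans ?_
    rw [Submodule.smul_sup]
    exact sup_le (Submodule.smul_pow_le_add hst j n1) hj
  have hind : ∀ n, N (n1 + n) ≤ X (n1 + n) ⊔ E ^ n • N n1 := by
    intro n
    induction n with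
    | zero => rw [pow_zero, Submodule.one_smul]; exact le_sup_right
    | succ n ih =>
      refine (hn1 (n1 + n) (by omega)).trans (sup_le le_sup_left ?_)
      refine (iSup_map_smulBy_le x).trans ((Submodule.smul_mono le_rfl ih).trans ?_)
      rw [Submodule.smul_sup, ← Submodule.pow_succ_smul E n (N n1)]
      exact sup_le_sup (hst _) le_rfl
  refine ⟨n1 + j, fun n hn => ?_⟩
  obtain ⟨q, rfl⟩ := Nat.exists_eq_add_of_le hn
  have := hind (j + q)
  rw [← add_assoc] at this
  refine this.trans (sup_le le_rfl ?_)
  rw [add_comm j q, Submodule.pow_add_smul]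
  have h2 := Submodule.smul_pow_le_add hst q (n1 + j)
  exact le_trans (Submodule.smul_mono le_rfl hj') h2

theorem Submodule.pi_eq_iSup {κ : Type*} [Fintype κ] [DecidableEq κ] (P : Submodule R B) :
    Submodule.pi Set.univ (fun _ : κ => P) =
      ⨆ i, P.map (LinearMap.single R (fun _ : κ => B) i) := by
  apply le_antisymm
  · intro v hv
    have : v = ∑ i, LinearMap.single R (fun _ : κ => B) i (v i) := by
      ext j
      rw [Finset.sum_apply, Finset.sum_eq_single j] <;> simp +contextual [eq_comm]
    rw [this]
    exact sum_mem fun i _ => Submodule.mem_iSup_of_mem i ⟨v i, hv i trivial, rfl⟩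
  · refine iSup_le fun i => ?_
    rintro _ ⟨b, hb, rfl⟩ j -
    by_cases h : j = i
    · subst h; simpa using hb
    · simp [Pi.single_eq_of_ne h]

/-- A saturated family is generated in large degrees by the top-degree part, provided that this
holds up to saturation. -/
theorem exists_saturation_generated {X : ℕ → Submodule R B}
    (hX : ∀ n, linForms R x • X n ≤ X (n + 1)) {G : Submodule R B} (hG : G.FG)
    (hGX : ∀ n, linForms R x ^ n • G ≤ X n) (N : ℕ)
    (hN : ∀ m, linForms R x ^ (N + 1) • X m ≤ linForms R x ^ (m + N + 1) • G ⊔ X (m + N)) :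
    ∃ n0, ∀ n ≥ n0, saturation (linForms R x) X hX (n + 1) ≤
      saturation (linForms R x) X hX n ⊔ linForms R x ^ (n + 1) • G := by
  classical
  set E := linForms R x with hE
  have hE1 : 1 ≤ E := one_le_linForms R x
  have hxmem : ∀ i, x i ∈ E := mem_linForms R x
  set W := saturation E X hX with hW
  have hEW : ∀ n, E • W n ≤ W (n + 1) := smul_saturation_le hX
  have hWmono : ∀ n, W n ≤ W (n + 1) := fun n =>
    (Submodule.le_smul_of_one_le hE1 _).trans (hEW n)
  have hGW : ∀ n, E ^ n • G ≤ W n := fun n => (hGX n).trans (le_saturation hX n)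
  set Y : ℕ → Submodule R B := fun n => W n ⊔ E ^ (n + 1) • G with hYdef
  have hYW : ∀ n, Y n ≤ W (n + 1) := fun n => sup_le (hWmono n) (hGW _)
  have hEY : ∀ n, E • Y n ≤ Y (n + 1) := by
    intro n
    simp only [hYdef]
    rw [Submodule.smul_sup, ← Submodule.pow_succ_smul]
    exact sup_le_sup (hEW n) le_rfl
  have hYgen : ∀ n, Y (n + 1) ≤ W (n + 1) ⊔ ⨆ i, (Y n).map (smulBy R B (x i)) := by
    intro n
    refine sup_le le_sup_left ?_
    rw [Submodule.pow_succ_smul, hE, linForms_smul, ← hE]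
    refine sup_le ((hGW _).trans le_sup_left) (le_sup_of_le_right (iSup_mono fun i => ?_))
    exact Submodule.map_mono le_sup_right
  -- The elements of W (n+1) whose classes modulo Y are annihilated by all x_i: the socle of W (n+1)
  -- / Y n. It suffices to show that it vanishes in large degrees.
  let D : ℕ → Submodule R B := fun n => W (n + 1) ⊓ ⨅ i, (Y (n + 1)).comap (smulBy R B (x i))
  have hDmem : ∀ n b, b ∈ D n ↔ b ∈ W (n + 1) ∧ ∀ i, x i • b ∈ Y (n + 1) := by
    intro n b
    simp only [D, Submodule.mem_inf, Submodule.mem_iInf, Submodule.mem_comap]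
    rfl
  have hDx : ∀ n i, ∀ b ∈ D n, x i • b ∈ D (n + 1) := by
    intro n i b hb
    rw [hDmem] at hb ⊢
    refine ⟨hEW _ (Submodule.smul_mem_smul (hxmem i) hb.1), fun j => ?_⟩
    rw [smul_comm]
    exact hEY _ (Submodule.smul_mem_smul (hxmem i) (hb.2 j))
  -- Because W is saturated, δ embeds D n / W n into (Y (n+1) / W (n+1))^k. The target is finitely
  -- generated as a graded module, since Y / W is generated by G; so D / W is finitely generated in
  -- the graded sense.
  let δ : B →ₗ[R] (Fin k → B) := LinearMap.pi fun i => smulBy R B (x i)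
  have hδ : ∀ b i, δ b i = x i • b := fun _ _ => rfl
  have hδx : ∀ b i, x i • δ b = δ (x i • b) := by
    intro b i; ext j; rw [Pi.smul_apply, hδ, hδ, smul_comm]
  let pi : Submodule R B → Submodule R (Fin k → B) := fun P => Submodule.pi Set.univ fun _ => P
  have hpimono : ∀ {P Q}, P ≤ Q → pi P ≤ pi Q := fun h v hv i _ => h (hv i trivial)
  have hpix : ∀ {P Q : Submodule R B}, E • P ≤ Q → ∀ i, ∀ v ∈ pi P, x i • v ∈ pi Q :=
    fun h i v hv j _ => h (Submodule.smul_mem_smul (hxmem i) (hv j trivial))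
  obtain ⟨n1, hn1⟩ := exists_graded_generation x (fun n => pi (W (n + 1)))
    (fun n => pi (W (n + 1)) ⊔ (D n).map δ) (fun n => pi (Y (n + 1))) (fun n => le_sup_left)
    (fun n => sup_le (hpimono le_sup_left) (by
      rintro _ ⟨b, hb, rfl⟩ i -
      exact ((hDmem n b).1 hb).2 i))
    (fun n i a ha => hpix (hEW _) i a ha)
    (fun n i a ha => by
      obtain ⟨b, hb, _, ⟨c, hc, rfl⟩, rfl⟩ := Submodule.mem_sup.1 ha
      rw [smul_add, hδx]
      exact Submodule.add_mem_sup (hpix (hEW _) i b hb) ⟨_, hDx n i c hc, rfl⟩)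
    (fun n i a ha => hpix (hEY _) i a ha)
    (fun n => by
      refine .of_le_sup (F := pi (E ^ (n + 2) • G)) ?_ ?_
      · change (Submodule.pi Set.univ fun _ => _).FG
        rw [Submodule.pi_eq_iSup]
        exact Submodule.fg_iSup _ fun i =>
          (Submodule.smul_fg ((linForms_fg R x).pow _) hG).map _
      · change Submodule.pi Set.univ (fun _ => _) ≤ _
        rw [Submodule.pi_eq_iSup]
        refine iSup_le fun i => ?_
        change (W (n + 1) ⊔ E ^ (n + 2) • G).map _ ≤ _
        rw [Submodule.map_sup]
        refine sup_le_sup ?_ ?_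
        · change _ ≤ Submodule.pi Set.univ fun _ => _
          rw [Submodule.pi_eq_iSup]
          exact le_iSup (fun i => (W (n + 1)).map (LinearMap.single R (fun _ : Fin k => B) i)) i
        · change _ ≤ Submodule.pi Set.univ fun _ => _
          rw [Submodule.pi_eq_iSup]
          exact le_iSup
            (fun i => (E ^ (n + 2) • G).map (LinearMap.single R (fun _ : Fin k => B) i)) i)
    0 (fun n _ => by
      change Submodule.pi Set.univ (fun _ => _) ≤ _
      rw [Submodule.pi_eq_iSup]
      refine iSup_le fun i => (Submodule.map_mono (hYgen (n + 1))).trans ?_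
      rw [Submodule.map_sup, Submodule.map_iSup]
      refine sup_le_sup ?_ (iSup_mono fun l => ?_)
      · change _ ≤ Submodule.pi Set.univ fun _ => _
        rw [Submodule.pi_eq_iSup]
        exact le_iSup (fun i => (W (n + 2)).map (LinearMap.single R (fun _ : Fin k => B) i)) i
      · rintro _ ⟨_, ⟨b, hb, rfl⟩, rfl⟩
        refine ⟨LinearMap.single R (fun _ : Fin k => B) i b, ?_, ?_⟩
        · intro j _
          by_cases h : j = i
          · subst h; simpa using hb
          · simp [Pi.single_eq_of_ne h]
        · ext j
          by_cases h : j = i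
          · subst h; simp
          · simp [Pi.single_eq_of_ne h])
  -- In large degrees D n is obtained, modulo W n, from the x_i D (n-1), which lie in Y n by the
  -- definition of D.
  have hDY : ∀ n ≥ n1 + 1, D n ≤ Y n := by
    intro n hn b hb
    obtain ⟨n, rfl⟩ : ∃ m, n = m + 1 := ⟨n - 1, by omega⟩
    have h1 := hn1 n (by omega) (Submodule.mem_sup_right ⟨b, hb, rfl⟩ :
      δ b ∈ pi (W (n + 1 + 1)) ⊔ (D (n + 1)).map δ)
    have h2 : ⨆ i, (pi (W (n + 1)) ⊔ (D n).map δ).map (smulBy R (Fin k → B) (x i)) ≤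
        pi (W (n + 2)) ⊔ (⨆ i, (D n).map (smulBy R B (x i))).map δ := by
      refine iSup_le fun i => ?_
      rw [Submodule.map_sup, Submodule.map_iSup]
      refine sup_le_sup ?_ ?_
      · rintro _ ⟨v, hv, rfl⟩
        exact hpix (hEW _) i v hv
      · refine le_iSup_of_le i ?_
        rintro _ ⟨_, ⟨c, hc, rfl⟩, rfl⟩
        exact ⟨_, ⟨c, hc, rfl⟩, (hδx c i).symm⟩
    obtain ⟨w, hw, _, ⟨c, hc, rfl⟩, e⟩ := Submodule.mem_sup.1
      (sup_le le_sup_left h2 h1 : δ b ∈ pi (W (n + 2)) ⊔ _)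
    have hcY : c ∈ Y (n + 1) := by
      have : ⨆ i, (D n).map (smulBy R B (x i)) ≤ Y (n + 1) := by
        refine iSup_le fun i => ?_
        rintro _ ⟨d, hd, rfl⟩
        exact ((hDmem n d).1 hd).2 i
      exact this hc
    have h3 : b - c ∈ W (n + 1) := by
      refine mem_saturation_of_smul_le hX (linForms_fg R x) ?_
      rw [linForms_smul]
      refine sup_le ?_ (iSup_le fun i => ?_)
      · rw [Submodule.span_singleton_le_iff_mem]
        exact sub_mem ((hDmem _ b).1 hb).1 (hYW _ hcY)
      · rw [Submodule.map_span_le]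
        rintro d rfl
        have h4 := congrFun e i
        rw [Pi.add_apply, hδ, hδ] at h4
        change x i • (b - c) ∈ _
        rw [smul_sub, ← h4, add_sub_cancel_right]
        exact hw i trivial
    have : b = (b - c) + c := by abel
    rw [this]
    exact add_mem (Submodule.mem_sup_left h3) hcY
  -- A nonzero class killed by a power of E would produce a nonzero socle element. Concretely, x_i b
  -- lies in Y (n+1) by induction, so b lies in D n ≤ Y n.
  have hdesc : ∀ j, ∀ n ≥ n1 + 1, ∀ b ∈ W (n + 1), E ^ j • Submodule.span R {b} ≤ Y (n + j) →
      b ∈ Y n := by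
    intro j
    induction j with
    | zero =>
      intro n _ b _ h
      rw [pow_zero, Submodule.one_smul] at h
      exact h (Submodule.mem_span_singleton_self b)
    | succ j ih =>
      intro n hn b hb h
      refine hDY n hn ((hDmem n b).2 ⟨hb, fun i => ?_⟩)
      refine ih (n + 1) (by omega) _ (hEW _ (Submodule.smul_mem_smul (hxmem i) hb)) ?_
      have h1 : Submodule.span R {x i • b} ≤ E • Submodule.span R {b} := by
        rw [Submodule.span_singleton_le_iff_mem]
        exact Submodule.smul_mem_smul (hxmem i) (Submodule.mem_span_singleton_self b)
      refine (Submodule.smul_mono le_rfl h1).trans ?_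
      rw [Submodule.pow_add_smul, pow_one] at h
      exact h.trans (le_of_eq (by congr 1; omega))
  refine ⟨n1 + 1, fun n hn b hb => ?_⟩
  obtain ⟨j, hj⟩ := hb
  -- E^j brings b into X by saturation; N + 1 further factors bring it into Y by the hypothesis
  -- `hN`.
  refine hdesc (N + 1 + j) n hn b ⟨j, hj⟩ ?_
  rw [Submodule.pow_add_smul]
  refine (Submodule.smul_mono le_rfl hj).trans ((hN _).trans ?_)
  refine sup_le ?_ ?_
  · refine le_sup_of_le_right (le_of_eq ?_)
    congr 2; omega
  · refine le_sup_of_le_left ((le_saturation hX _).trans (le_of_eq ?_))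
    rw [← hW]; congr 1; omega

end Torsion

/-! ### Intersections and colon submodules -/

section RelFGInf

variable {R : Type*} [CommRing R] [IsNoetherianRing R] {A : Type*} [AddCommGroup A] [Module R A]

theorem RelFG.inf_left {U V : Submodule R A} (h : RelFG U V) (W : Submodule R A) :
    RelFG (W ⊓ U) (W ⊓ V) := by
  have := (h.comap W.subtype).map W.subtype
  rwa [Submodule.map_comap_subtype, Submodule.map_comap_subtype] at this

theorem RelFG.inf {U V U' V' : Submodule R A} (h : RelFG U V) (h' : RelFG U' V') :
    RelFG (U ⊓ U') (V ⊓ V') := by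
  have h1 := h'.inf_left U
  have h2 := h.inf_left V'
  rw [inf_comm V' U, inf_comm V' V] at h2
  exact h1.trans h2

end RelFGInf

section Colon

variable {R S B : Type*} [CommRing R] [CommRing S] [Algebra R S]
  [AddCommGroup B] [Module R B] [Module S B] [IsScalarTower R S B]

/-- The elements of `S` that multiply `F` into `V`. -/
def colonSubmodule (S : Type*) {R B : Type*} [CommRing R] [CommRing S] [Algebra R S]
    [AddCommGroup B] [Module R B] [Module S B] [IsScalarTower R S B] (V : Submodule R B)
    (F : Set B) : Submodule R S where
  carrier := {s | ∀ f ∈ F, s • f ∈ V}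
  zero_mem' := fun f _ => by rw [zero_smul]; exact V.zero_mem
  add_mem' := fun {a b} h h' f hf => by rw [add_smul]; exact V.add_mem (h f hf) (h' f hf)
  smul_mem' := fun r s h f hf => by rw [smul_assoc]; exact V.smul_mem r (h f hf)

theorem RelFG.colon [IsNoetherianRing R] {U V : Submodule R B} (h : RelFG U V) (t : Finset B) :
    RelFG (colonSubmodule S U t) (colonSubmodule S V t) := by
  classical
  induction t using Finset.induction_on with
  | empty =>
    refine ⟨⊥, Submodule.fg_bot, bot_le, le_sup_of_le_left fun s _ f hf => ?_⟩
    simp at hf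
  | insert b t hb ih =>
    have h1 : ∀ P : Submodule R B, colonSubmodule S P (insert b t : Finset B) =
        P.comap ((LinearMap.toSpanSingleton S B b).restrictScalars R) ⊓ colonSubmodule S P t := by
      intro P
      ext s
      simp [colonSubmodule]
    rw [h1, h1]
    exact (h.comap _).inf ih

theorem Submodule.FG.le_pow {E P : Submodule R S} (hE : 1 ≤ E) (hS : ∀ s : S, ∃ n : ℕ, s ∈ E ^ n)
    (hP : P.FG) : ∃ n : ℕ, P ≤ E ^ n := by
  obtain ⟨t, rfl⟩ := hP
  choose f hf using hS
  refine ⟨t.sup f, Submodule.span_le.2 fun s hs => ?_⟩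
  exact pow_le_pow_right₀ hE (Finset.le_sup hs) (hf s)

/-- E (V : F) lies in (E V : F), and (E V : F) / (V : F) embeds into finitely many copies of E V /
V, one for each generator of F. It is therefore finitely generated, and its generators lie in some
E^d. -/
theorem exists_mul_colon_le [IsNoetherianRing R] {E : Submodule R S} (hE : 1 ≤ E)
    (hS : ∀ s : S, ∃ n : ℕ, s ∈ E ^ n) {V : Submodule R B} (hV : RelFG V (E • V)) {F : Submodule R B}
    (hF : F.FG) : ∃ d : ℕ, E * colonSubmodule S V F ≤ colonSubmodule S V F ⊔ E ^ d := by
  obtain ⟨t, rfl⟩ := hF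
  have h1 : ∀ P : Submodule R B, colonSubmodule S P (Submodule.span R (t : Set B)) =
      colonSubmodule S P t := by
    intro P
    apply le_antisymm
    · exact fun s hs f hf => hs f (Submodule.subset_span hf)
    · intro s hs f hf
      have : Submodule.span R (t : Set B) ≤ P.comap (smulBy R B s) :=
        Submodule.span_le.2 fun f hf => hs f hf
      exact this hf
  obtain ⟨Q, hQ, -, hle⟩ := hV.colon (S := S) t
  obtain ⟨d, hd⟩ := hQ.le_pow hE hS
  refine ⟨d, ?_⟩
  rw [h1]
  refine le_trans ?_ (hle.trans (sup_le_sup_left hd _))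
  rw [Submodule.mul_le]
  intro e he s hs f hf
  rw [mul_smul]
  exact Submodule.smul_mem_smul he (hs f hf)

end Colon

section ChartLocalization

variable {R S B : Type*} [CommRing R] [IsNoetherianRing R] [CommRing S] [Algebra R S]
  [AddCommGroup B] [Module R B] [Module S B] [IsScalarTower R S B]

theorem exists_chart_bound_of_localization {E : Submodule R S} (hEfg : E.FG) (hE1 : 1 ≤ E) {y : S}
    (hyE : y ∈ E) (T : ℕ → Submodule R B)
    (hTmono : ∀ n, T n ≤ T (n + 1)) (hET : ∀ n, E • T n ≤ T (n + 1)) {F G : Submodule R B}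
    (hF : F.FG) (hG : G.FG) (hTF : ∀ n, T (n + 1) ≤ T n ⊔ E ^ n • F) (d : ℕ)
    (I : ℕ → Submodule R S) (hIE : ∀ n, I n ≤ E ^ n)
    (hI : ∀ n ≥ d, E * I n ≤ I (n + 1) ⊔ E ^ d) (hIT : ∀ n p, n ≤ p → I n • T p ≤ T p) :
    ∃ N0, ∀ N ≥ N0, ∃ b : ℕ, ∀ m : ℕ, ∀ a : B, (∃ c, a ∈ T c) →
      (∃ j, y ^ j • a ∈ extensionFamily E G I d N (m + j)) → ∃ j, y ^ j • a ∈ T (m + b + j) := by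
  obtain ⟨s, hs⟩ := hEfg
  refine exists_chart_bound (S' := Localization.Away y) (B' := LocalizedModule (.powers y) B)
    (ι := LocalizedModule.mkLinearMap (.powers y) B) (τ := IsLocalization.Away.invSelf y)
    ?_ hs hyE hE1 ?_ T hTmono hET hF hG hTF d I hIE hI hIT
  · rw [mul_comm]; exact IsLocalization.Away.mul_invSelf y
  · intro b hb
    obtain ⟨⟨_, j, rfl⟩, hj⟩ := (IsLocalizedModule.eq_zero_iff (.powers y)
      (LocalizedModule.mkLinearMap (.powers y) B)).1 hb
    exact ⟨j, hj⟩

end ChartLocalization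

/-! ### Ideals whose cyclic quotients have finite length -/

section FiniteLengthIdeal

variable {R : Type u} [CommRing R] (lam : LengthFunction.{u, v} R)
  (B : Type v) [AddCommGroup B] [Module R B]

/-- Cyclic subquotients of `B` killed by the ideal `c` have finite length. -/
def IsFiniteLengthIdeal (c : Ideal R) : Prop :=
  ∀ (l : B) (P : Submodule R B), (∀ r ∈ c, r • l ∈ P) → relLen lam P (Submodule.span R {l}) ≠ ∞

variable {lam B}

theorem IsFiniteLengthIdeal.one : IsFiniteLengthIdeal lam B (1 : Ideal R) := by
  intro l P h
  rw [relLen_eq_zero lam]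
  · exact ENNReal.zero_ne_top
  · rw [Submodule.span_singleton_le_iff_mem]
    simpa using h 1 (by simp)

theorem IsFiniteLengthIdeal.relLen_ne_top {c : Ideal R} (hc : IsFiniteLengthIdeal lam B c)
    {P L : Submodule R B} (hL : L.FG) (h : ∀ r ∈ c, ∀ l ∈ L, r • l ∈ P) :
    relLen lam P L ≠ ∞ := by
  obtain ⟨t, rfl⟩ := hL
  have h1 : Submodule.span R (t : Set B) = ⨆ l ∈ t, Submodule.span R {l} := by
    rw [Submodule.span_eq_iSup_of_singleton_spans]; rfl
  rw [h1]
  refine ne_top_of_le_ne_top (ENNReal.sum_ne_top.2 fun l hl => ?_) (relLen_iSup_le lam t P _)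
  exact hc l P fun r hr => h r hr l (Submodule.subset_span hl)

/-- Filter R l by c l. The top quotient is killed by c, and c l, finitely generated by
Noetherianity, is carried into P by c'. -/
theorem IsFiniteLengthIdeal.mul [IsNoetherianRing R] {c c' : Ideal R}
    (hc : IsFiniteLengthIdeal lam B c)
    (hc' : IsFiniteLengthIdeal lam B c') : IsFiniteLengthIdeal lam B (c * c') := by
  intro l P h
  let Q : Submodule R B := Submodule.map (LinearMap.toSpanSingleton R B l) c
  have hQ : Q.FG := (IsNoetherian.noetherian c).map _
  refine relLen_trans_ne_top lam (V := Q) (hc'.relLen_ne_top hQ ?_) (hc l Q ?_)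
  · rintro r hr _ ⟨s, hs, rfl⟩
    rw [LinearMap.toSpanSingleton_apply, smul_smul, mul_comm]
    exact h _ (Ideal.mul_mem_mul hs hr)
  · intro r hr
    exact ⟨r, hr, rfl⟩

theorem IsFiniteLengthIdeal.pow [IsNoetherianRing R] {c : Ideal R}
    (hc : IsFiniteLengthIdeal lam B c) (n : ℕ) : IsFiniteLengthIdeal lam B (c ^ n) := by
  induction n with
  | zero => rw [pow_zero]; exact .one
  | succ n ih => rw [pow_succ]; exact ih.mul hc

/-- The annihilator of an element of a subquotient of finite length. -/
theorem isFiniteLengthIdeal_comap {P : Submodule R B} {f : B}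
    (h : relLen lam P (Submodule.span R {f}) ≠ ∞) :
    IsFiniteLengthIdeal lam B (P.comap (LinearMap.toSpanSingleton R B f)) := by
  intro l P' hl
  -- The cyclic module spanned by (f, l) projects onto both R f and R l. If r f lies in P then r l
  -- lies in P', so the length for l is at most that for f.
  have h1 := relLen_map lam (LinearMap.fst R B B) P (Submodule.span R {(f, l)})
  have h2 := relLen_map lam (LinearMap.snd R B B) P' (Submodule.span R {(f, l)})
  rw [Submodule.map_span, Set.image_singleton] at h1 h2
  change relLen lam P (Submodule.span R {f}) = _ at h1
  change relLen lam P' (Submodule.span R {l}) = _ at h2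
  rw [h2]
  rw [h1] at h
  refine ne_top_of_le_ne_top h ?_
  rw [← relLen_inf lam (P.comap _)]
  refine relLen_anti_left lam ?_
  rintro z ⟨hz, hz'⟩
  obtain ⟨r, rfl⟩ := Submodule.mem_span_singleton.1 hz'
  exact hl r hz

/-- A finitely generated subquotient of finite length is killed by a finite length ideal. -/
theorem exists_isFiniteLengthIdeal [IsNoetherianRing R] {P F : Submodule R B} (hF : F.FG)
    (h : relLen lam P F ≠ ∞) :
    ∃ c : Ideal R, IsFiniteLengthIdeal lam B c ∧ ∀ r ∈ c, ∀ f ∈ F, r • f ∈ P := by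
  classical
  obtain ⟨t, rfl⟩ := hF
  have key : ∀ u : Finset B, u ⊆ t → ∃ c : Ideal R, IsFiniteLengthIdeal lam B c ∧
      ∀ r ∈ c, ∀ f ∈ u, r • f ∈ P := by
    intro u
    induction u using Finset.induction_on with
    | empty => intro _; exact ⟨1, .one, by simp⟩
    | insert f u _ ih =>
      intro hu
      obtain ⟨c, hc, hc'⟩ := ih fun z hz => hu (Finset.mem_insert_of_mem hz)
      have h1 : relLen lam P (Submodule.span R {f}) ≠ ∞ :=
        ne_top_of_le_ne_top h (relLen_mono_right lam (Submodule.span_mono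
          (by simpa using hu (Finset.mem_insert_self f u))))
      refine ⟨_, (isFiniteLengthIdeal_comap h1).mul hc, fun r hr g hg => ?_⟩
      rcases Finset.mem_insert.1 hg with rfl | hg
      · have h2 : r ∈ P.comap (LinearMap.toSpanSingleton R B g) := Ideal.mul_le_left hr
        exact h2
      · have h2 : r ∈ c := Ideal.mul_le_right hr
        exact hc' r h2 g hg
  obtain ⟨c, hc, hc'⟩ := key t le_rfl
  refine ⟨c, hc, fun r hr f hf => ?_⟩
  have : Submodule.span R (t : Set B) ≤ P.comap (LinearMap.lsmul R B r) :=
    Submodule.span_le.2 fun f hf => hc' r hr f hf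
  exact this hf

end FiniteLengthIdeal

/-! ### Extending inert submodules -/

section ExtensionFamily

variable {R S B : Type*} [CommRing R] [CommRing S] [Algebra R S]
  [AddCommGroup B] [Module R B] [Module S B] [IsScalarTower R S B] {E : Submodule R S}
  {G : Submodule R B} {I : ℕ → Submodule R S} {d : ℕ}

theorem smul_extensionFamily_le (N n : ℕ) :
    E • extensionFamily E G I d N n ≤ extensionFamily E G I d N (n + 1) := by
  rw [extensionFamily, extensionFamily, Submodule.smul_sup, Submodule.smul_iSup,
    ← Submodule.pow_succ_smul]
  refine sup_le_sup (le_of_eq (by congr 2; omega)) (iSup_le fun p => ?_)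
  rw [Submodule.smul_iSup]
  refine iSup_le fun hp => ?_
  rw [Submodule.smul_comm_eq, ← Submodule.pow_succ_smul]
  exact le_iSup₂_of_le (p.1, p.2 + 1) ⟨hp.1, by dsimp only; omega⟩ le_rfl

/-- Multiplication by E^(N+1) raises the index by N only. Expand (E I_p)^(N+1) ≤ (I_(p+1) +
E^d)^(N+1): the pure power of I_(p+1) lies in the family at m + N, and any other product has a
factor E^d and N factors of degree at most p + 1, so it is absorbed by the power of E acting on G.
This is the hypothesis of `exists_saturation_generated`. -/
theorem pow_smul_extensionFamily_le (hE1 : 1 ≤ E) (hI : ∀ n ≥ d, E * I n ≤ I (n + 1) ⊔ E ^ d)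
    (hIE : ∀ n, I n ≤ E ^ n) (N m : ℕ) :
    E ^ (N + 1) • extensionFamily E G I d (N + 1) m ≤
      E ^ (m + N + 1) • E ^ d • G ⊔ extensionFamily E G I d (N + 1) (m + N) := by
  conv_lhs => rw [extensionFamily, Submodule.smul_sup, Submodule.smul_iSup]
  refine sup_le (le_sup_of_le_left ?_) (le_sup_of_le_right (iSup_le fun p => ?_))
  · rw [← Submodule.pow_add_smul, ← Submodule.pow_add_smul]
    exact le_of_eq (by congr 2; omega)
  rw [Submodule.smul_iSup]
  refine iSup_le fun hp => ?_
  rw [← Submodule.mul_smul_eq, ← mul_pow]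
  have h1 : (E * I p.1) ^ (N + 1) ≤ I (p.1 + 1) ^ (N + 1) ⊔ E ^ d * (E ^ (p.1 + 1)) ^ N := by
    refine (pow_le_pow_left' (hI p.1 hp.1) (N + 1)).trans ?_
    have hd : E ^ d ≤ E ^ (p.1 + 1) := pow_le_pow_right₀ hE1 (by omega)
    have hIs : I (p.1 + 1) ⊔ E ^ d ≤ E ^ (p.1 + 1) := sup_le (hIE _) hd
    have : ∀ N : ℕ, (I (p.1 + 1) ⊔ E ^ d) ^ (N + 1) ≤
        I (p.1 + 1) ^ (N + 1) ⊔ E ^ d * (E ^ (p.1 + 1)) ^ N := by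
      intro N
      induction N with
      | zero => simp
      | succ N ih =>
        rw [pow_succ']
        refine (mul_le_mul' le_rfl ih).trans ?_
        rw [Submodule.mul_sup, Submodule.sup_mul, ← pow_succ']
        refine sup_le (sup_le le_sup_left (le_sup_of_le_right ?_)) (le_sup_of_le_right ?_)
        · exact mul_le_mul' le_rfl (pow_le_pow_left' (hIE _) _)
        · rw [mul_left_comm, pow_succ' (E ^ (p.1 + 1)) N]
          exact mul_le_mul' le_rfl (mul_le_mul' hIs le_rfl)
    exact this N
  refine (Submodule.smul_mono_left h1).trans ?_
  rw [Submodule.sup_smul]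
  have h2 := hp.2
  rw [Nat.add_sub_cancel] at h2
  refine sup_le (le_sup_of_le_right ?_) (le_sup_of_le_left ?_)
  · refine le_iSup₂_of_le (p.1 + 1, p.2) ⟨by dsimp only; omega, ?_⟩ le_rfl
    dsimp only
    rw [Nat.add_sub_cancel, mul_add]; omega
  · rw [← pow_mul, ← pow_add, ← Submodule.pow_add_smul]
    refine Submodule.pow_smul_mono hE1 ?_ le_rfl
    rw [add_mul, one_mul, mul_comm p.1]; omega

theorem exists_mem_of_mem_extensionFamily (hE1 : 1 ≤ E) (hIE : ∀ n, I n ≤ E ^ n) {N M : ℕ} {b : B}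
    (hb : b ∈ extensionFamily E G I d N M) : ∃ n : ℕ, b ∈ E ^ n • G := by
  have hdir : Directed (· ≤ ·) fun n => E ^ n • G := by
    intro m n
    exact ⟨max m n, Submodule.pow_smul_mono hE1 (le_max_left _ _) le_rfl,
      Submodule.pow_smul_mono hE1 (le_max_right _ _) le_rfl⟩
  rw [← Submodule.mem_iSup_of_directed _ hdir]
  refine (sup_le (le_iSup (fun n => E ^ n • G) _) (iSup₂_le fun p _ => ?_) :
    extensionFamily E G I d N M ≤ _) hb
  refine (Submodule.smul_mono_left (pow_le_pow_left' (hIE p.1) N)).trans ?_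
  rw [← pow_mul, ← Submodule.pow_add_smul]
  exact le_iSup (fun n => E ^ n • G) _

theorem Submodule.smul_mem_pow_of_mem_pow {q : Ideal R} {P Q : Submodule R S}
    (h : ∀ r ∈ q, ∀ s ∈ P, r • s ∈ Q) (N : ℕ) : ∀ r ∈ q ^ N, ∀ s ∈ P ^ N, r • s ∈ Q ^ N := by
  induction N with
  | zero =>
    intro r _ s hs
    rw [pow_zero] at hs ⊢
    exact Submodule.smul_mem _ r hs
  | succ N ih =>
    intro r hr s hs
    rw [pow_succ] at hr hs ⊢
    induction hr using Submodule.mul_induction_on' with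
    | mem_mul_mem a ha b hb =>
      induction hs using Submodule.mul_induction_on' with
      | mem_mul_mem s hs t ht =>
        rw [← smul_mul_smul_comm]
        exact Submodule.mul_mem_mul (ih a ha s hs) (h b hb t ht)
      | add s _ t _ hs ht => rw [smul_add]; exact add_mem hs ht
    | add a _ b _ ha hb => rw [add_smul]; exact add_mem ha hb

end ExtensionFamily

section Extension

variable {R : Type u} {S : Type*} {B : Type v} [CommRing R] [IsNoetherianRing R] [CommRing S]
  [Algebra R S] [AddCommGroup B] [Module R B] [Module S B] [IsScalarTower R S B]
  {lam : LengthFunction.{u, v} R} {k : ℕ} {x : Fin k → S}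

/-- All growth of V thus comes from the finitely generated module F. -/
theorem pow_succ_smul_eq_sup {V F : Submodule R B} (h : linForms R x • V = V ⊔ F) (n : ℕ) :
    linForms R x ^ (n + 1) • V = V ⊔ linForms R x ^ n • F := by
  induction n with
  | zero => rw [pow_zero, Submodule.one_smul, zero_add, pow_one, h]
  | succ n ih =>
    rw [Submodule.pow_succ_smul, ih, Submodule.smul_sup, h, ← Submodule.pow_succ_smul, sup_assoc]
    congr 1
    refine sup_eq_right.2 ?_
    exact le_linForms_pow_smul (n + 1) F

theorem pow_smul_mem_of_mem_pow {c : Ideal R} {V F : Submodule R B}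
    (h : linForms R x • V = V ⊔ F) (hc : ∀ r ∈ c, ∀ f ∈ F, r • f ∈ V) (n : ℕ) :
    ∀ r ∈ c ^ n, ∀ v ∈ linForms R x ^ n • V, r • v ∈ V := by
  induction n with
  | zero =>
    intro r _ v hv
    rw [pow_zero, Submodule.one_smul] at hv
    exact V.smul_mem r hv
  | succ n ih =>
    intro r hr v hv
    rw [pow_succ] at hr
    induction hr using Submodule.mul_induction_on' with
    | mem_mul_mem a ha b hb =>
      rw [mul_smul]
      refine ih a ha _ ?_
      rw [Submodule.pow_add_smul, pow_one, h] at hv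
      induction hv using Submodule.smul_induction_on' with
      | smul s hs w hw =>
        rw [smul_comm]
        refine Submodule.smul_mem_smul hs ?_
        obtain ⟨w1, hw1, w2, hw2, rfl⟩ := Submodule.mem_sup.1 hw
        rw [smul_add]
        exact add_mem (V.smul_mem b hw1) (hc b hb w2 hw2)
      | add s _ t _ hs ht => rw [smul_add]; exact add_mem hs ht
    | add a _ b _ ha hb => rw [add_smul]; exact add_mem ha hb

/-- Inert submodules of a submodule can be extended to inert submodules of the whole module,
without changing the growth of the intersection. -/
theorem IsInert.exists_extension (hS : ∀ s : S, ∃ n : ℕ, s ∈ linForms R x ^ n)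
    {V F G : Submodule R B} (hV : IsInert lam x V) (hF : F.FG) (hEV : linForms R x • V = V ⊔ F)
    (hG : G.FG) :
    ∃ W : Submodule R B, IsInert lam x W ∧ G ≤ W ∧ (∀ w ∈ W, ∃ n : ℕ, w ∈ linForms R x ^ n • G) ∧
      ∀ n, ∃ b, ∀ a ∈ linForms R x ^ n • W, (∃ c, a ∈ linForms R x ^ c • V) →
        a ∈ linForms R x ^ b • V := by
  have hE1 : 1 ≤ linForms R x := one_le_linForms R x
  have hEfg : (linForms R x).FG := linForms_fg R x
  set E := linForms R x with hE
  have hTE : ∀ n, E • E ^ n • V ≤ E ^ (n + 1) • V := fun n => pow_smul_stable x V n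
  have hTmono : ∀ n, E ^ n • V ≤ E ^ (n + 1) • V := fun n => pow_smul_le_pow_smul n.le_succ V
  have hTF : ∀ n, E ^ (n + 1) • V ≤ E ^ n • V ⊔ E ^ n • F := fun n => by
    rw [hE, pow_succ_smul_eq_sup hEV n]
    exact sup_le_sup_right (le_linForms_pow_smul n V) _
  obtain ⟨d, hd⟩ := exists_mul_colon_le hE1 hS hV.2 hF
  -- As E^(p+1) V = V + E^p F, elements of I n with n ≤ p preserve E^p V. For n ≥ d the family I is
  -- stable under E up to E^d.
  let I : ℕ → Submodule R S := fun n => colonSubmodule S V F ⊓ E ^ n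
  have hIE : ∀ n, I n ≤ E ^ n := fun n => inf_le_right
  have hI : ∀ n ≥ d, E * I n ≤ I (n + 1) ⊔ E ^ d := by
    intro n hn
    have h1 : E ^ d ≤ E ^ (n + 1) := pow_le_pow_right₀ hE1 (by omega)
    have h2 : I (n + 1) ⊔ E ^ d = (colonSubmodule S V F ⊔ E ^ d) ⊓ E ^ (n + 1) := by
      rw [sup_comm, sup_comm (colonSubmodule S V F), sup_inf_assoc_of_le _ h1]
    rw [h2]
    refine le_inf ((mul_le_mul' le_rfl inf_le_left).trans hd) ?_
    rw [pow_succ']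
    exact mul_le_mul' le_rfl inf_le_right
  have hIT : ∀ n p, n ≤ p → I n • E ^ p • V ≤ E ^ p • V := by
    intro n p hnp
    have hIV : I n • V ≤ E ^ p • V := Submodule.smul_mono_left
      ((hIE n).trans (pow_le_pow_right₀ hE1 hnp))
    rcases p with _ | p
    · rw [pow_zero, Submodule.one_smul] at hIV ⊢
      exact hIV
    · conv_lhs => rw [hE, pow_succ_smul_eq_sup hEV p, Submodule.smul_sup, Submodule.smul_comm_eq]
      refine sup_le hIV ?_
      have h3 : I n • F ≤ V := by
        rw [Submodule.smul_le]
        exact fun s hs f hf => hs.1 f hf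
      exact (Submodule.smul_mono le_rfl h3).trans (hTmono p)
  have hEfg' := hEfg
  obtain ⟨t, ht⟩ := hEfg'
  have hchart : ∀ y : t, _ := fun y => exists_chart_bound_of_localization hEfg hE1
    (y := (y : S)) (ht ▸ Submodule.subset_span y.2) (fun n => E ^ n • V) hTmono hTE hF hG hTF d I
    hIE hI hIT
  choose N0 hN0 using hchart
  -- One exponent N + 1 that works on all of the finitely many charts.
  obtain ⟨N, hN⟩ : ∃ N, ∀ y, N0 y ≤ N + 1 :=
    ⟨Finset.univ.sup N0, fun y => (Finset.le_sup (Finset.mem_univ y)).trans (Nat.le_succ _)⟩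
  have hchart' := fun y => hN0 y (N + 1) (hN y)
  choose β hβ using hchart'
  obtain ⟨b0, hb0⟩ : ∃ b0, ∀ y, β y ≤ b0 :=
    ⟨Finset.univ.sup β, fun y => Finset.le_sup (Finset.mem_univ y)⟩
  have hX := smul_extensionFamily_le (E := E) (G := G) (I := I) (d := d) (N + 1)
  have hGX : ∀ n, E ^ n • E ^ d • G ≤ extensionFamily E G I d (N + 1) n := fun n => by
    rw [← Submodule.pow_add_smul]; exact le_sup_left
  have hG' : (E ^ d • G).FG := Submodule.smul_fg (hEfg.pow d) hG
  obtain ⟨n1, hn1⟩ := exists_saturation_generated x hX hG' hGX N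
    (pow_smul_extensionFamily_le hE1 hI hIE N)
  let W := saturation E (extensionFamily E G I d (N + 1)) hX
  have hXW : ∀ n, extensionFamily E G I d (N + 1) n ≤ W n := le_saturation hX
  have hEW : ∀ n ≥ n1, E • W n = W (n + 1) := by
    intro n hn
    refine le_antisymm (smul_saturation_le hX n) ((hn1 n hn).trans (sup_le ?_ ?_))
    · exact Submodule.le_smul_of_one_le hE1 _
    · rw [Submodule.pow_succ_smul]
      exact Submodule.smul_mono le_rfl ((hGX n).trans (hXW n))
  -- From n1 on the saturated family is E^n applied to a single member. The second bound lets
  -- E^(m1+1+d) be split as (E^(d+1))^(N+1) E^p in the finite length argument.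
  set m1 := max n1 ((d + 1) * (N + 1)) with hm1
  have hEW' : ∀ n, E ^ n • W m1 = W (m1 + n) := by
    intro n
    induction n with
    | zero => rw [pow_zero, Submodule.one_smul, add_zero]
    | succ n ih =>
      rw [Submodule.pow_succ_smul, ih, hEW _ (by omega)]; rfl
  have hEWle : E • W m1 ≤ W m1 ⊔ E ^ (m1 + 1) • E ^ d • G := by
    rw [hEW m1 (le_max_left _ _)]
    exact hn1 m1 (le_max_left _ _)
  have hLfg : (E ^ (m1 + 1) • E ^ d • G).FG := Submodule.smul_fg (hEfg.pow _) hG'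
  have hlen : relLen lam (W m1) (E ^ (m1 + 1) • E ^ d • G) ≠ ∞ := by
    have hF' : relLen lam V F ≠ ∞ := by
      have := hV.1
      rwa [← hE, hEV, relLen_sup_left] at this
    -- The ideal c carries F into V, so c^(d+2) carries E^(d+2) V into V and E^(d+1) into I (d+1).
    -- Its (N+1)-st power therefore carries E^(m1+1+d) G into the extension family at m1; the
    -- inequality defining the family is an equality here.
    obtain ⟨c, hc, hcF⟩ := exists_isFiniteLengthIdeal hF hF'
    have h1 : ∀ r ∈ c ^ (d + 2), ∀ s ∈ E ^ (d + 1), r • s ∈ I (d + 1) := by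
      intro r hr s hs
      refine ⟨fun f hf => ?_, Submodule.smul_mem _ r hs⟩
      rw [smul_assoc]
      refine pow_smul_mem_of_mem_pow hEV hcF (d + 2) r hr _ ?_
      rw [pow_succ_smul_eq_sup hEV]
      exact Submodule.mem_sup_right (Submodule.smul_mem_smul hs hf)
    have h2 := Submodule.smul_mem_pow_of_mem_pow h1 (N + 1)
    refine ne_top_of_le_ne_top ?_ (relLen_anti_left lam (hXW m1))
    refine ((hc.pow (d + 2)).pow (N + 1)).relLen_ne_top hLfg fun r hr l hl => ?_
    obtain ⟨p, hp⟩ : ∃ p, m1 + 1 + d = (d + 1) * (N + 1) + p :=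
      ⟨m1 + 1 + d - (d + 1) * (N + 1), by omega⟩
    rw [← Submodule.pow_add_smul, hp, Submodule.pow_add_smul, pow_mul] at hl
    have h3 : I (d + 1) ^ (N + 1) • E ^ p • G ≤ extensionFamily E G I d (N + 1) m1 := by
      refine le_sup_of_le_right (le_iSup₂_of_le (d + 1, p) ⟨by dsimp only; omega, ?_⟩ le_rfl)
      dsimp only
      rw [Nat.add_sub_cancel, mul_comm]
      rw [mul_add, mul_one] at hp
      omega
    refine h3 ?_
    induction hl using Submodule.smul_induction_on' with
    | smul s hs w hw =>
      have h4 : r • s • w = (r • s) • w := (smul_assoc r s w).symm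
      rw [h4]
      exact Submodule.smul_mem_smul (h2 r hr s hs) hw
    | add s _ t _ hs ht => rw [smul_add]; exact add_mem hs ht
  refine ⟨W m1, ⟨?_, ?_⟩, ?_, ?_, ?_⟩
  · refine ne_top_of_le_ne_top hlen ((relLen_mono_right lam hEWle).trans ?_)
    rw [relLen_sup_left]
  · exact .of_le_sup hLfg hEWle
  · refine le_trans ?_ ((hGX m1).trans (hXW m1))
    rw [← Submodule.pow_add_smul]
    exact le_linForms_pow_smul _ G
  · rintro w ⟨j, hj⟩
    refine exists_mem_of_mem_extensionFamily hE1 hIE (hj ?_)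
    have := Submodule.smul_mem_smul (Submodule.one_le.1 (one_le_pow₀ hE1 : 1 ≤ E ^ j))
      (Submodule.mem_span_singleton_self (R := R) w)
    rwa [one_smul] at this
  -- On each chart the element lies in E^b V with bounded b, so it lies in the saturation of the
  -- filtration of V. Above degree n2 saturation adds nothing, and one descends step by step from c.
  · intro n
    obtain ⟨n2, hn2⟩ := exists_saturation_inf_le x hV.2
    refine ⟨max n2 (m1 + n + b0), fun a ha => ?_⟩
    rintro ⟨c, hc⟩
    have haW : a ∈ W (m1 + n) := by rw [← hEW' n]; exact ha
    obtain ⟨j, hj⟩ := haW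
    have hsat : a ∈ saturation E (fun n => E ^ n • V) hTE (m1 + n + b0) := by
      refine mem_saturation_of_pow_smul_mem hTE t ht fun y hy => ?_
      obtain ⟨i, hi⟩ := hβ ⟨y, hy⟩ (m1 + n) a ⟨c, hc⟩ ⟨j, hj (Submodule.smul_mem_smul
        (Submodule.pow_mem_pow _ (ht ▸ Submodule.subset_span hy) j)
        (Submodule.mem_span_singleton_self a))⟩
      refine ⟨i, pow_smul_le_pow_smul ?_ V hi⟩
      have := hb0 ⟨y, hy⟩
      omega
    have hsatmono : ∀ q, m1 + n + b0 ≤ q → a ∈ saturation E (fun n => E ^ n • V) hTE q := by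
      intro q hq
      obtain ⟨i, hi⟩ := hsat
      exact ⟨i, hi.trans (pow_smul_le_pow_smul (by omega) V)⟩
    have hdesc : ∀ c, a ∈ E ^ (max n2 (m1 + n + b0) + c) • V →
        a ∈ E ^ (max n2 (m1 + n + b0)) • V := by
      intro c
      induction c with
      | zero => exact id
      | succ c ih =>
        intro h
        exact ih (hn2 _ (by omega) ⟨h, hsatmono _ (by omega)⟩)
    exact hdesc c (pow_smul_le_pow_smul (by omega) V hc)

end Extension

/-! ### Order and suprema of monomials -/

namespace LeadTerm

/-- The order of monomials: by degree, then by coefficient. -/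
def Le (a b : LeadTerm) : Prop := a.deg < b.deg ∨ a.deg = b.deg ∧ a.coeff ≤ b.coeff

theorem Le.refl (a : LeadTerm) : Le a a := .inr ⟨rfl, le_rfl⟩

theorem Le.trans {a b c : LeadTerm} (h : Le a b) (h' : Le b c) : Le a c := by
  rcases h with h | ⟨h, e⟩ <;> rcases h' with h' | ⟨h', e'⟩
  · exact .inl (h.trans h')
  · exact .inl (h'.symm ▸ h)
  · exact .inl (h ▸ h')
  · exact .inr ⟨h.trans h', e.trans e'⟩

theorem Le.antisymm {a b : LeadTerm} (h : Le a b) (h' : Le b a) : a = b := by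
  rcases h with h | ⟨h, e⟩ <;> rcases h' with h' | ⟨h', e'⟩
  · omega
  · omega
  · omega
  · exact LeadTerm.ext h (le_antisymm e e')

theorem zero_le (a : LeadTerm) : Le zero a := by
  rcases Nat.eq_zero_or_pos a.deg with h | h
  · exact .inr ⟨h.symm, bot_le⟩
  · exact .inl h

theorem le_sup {I : Set LeadTerm} (hI : BddAbove (deg '' I)) {m : LeadTerm} (hm : m ∈ I) :
    Le m (sup I) := by
  have h1 : m.deg ≤ sSup (deg '' I) := le_csSup hI ⟨m, hm, rfl⟩
  rcases h1.lt_or_eq with h | h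
  · exact .inl h
  · exact .inr ⟨h, le_sSup ⟨m, hm, h, rfl⟩⟩

theorem exists_deg_eq_sup {I : Set LeadTerm} (hne : I.Nonempty) (hI : BddAbove (deg '' I)) :
    ∃ m ∈ I, m.deg = (sup I).deg := by
  obtain ⟨m, hm, h⟩ := Nat.sSup_mem (hne.image deg) hI
  exact ⟨m, hm, h⟩

theorem sup_le {I : Set LeadTerm} (hne : I.Nonempty) (hI : BddAbove (deg '' I)) {u : LeadTerm}
    (h : ∀ m ∈ I, Le m u) : Le (sup I) u := by
  obtain ⟨m0, hm0, e⟩ := exists_deg_eq_sup hne hI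
  rcases h m0 hm0 with h1 | ⟨h1, -⟩
  · exact .inl (e ▸ h1)
  · refine .inr ⟨e ▸ h1, sSup_le ?_⟩
    rintro _ ⟨m, hm, hd, rfl⟩
    rcases h m hm with h2 | ⟨-, h2⟩
    · have : m.deg = (sup I).deg := hd
      omega
    · exact h2

theorem oplus_comm (a b : LeadTerm) : oplus a b = oplus b a := by
  unfold oplus
  rcases lt_trichotomy a.deg b.deg with h | h | h
  · simp [h, h.not_gt]
  · simp [h, add_comm]
  · simp [h, h.not_gt]

theorem le_oplus_left (a b : LeadTerm) : Le a (oplus a b) := by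
  unfold oplus
  split_ifs with h h'
  · exact .refl a
  · exact .inl h'
  · exact .inr ⟨rfl, le_self_add⟩

theorem le_oplus_right (a b : LeadTerm) : Le b (oplus a b) := by
  rw [oplus_comm]; exact le_oplus_left b a

theorem oplus_mono {a a' b b' : LeadTerm} (h : Le a a') (h' : Le b b') :
    Le (oplus a b) (oplus a' b') := by
  rcases lt_trichotomy a.deg b.deg with hd | hd | hd
  · have : oplus a b = b := by simp [oplus, hd, hd.not_gt]
    rw [this]; exact h'.trans (le_oplus_right a' b')
  · have e : oplus a b = ⟨a.deg, a.coeff + b.coeff⟩ := by simp [oplus, hd]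
    rw [e]
    rcases h with h | ⟨h, hc⟩
    · exact Le.trans (b := a') (.inl h) (le_oplus_left a' b')
    rcases h' with h' | ⟨h', hc'⟩
    · exact Le.trans (b := b') (.inl (hd ▸ h' : a.deg < b'.deg)) (le_oplus_right a' b')
    have e' : oplus a' b' = ⟨a'.deg, a'.coeff + b'.coeff⟩ := by
      simp [oplus, ← h, ← h', hd]
    rw [e']
    exact .inr ⟨h, add_le_add hc hc'⟩
  · have : oplus a b = a := by simp [oplus, hd]
    rw [this]; exact h.trans (le_oplus_left a' b')

/-- The delicate case is that of equal degrees. Both maximal degrees are attained, so each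
coefficient is a supremum over a nonempty set, and a sum of two such suprema is bounded through
pairs of members. -/
theorem oplus_sup_le {I J : Set LeadTerm} (hI : I.Nonempty) (hJ : J.Nonempty)
    (hbI : BddAbove (deg '' I)) (hbJ : BddAbove (deg '' J)) {u : LeadTerm}
    (h : ∀ a ∈ I, ∀ b ∈ J, Le (oplus a b) u) : Le (oplus (sup I) (sup J)) u := by
  have hIu : Le (sup I) u := sup_le hI hbI fun a ha => by
    obtain ⟨b, hb⟩ := hJ
    exact (le_oplus_left a b).trans (h a ha b hb)
  have hJu : Le (sup J) u := sup_le hJ hbJ fun b hb => by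
    obtain ⟨a, ha⟩ := hI
    exact (le_oplus_right a b).trans (h a ha b hb)
  rcases lt_trichotomy (sup I).deg (sup J).deg with hd | hd | hd
  · have : oplus (sup I) (sup J) = sup J := by simp [oplus, hd, hd.not_gt]
    rw [this]; exact hJu
  · have e : oplus (sup I) (sup J) = ⟨(sup I).deg, (sup I).coeff + (sup J).coeff⟩ := by
      simp [oplus, hd]
    rw [e]
    rcases hIu with h1 | ⟨h1, -⟩
    · exact .inl h1
    refine .inr ⟨h1, ?_⟩
    obtain ⟨a0, ha0, hda0⟩ := exists_deg_eq_sup hI hbI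
    obtain ⟨b0, hb0, hdb0⟩ := exists_deg_eq_sup hJ hbJ
    have hIc : (sup I).coeff = sSup {r | ∃ m ∈ I, m.deg = (sup I).deg ∧ m.coeff = r} := rfl
    have hJc : (sup J).coeff = sSup {r | ∃ m ∈ J, m.deg = (sup J).deg ∧ m.coeff = r} := rfl
    dsimp only
    rw [hIc, hJc, sSup_eq_iSup, sSup_eq_iSup]
    refine ENNReal.biSup_add_biSup_le' ⟨_, a0, ha0, hda0, rfl⟩ ⟨_, b0, hb0, hdb0, rfl⟩ ?_
    rintro _ ⟨a, ha, hda, rfl⟩ _ ⟨b, hb, hdb, rfl⟩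
    have hab := h a ha b hb
    have e' : oplus a b = ⟨a.deg, a.coeff + b.coeff⟩ := by
      have : a.deg = b.deg := by rw [hda, hdb, hd]
      simp [oplus, this]
    rw [e'] at hab
    rcases hab with h2 | ⟨-, h2⟩
    · dsimp only at h2; omega
    · exact h2
  · have : oplus (sup I) (sup J) = sup I := by simp [oplus, hd]
    rw [this]; exact hIu

/-- Nonnegative leading coefficients cannot cancel. -/
theorem ofPoly_add {p q : ℝ[X]} (hp : 0 ≤ p.leadingCoeff) (hq : 0 ≤ q.leadingCoeff) :
    ofPoly (p + q) = oplus (ofPoly p) (ofPoly q) := by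
  have key : ∀ {p q : ℝ[X]}, p.natDegree < q.natDegree → ofPoly (p + q) = ofPoly q := by
    intro p q h
    have h' := Polynomial.degree_lt_degree h
    rw [ofPoly, ofPoly, Polynomial.natDegree_add_eq_right_of_natDegree_lt h,
      Polynomial.leadingCoeff_add_of_degree_lt h']
  rcases lt_trichotomy p.natDegree q.natDegree with h | h | h
  · rw [key h]
    have h2 : (ofPoly p).deg < (ofPoly q).deg := h
    simp [oplus, h2, h2.not_gt]
  · have e : oplus (ofPoly p) (ofPoly q) = ⟨(ofPoly p).deg, (ofPoly p).coeff + (ofPoly q).coeff⟩ := by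
      have h2 : (ofPoly p).deg = (ofPoly q).deg := h
      simp [oplus, h2]
    rw [e]
    by_cases h0 : p.leadingCoeff + q.leadingCoeff = 0
    · have hp0 : p = 0 := by
        rw [← Polynomial.leadingCoeff_eq_zero]; linarith
      have hq0 : q = 0 := by
        rw [← Polynomial.leadingCoeff_eq_zero]; linarith
      simp [hp0, hq0, ofPoly]
    · have hc : (p + q).coeff p.natDegree = p.leadingCoeff + q.leadingCoeff := by
        rw [Polynomial.coeff_add, Polynomial.coeff_natDegree, h, Polynomial.coeff_natDegree]
      have hd : (p + q).natDegree = p.natDegree := by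
        refine le_antisymm ?_ (Polynomial.le_natDegree_of_ne_zero (by rw [hc]; exact h0))
        exact (Polynomial.natDegree_add_le _ _).trans (by rw [h, max_self])
      have hl : (p + q).leadingCoeff = p.leadingCoeff + q.leadingCoeff := by
        rw [← hc, ← hd]; rfl
      simp only [ofPoly, hd, hl, ENNReal.ofReal_add hp hq]
  · rw [add_comm, key h]
    have h2 : (ofPoly q).deg < (ofPoly p).deg := h
    simp [oplus, h2]

theorem ofPoly_le {p q : ℝ[X]} (hp : 0 ≤ p.leadingCoeff) (h : 0 ≤ (q - p).leadingCoeff) :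
    Le (ofPoly p) (ofPoly q) := by
  rcases lt_trichotomy p.natDegree q.natDegree with hd | hd | hd
  · exact .inl hd
  · refine .inr ⟨hd, ENNReal.ofReal_le_ofReal ?_⟩
    by_contra hlt
    push Not at hlt
    have hc : (q - p).coeff q.natDegree = q.leadingCoeff - p.leadingCoeff := by
      rw [Polynomial.coeff_sub, Polynomial.coeff_natDegree, ← hd, Polynomial.coeff_natDegree]
    have hd' : (q - p).natDegree = q.natDegree := by
      refine le_antisymm ?_ (Polynomial.le_natDegree_of_ne_zero (by rw [hc]; linarith))
      exact (Polynomial.natDegree_sub_le _ _).trans (by rw [hd, max_self])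
    rw [Polynomial.leadingCoeff, hd', hc] at h
    linarith
  · exfalso
    have hl : (q - p).leadingCoeff = - p.leadingCoeff := by
      rw [← neg_sub, Polynomial.leadingCoeff_neg,
        Polynomial.leadingCoeff_sub_of_degree_lt (Polynomial.degree_lt_degree hd)]
    have : p = 0 := by
      rw [← Polynomial.leadingCoeff_eq_zero]; linarith
    simp [this] at hd

theorem ofPoly_comp (q : ℝ[X]) (c : ℕ) :
    ofPoly (q.comp (Polynomial.X + (c : ℝ[X]))) = ofPoly q := by
  have h1 : (Polynomial.X + (c : ℝ[X])).natDegree = 1 := by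
    rw [← Polynomial.C_eq_natCast, Polynomial.natDegree_X_add_C]
  have h2 : (Polynomial.X + (c : ℝ[X])).leadingCoeff = 1 := by
    rw [← Polynomial.C_eq_natCast, Polynomial.leadingCoeff_X_add_C]
  rw [ofPoly, ofPoly, Polynomial.natDegree_comp, h1, mul_one,
    Polynomial.leadingCoeff_comp (by rw [h1]; exact one_ne_zero), h2, one_pow, mul_one]

end LeadTerm

/-! ### Comparing growth of total lengths -/

section Growth

theorem IsEventuallyPoly.comp_add {a : ℕ → ℝ≥0∞} {q : ℝ[X]} (h : IsEventuallyPoly a q) (c : ℕ) :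
    IsEventuallyPoly (fun n => a (n + c)) (q.comp (Polynomial.X + (c : ℝ[X]))) := by
  have := (tendsto_add_atTop_nat c).eventually h
  filter_upwards [this] with n hn
  simpa using hn

theorem IsEventuallyPoly.add {a b : ℕ → ℝ≥0∞} {p q : ℝ[X]} (h : IsEventuallyPoly a p)
    (h' : IsEventuallyPoly b q) : IsEventuallyPoly (fun n => a n + b n) (p + q) := by
  filter_upwards [h, h'] with n hn hn'
  rw [Polynomial.eval_add, ENNReal.ofReal_add hn.1 hn'.1, hn.2, hn'.2]
  exact ⟨add_nonneg hn.1 hn'.1, rfl⟩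

theorem forwardDiff_comp_add (q : ℝ[X]) (c : ℕ) :
    forwardDiff (q.comp (Polynomial.X + (c : ℝ[X]))) =
      (forwardDiff q).comp (Polynomial.X + (c : ℝ[X])) := by
  simp only [forwardDiff, Polynomial.sub_comp, Polynomial.comp_assoc, Polynomial.add_comp,
    Polynomial.X_comp, Polynomial.one_comp, Polynomial.natCast_comp]
  rw [add_right_comm]

/-- Comparison of leading terms from a comparison of the growth of the sums. -/
theorem LeadTerm.ofPoly_le_of_growth {a b : ℕ → ℝ≥0∞} {P Q : ℝ[X]} (ha : IsEventuallyPoly a P)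
    (hb : IsEventuallyPoly b Q) (hP : 0 ≤ (forwardDiff P).leadingCoeff) {c : ℕ} {C : ℝ≥0∞}
    (hC : C ≠ ∞) (h : ∀ᶠ n in atTop, a n ≤ b (n + c) + C) :
    Le (ofPoly (forwardDiff P)) (ofPoly (forwardDiff Q)) := by
  rw [← ofPoly_comp (forwardDiff Q) c, ← forwardDiff_comp_add]
  refine ofPoly_le hP ?_
  -- A bounded error C disappears under the difference operator.
  have e : forwardDiff (Q.comp (Polynomial.X + (c : ℝ[X]))) - forwardDiff P =
      forwardDiff (Q.comp (Polynomial.X + (c : ℝ[X])) + Polynomial.C C.toReal - P) := by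
    simp only [forwardDiff, Polynomial.sub_comp, Polynomial.add_comp, Polynomial.C_comp]
    ring
  rw [e]
  refine leadingCoeff_forwardDiff_nonneg (leadingCoeff_nonneg_of_eventually ?_)
  filter_upwards [ha, hb.comp_add c, h] with n h1 h2 h3
  rw [h1.2, h2.2, ← ENNReal.ofReal_toReal hC, ← ENNReal.ofReal_add h2.1 ENNReal.toReal_nonneg,
    ENNReal.ofReal_le_ofReal_iff (add_nonneg h2.1 ENNReal.toReal_nonneg)] at h3
  rw [Polynomial.eval_sub, Polynomial.eval_add, Polynomial.eval_C]
  linarith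

end Growth

/-! ### Intersections of filtrations -/

section Inter

variable {R S B C : Type*} [CommRing R] [IsNoetherianRing R] [CommRing S]
  [Algebra R S] [AddCommGroup B] [Module R B] [Module S B] [IsScalarTower R S B]
  [AddCommGroup C] [Module R C] [Module S C] [IsScalarTower R S C]
  {k : ℕ} {x : Fin k → S}

theorem Submodule.smul_restrictScalars_le (I : Submodule R S) (D : Submodule S B) :
    I • D.restrictScalars R ≤ D.restrictScalars R := by
  rw [Submodule.smul_le]
  exact fun r _ n hn => D.smul_mem r hn

/-- Intersecting the family `E ^ n V` with a submodule over the big ring. -/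
theorem exists_inf_restrictScalars_generated {V : Submodule R B} (hV : RelFG V (linForms R x • V))
    (D : Submodule S B) :
    ∃ n0, ∀ n ≥ n0, linForms R x ^ (n + 1) • V ⊓ D.restrictScalars R =
      linForms R x • (linForms R x ^ n • V ⊓ D.restrictScalars R) := by
  obtain ⟨n1, h⟩ := exists_graded_generation x (fun n => linForms R x ^ n • V)
    -- The middle family is the part of degree n of the graded module that is represented by
    -- elements of D.
    (fun n => linForms R x ^ n • V ⊔ (linForms R x ^ (n + 1) • V ⊓ D.restrictScalars R))
    (fun n => linForms R x ^ (n + 1) • V) (fun n => le_sup_left)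
    (fun n => sup_le (pow_smul_le_pow_smul n.le_succ V) inf_le_left)
    (fun n i a ha => smul_mem_pow_smul ha i)
    (fun n i a ha => by
      obtain ⟨b, hb, c, hc, rfl⟩ := Submodule.mem_sup.1 ha
      rw [smul_add]
      exact Submodule.add_mem_sup (smul_mem_pow_smul hb i)
        ⟨smul_mem_pow_smul hc.1 i, D.smul_mem _ hc.2⟩)
    (fun n i a ha => smul_mem_pow_smul ha i)
    (fun n => hV.pow_smul n) 0 (fun n _ => pow_succ_smul_le (n + 1) V)
  refine ⟨n1 + 1, fun n hn => ?_⟩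
  obtain ⟨m, rfl⟩ : ∃ m, n = m + 1 := ⟨n - 1, by omega⟩
  apply le_antisymm
  · set Y := linForms R x ^ (m + 1) • V ⊓ D.restrictScalars R with hY
    have hYD : linForms R x • Y ≤ D.restrictScalars R :=
      (Submodule.smul_mono le_rfl inf_le_right).trans (Submodule.smul_restrictScalars_le _ D)
    have h1 : linForms R x ^ (m + 1 + 1) • V ⊓ D.restrictScalars R ≤
        linForms R x ^ (m + 1) • V ⊔ linForms R x • Y := by
      refine (le_sup_right.trans (h m (by omega))).trans (sup_le le_sup_left ?_)
      refine (iSup_map_smulBy_le x).trans ?_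
      rw [Submodule.smul_sup, ← Submodule.pow_succ_smul]
    refine (le_inf h1 inf_le_right).trans ?_
    rw [sup_comm, sup_inf_assoc_of_le _ hYD]
    exact sup_le le_rfl (Submodule.le_smul_of_one_le (one_le_linForms R x) Y)
  · refine le_inf ?_ ?_
    · rw [Submodule.pow_succ_smul _ (m + 1) V]
      exact Submodule.smul_mono le_rfl inf_le_left
    · exact (Submodule.smul_mono le_rfl inf_le_right).trans (Submodule.smul_restrictScalars_le _ D)

theorem Submodule.prod_eq_map_sup_map (P : Submodule R B) (Q : Submodule R C) :
    P.prod Q = P.map (LinearMap.inl R B C) ⊔ Q.map (LinearMap.inr R B C) := by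
  rw [Submodule.map_inl, Submodule.map_inr, Submodule.prod_sup_prod, sup_bot_eq, bot_sup_eq]

theorem Submodule.smul_prod (I : Submodule R S) (P : Submodule R B) (Q : Submodule R C) :
    I • P.prod Q = (I • P).prod (I • Q) := by
  rw [Submodule.prod_eq_map_sup_map, Submodule.prod_eq_map_sup_map, Submodule.smul_sup]
  exact congrArg₂ _ (Submodule.map_smul_eq I P (LinearMap.inl S B C)).symm
    (Submodule.map_smul_eq I Q (LinearMap.inr S B C)).symm

/-- V ∩ W is the intersection of V × W with the diagonal of B × B, and the diagonal is a submodule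
over S. -/
theorem exists_inf_generated {V W : Submodule R B} (hV : RelFG V (linForms R x • V))
    (hW : RelFG W (linForms R x • W)) :
    ∃ n0, ∀ n ≥ n0, linForms R x ^ (n + 1) • V ⊓ linForms R x ^ (n + 1) • W =
      linForms R x • (linForms R x ^ n • V ⊓ linForms R x ^ n • W) := by
  have hT : RelFG (V.prod W) (linForms R x • V.prod W) := by
    obtain ⟨F, hF, -, h⟩ := hV
    obtain ⟨F', hF', -, h'⟩ := hW
    refine .of_le_sup (hF.prod hF') ?_
    rw [Submodule.smul_prod, Submodule.prod_sup_prod]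
    exact Submodule.prod_mono h h'
  let δ : B →ₗ[S] B × B := LinearMap.prod LinearMap.id LinearMap.id
  have hδ : Function.Injective (δ.restrictScalars R) := fun a b h => congrArg Prod.fst h
  obtain ⟨n0, h⟩ := exists_inf_restrictScalars_generated hT (LinearMap.range δ)
  have key : ∀ n, (linForms R x ^ n • V ⊓ linForms R x ^ n • W).map (δ.restrictScalars R) =
      linForms R x ^ n • V.prod W ⊓ (LinearMap.range δ).restrictScalars R := by
    intro n
    rw [Submodule.smul_prod]
    apply le_antisymm
    · rintro _ ⟨b, hb, rfl⟩
      exact ⟨hb, b, rfl⟩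
    · rintro _ ⟨hb, b, rfl⟩
      exact ⟨b, hb, rfl⟩
  refine ⟨n0, fun n hn => Submodule.map_injective_of_injective hδ ?_⟩
  rw [key, Submodule.map_smul_eq, key, h n hn]

theorem Submodule.span_fg_of_le [IsNoetherianRing S] {D : Submodule S B} (hD : D.FG)
    {X : Submodule R B} (h : X ≤ D.restrictScalars R) : (Submodule.span S (X : Set B)).FG := by
  have := isNoetherian_of_fg_of_noetherian D hD
  have hle : Submodule.span S (X : Set B) ≤ D := Submodule.span_le.2 h
  have h2 := (IsNoetherian.noetherian ((Submodule.span S (X : Set B)).submoduleOf D)).map D.subtype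
  rwa [Submodule.submoduleOf, Submodule.map_comap_subtype, inf_eq_right.2 hle] at h2

end Inter

/-! ### Leading monomials along linear maps -/

section Lead

variable {R : Type u} {S : Type*} {B C : Type v} [CommRing R] [IsNoetherianRing R] [CommRing S]
  [Algebra R S] [AddCommGroup B] [Module R B] [Module S B] [IsScalarTower R S B]
  [AddCommGroup C] [Module R C] [Module S C] [IsScalarTower R S C]
  (lam : LengthFunction.{u, v} R) {k : ℕ} (x : Fin k → S)

theorem relLen_inf_inf_ne_top {U V U' V' : Submodule R B} (h : relLen lam U V ≠ ∞)
    (h' : relLen lam U' V' ≠ ∞) : relLen lam (U ⊓ U') (V ⊓ V') ≠ ∞ := by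
  refine relLen_trans_ne_top lam (V := U ⊓ V') ?_ ?_
  · rw [relLen_congr_inf lam (U' := U') (by
      rw [inf_comm U U', inf_assoc, ← inf_assoc U U V', inf_idem])]
    exact ne_top_of_le_ne_top h' (relLen_mono_right lam inf_le_right)
  · rw [relLen_congr_inf lam (U' := U) (by rw [inf_assoc, inf_left_comm V', inf_idem])]
    exact ne_top_of_le_ne_top h (relLen_mono_right lam inf_le_left)

variable {lam x} in
theorem IsInert.of_smul_le {V : Submodule R B} (h : linForms R x • V ≤ V) : IsInert lam x V := by
  rw [IsInert, relLen_eq_zero lam h]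
  exact ⟨ENNReal.zero_ne_top, ⟨⊥, Submodule.fg_bot, bot_le, by simpa using h⟩⟩

/-- The leading monomial of the Hilbert polynomial. -/
noncomputable def hilbertLead (V : Submodule R B) : LeadTerm :=
  open Classical in
  if h : ∃ q, IsHilbertPoly lam x V q then LeadTerm.ofPoly h.choose else LeadTerm.zero

variable {lam x}

theorem IsHilbertPoly.hilbertLead_eq {V : Submodule R B} {q : ℝ[X]}
    (h : IsHilbertPoly lam x V q) : hilbertLead lam x V = LeadTerm.ofPoly q := by
  have h' : ∃ q, IsHilbertPoly lam x V q := ⟨q, h⟩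
  rw [hilbertLead, dif_pos h', h'.choose_spec.unique h]

theorem IsInert.hilbertLead_deg_le {V : Submodule R B} (h : IsInert lam x V) :
    (hilbertLead lam x V).deg ≤ k - 1 := by
  obtain ⟨q, hd, hq⟩ := h.exists_isHilbertPoly
  rw [hq.hilbertLead_eq]
  change q.natDegree ≤ k - 1
  by_cases h0 : q = 0
  · simp [h0]
  · rw [Polynomial.degree_eq_natDegree h0] at hd
    have := Nat.cast_lt.1 hd
    omega

theorem hilbertLead_eq_zero {V : Submodule R B} (h : linForms R x • V ≤ V) :
    hilbertLead lam x V = LeadTerm.zero := by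
  have : IsHilbertPoly lam x V 0 := by
    refine .of_forall fun n => ?_
    dsimp only
    rw [relLen_eq_zero]
    · simp
    · rw [Submodule.pow_succ_smul, Submodule.smul_comm_eq]
      exact Submodule.smul_mono le_rfl h
  rw [this.hilbertLead_eq, LeadTerm.ofPoly, LeadTerm.zero]
  simp

theorem IsInert.map {V : Submodule R B} (h : IsInert lam x V) (g : B →ₗ[S] C) :
    IsInert lam x (V.map (g.restrictScalars R)) := by
  rw [IsInert, ← Submodule.map_smul_eq, relLen_map]
  exact ⟨ne_top_of_le_ne_top h.1 (relLen_anti_left lam (Submodule.le_comap_map _ _)), h.2.map _⟩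

theorem isInert_map_iff {V : Submodule R B} {g : B →ₗ[S] C} (hg : Function.Injective g) :
    IsInert lam x (V.map (g.restrictScalars R)) ↔ IsInert lam x V := by
  refine ⟨fun h => ?_, fun h => h.map g⟩
  have hg' : Function.Injective (g.restrictScalars R) := hg
  rw [IsInert, ← Submodule.map_smul_eq, relLen_map, Submodule.comap_map_eq_of_injective hg'] at h
  refine ⟨h.1, ?_⟩
  have := h.2.comap (g.restrictScalars R)
  rwa [Submodule.comap_map_eq_of_injective hg', Submodule.comap_map_eq_of_injective hg'] at this

theorem hilbertLead_map {V : Submodule R B} {g : B →ₗ[S] C} (hg : Function.Injective g) :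
    hilbertLead lam x (V.map (g.restrictScalars R)) = hilbertLead lam x V := by
  have hg' : Function.Injective (g.restrictScalars R) := hg
  have : IsHilbertPoly lam x (V.map (g.restrictScalars R)) = IsHilbertPoly lam x V := by
    unfold IsHilbertPoly
    simp only [← Submodule.map_smul_eq, relLen_map, Submodule.comap_map_eq_of_injective hg']
  unfold hilbertLead
  rw [this]

/-- The intersection of two inert submodules, up to a shift. -/
theorem IsInert.exists_inf {V W : Submodule R B} (hV : IsInert lam x V) (hW : IsInert lam x W)
    (n1 : ℕ) : ∃ n0 ≥ n1, IsInert lam x (linForms R x ^ n0 • V ⊓ linForms R x ^ n0 • W) ∧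
      ∀ m, linForms R x ^ m • (linForms R x ^ n0 • V ⊓ linForms R x ^ n0 • W) =
        linForms R x ^ (n0 + m) • V ⊓ linForms R x ^ (n0 + m) • W := by
  obtain ⟨n, h⟩ := exists_inf_generated hV.2 hW.2
  refine ⟨max n n1, le_max_right _ _, ⟨?_, ?_⟩, fun m => ?_⟩
  · rw [← h _ (le_max_left _ _)]
    exact relLen_inf_inf_ne_top lam (hV.relLen_succ_ne_top _) (hW.relLen_succ_ne_top _)
  · rw [← h _ (le_max_left _ _)]
    exact (hV.2.pow_smul _).inf (hW.2.pow_smul _)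
  · induction m with
    | zero => rw [pow_zero, Submodule.one_smul, add_zero]
    | succ m ih =>
      rw [Submodule.pow_succ_smul, ih, ← add_assoc, h]
      exact (le_max_left _ _).trans (Nat.le_add_right _ _)

theorem Submodule.pow_smul_restrictScalars (D : Submodule S B) (n : ℕ) :
    linForms R x ^ n • D.restrictScalars R = D.restrictScalars R :=
  le_antisymm (Submodule.smul_restrictScalars_le _ D) (le_linForms_pow_smul n _)

/-- The leading term decomposes along a linear map. -/
theorem IsInert.exists_hilbertLead_eq_oplus {V : Submodule R B} (hV : IsInert lam x V)
    (g : B →ₗ[S] C) : ∃ n, ∃ X : Submodule R B, IsInert lam x X ∧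
      X = linForms R x ^ n • V ⊓ (LinearMap.ker g).restrictScalars R ∧
      hilbertLead lam x V =
        (hilbertLead lam x X).oplus (hilbertLead lam x (V.map (g.restrictScalars R))) := by
  have hD : IsInert lam x ((LinearMap.ker g).restrictScalars R) :=
    .of_smul_le (Submodule.smul_restrictScalars_le _ _)
  obtain ⟨n, -, hX, h⟩ := hV.exists_inf hD 0
  simp only [Submodule.pow_smul_restrictScalars] at hX h
  refine ⟨n, _, hX, rfl, ?_⟩
  obtain ⟨p, -, hp⟩ := hX.exists_isHilbertPoly
  obtain ⟨q, -, hq⟩ := (hV.map g).exists_isHilbertPoly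
  obtain ⟨r, -, hr⟩ := hV.exists_isHilbertPoly
  have hq' : IsEventuallyPoly _ _ := IsEventuallyPoly.comp_add hq n
  have hr' : IsEventuallyPoly _ _ := IsEventuallyPoly.comp_add hr n
  -- Lengths split along g, with E^(n+m) V ∩ ker g = E^m X. The shift by n does not affect leading
  -- monomials.
  have e : r.comp (Polynomial.X + (n : ℝ[X])) = p + q.comp (Polynomial.X + (n : ℝ[X])) := by
    refine polynomial_eq_of_eventually ?_
    have hs : IsEventuallyPoly _ _ := IsEventuallyPoly.add hp hq'
    filter_upwards [hr'.toReal, hs.toReal] with m h1 h2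
    rw [← h1, ← h2]
    congr 1
    rw [relLen_eq_add_of_map lam (g.restrictScalars R)
      (pow_smul_le_pow_smul (Nat.le_succ (m + n)) V), add_comm, Submodule.map_smul_eq,
      Submodule.map_smul_eq, h, h]
    congr 3
    · rw [add_comm]
    · rw [Nat.succ_eq_add_one, add_right_comm, add_comm, ← add_assoc, add_right_comm]
  rw [hp.hilbertLead_eq, hq.hilbertLead_eq, hr.hilbertLead_eq, ← LeadTerm.ofPoly_comp r n, e,
    ← LeadTerm.ofPoly_comp q n]
  exact LeadTerm.ofPoly_add hp.leadingCoeff_nonneg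
    (leadingCoeff_nonneg_of_eventually (hq'.mono fun _ h => h.1))

/-- Only submodules generating a finitely generated module over the big ring matter. -/
theorem IsInert.exists_fg_span [IsNoetherianRing S] {V : Submodule R B} (hV : IsInert lam x V) :
    ∃ X : Submodule R B, IsInert lam x X ∧ (Submodule.span S (X : Set B)).FG ∧
      hilbertLead lam x X = hilbertLead lam x V := by
  obtain ⟨F, ⟨t, rfl⟩, hle, h⟩ := hV.2
  let D : Submodule S B := Submodule.span S t
  obtain ⟨n, X, hX, hXn, e⟩ := hV.exists_hilbertLead_eq_oplus D.mkQ
  rw [Submodule.ker_mkQ] at hXn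
  refine ⟨X, hX, ?_, ?_⟩
  · refine Submodule.span_fg_of_le ⟨t, rfl⟩ (D := D) ?_
    rw [hXn]
    exact inf_le_right
  -- Modulo D = S F the image of V is stable under E, since E V = V + F, so it contributes the zero
  -- monomial.
  · have h0 : hilbertLead lam x (V.map (D.mkQ.restrictScalars R)) = LeadTerm.zero := by
      refine hilbertLead_eq_zero ?_
      rw [← Submodule.map_smul_eq, Submodule.map_le_iff_le_comap]
      refine h.trans (sup_le (Submodule.le_comap_map _ _) (Submodule.span_le.2 fun a ha => ?_))
      refine ⟨0, V.zero_mem, ?_⟩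
      rw [map_zero]
      exact ((Submodule.Quotient.mk_eq_zero D).2 (Submodule.subset_span ha)).symm
    rw [e, h0]
    unfold LeadTerm.oplus LeadTerm.zero
    split_ifs with h1 h2
    · rfl
    · simp at h2
    · simp

end Lead

/-! ### Generating submodules and superadditivity -/

section Super

variable {R : Type u} {S : Type*} {B C : Type v} [CommRing R] [IsNoetherianRing R] [CommRing S]
  [Algebra R S] [AddCommGroup B] [Module R B] [Module S B] [IsScalarTower R S B]
  [AddCommGroup C] [Module R C] [Module S C] [IsScalarTower R S C]
  {lam : LengthFunction.{u, v} R} {k : ℕ} {x : Fin k → S}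

theorem RelFG.exists_smul_eq_sup {V : Submodule R B} (h : RelFG V (linForms R x • V)) :
    ∃ F : Submodule R B, F.FG ∧ linForms R x • V = V ⊔ F := by
  obtain ⟨F, hF, hle, hle'⟩ := h
  exact ⟨F, hF, le_antisymm hle' (sup_le (Submodule.le_smul_of_one_le (one_le_linForms R x) V) hle)⟩

theorem IsInert.hilbertLead_le {V : Submodule R B} {W : Submodule R C} (hV : IsInert lam x V)
    (hW : IsInert lam x W) {c : ℝ≥0∞} (hc : c ≠ ∞)
    (h : ∀ n, relLen lam V (linForms R x ^ n • V) ≤ relLen lam W (linForms R x ^ n • W) + c) :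
    (hilbertLead lam x V).Le (hilbertLead lam x W) := by
  obtain ⟨p, hdp, hp⟩ := hV.exists_isHilbertPoly
  obtain ⟨q, hdq, hq⟩ := hW.exists_isHilbertPoly
  obtain ⟨P, -, rfl, hP⟩ := hV.exists_sum_isEventuallyPoly hp hdp
  obtain ⟨Q, -, rfl, hQ⟩ := hW.exists_sum_isEventuallyPoly hq hdq
  rw [hp.hilbertLead_eq, hq.hilbertLead_eq]
  exact LeadTerm.ofPoly_le_of_growth (c := 0) hP hQ hp.leadingCoeff_nonneg hc (.of_forall h)

theorem forwardDiff_add_eq (p q : ℝ[X]) : forwardDiff (p + q) = forwardDiff p + forwardDiff q := by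
  simp only [forwardDiff, Polynomial.add_comp]; ring

theorem IsInert.oplus_hilbertLead_le {D : Type v} [AddCommGroup D] [Module R D] [Module S D]
    [IsScalarTower R S D] {V : Submodule R B} {W : Submodule R C} {Z : Submodule R D}
    (hV : IsInert lam x V) (hW : IsInert lam x W) (hZ : IsInert lam x Z)
    {c : ℝ≥0∞} (hc : c ≠ ∞)
    (h : ∀ n, relLen lam V (linForms R x ^ n • V) + relLen lam W (linForms R x ^ n • W) ≤
      relLen lam Z (linForms R x ^ n • Z) + c) :
    ((hilbertLead lam x V).oplus (hilbertLead lam x W)).Le (hilbertLead lam x Z) := by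
  obtain ⟨p, hdp, hp⟩ := hV.exists_isHilbertPoly
  obtain ⟨q, hdq, hq⟩ := hW.exists_isHilbertPoly
  obtain ⟨r, hdr, hr⟩ := hZ.exists_isHilbertPoly
  obtain ⟨P, -, rfl, hP⟩ := hV.exists_sum_isEventuallyPoly hp hdp
  obtain ⟨Q, -, rfl, hQ⟩ := hW.exists_sum_isEventuallyPoly hq hdq
  obtain ⟨T, -, rfl, hT⟩ := hZ.exists_sum_isEventuallyPoly hr hdr
  rw [hp.hilbertLead_eq, hq.hilbertLead_eq, hr.hilbertLead_eq,
    ← LeadTerm.ofPoly_add hp.leadingCoeff_nonneg hq.leadingCoeff_nonneg, ← forwardDiff_add_eq]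
  refine LeadTerm.ofPoly_le_of_growth (c := 0) (hP.add hQ) hT ?_ hc (.of_forall h)
  rw [forwardDiff_add_eq]
  have hpq : IsEventuallyPoly _ _ := IsEventuallyPoly.add hp hq
  exact leadingCoeff_nonneg_of_eventually (hpq.mono fun _ h => h.1)

/-- If `W` meets the module generated by `F` inside `E ^ b V`, then `F` grows in `W` at least as
fast as in `V`. -/
theorem relLen_pow_le_of_inf_le {V F W : Submodule R B} (hEV : linForms R x • V = V ⊔ F) {b : ℕ}
    (h : ∀ a ∈ W, (∃ c, a ∈ linForms R x ^ c • V) → a ∈ linForms R x ^ b • V) (n : ℕ) :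
    relLen lam V (linForms R x ^ n • V) ≤
      relLen lam W (linForms R x ^ n • F) + relLen lam V (linForms R x ^ b • V) := by
  refine (relLen_mono_right lam (pow_smul_le_pow_smul n.le_succ V)).trans ?_
  rw [pow_succ_smul_eq_sup hEV, relLen_sup_left, add_comm]
  refine (relLen_triangle lam V (linForms R x ^ b • V) _).trans (add_le_add_right ?_ _)
  rw [← relLen_inf lam W]
  refine relLen_anti_left lam fun a ha => h a ha.1 ⟨n + 1, ?_⟩
  rw [pow_succ_smul_eq_sup hEV]
  exact Submodule.mem_sup_right ha.2

variable (hS : ∀ s : S, ∃ n : ℕ, s ∈ linForms R x ^ n)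

include hS in
/-- An inert submodule of a finitely generated module can be enlarged to a generating one. -/
theorem IsInert.exists_generating [Module.Finite S B] {V : Submodule R B} (hV : IsInert lam x V) :
    ∃ W : Submodule R B, IsInert lam x W ∧ Submodule.span S (W : Set B) = ⊤ ∧
      (hilbertLead lam x V).Le (hilbertLead lam x W) := by
  obtain ⟨F, hF, hEV⟩ := hV.2.exists_smul_eq_sup
  obtain ⟨t, ht⟩ := (Module.Finite.fg_top : (⊤ : Submodule S B).FG)
  obtain ⟨W, hW, hGW, -, h⟩ := hV.exists_extension hS hF hEV
    (hF.sup (Submodule.fg_span (R := R) t.finite_toSet))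
  obtain ⟨b, hb⟩ := h 0
  rw [pow_zero, Submodule.one_smul] at hb
  refine ⟨W, hW, ?_, hV.hilbertLead_le hW (hV.relLen_ne_top b) fun n => ?_⟩
  · rw [eq_top_iff, ← ht]
    exact Submodule.span_mono (Set.Subset.trans Submodule.subset_span (le_sup_right.trans hGW : _ ≤ W))
  · refine (relLen_pow_le_of_inf_le hEV hb n).trans (add_le_add_left ?_ _)
    exact relLen_mono_right lam (Submodule.smul_mono le_rfl (le_sup_left.trans hGW))

theorem Submodule.comap_smul_eq {g : B →ₗ[S] C} (hg : Function.Surjective g) (V : Submodule R C) :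
    linForms R x • V.comap (g.restrictScalars R) =
      (linForms R x • V).comap (g.restrictScalars R) := by
  have hg' : Function.Surjective (g.restrictScalars R) := hg
  conv_rhs => rw [← Submodule.map_comap_eq_of_surjective hg' V, ← Submodule.map_smul_eq,
    Submodule.comap_map_eq]
  refine (sup_eq_left.2 (le_trans ?_ (Submodule.le_smul_of_one_le (one_le_linForms R x) _))).symm
  exact LinearMap.ker_le_comap _

theorem IsInert.comap {g : B →ₗ[S] C} (hg : Function.Surjective g) {V : Submodule R C}
    (hV : IsInert lam x V) : IsInert lam x (V.comap (g.restrictScalars R)) := by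
  have hg' : Function.Surjective (g.restrictScalars R) := hg
  rw [IsInert, Submodule.comap_smul_eq hg, ← relLen_map, Submodule.map_comap_eq_of_surjective hg']
  exact ⟨hV.1, hV.2.comap _⟩

include hS in
/-- Inert submodules of the kernel and the image of a linear map can be glued. -/
theorem IsInert.exists_oplus_le [IsNoetherianRing S] {g : B →ₗ[S] C}
    (hg : Function.Surjective g) {V : Submodule R B} (hV : IsInert lam x V)
    (hVg : V ≤ (LinearMap.ker g).restrictScalars R) {V' : Submodule R C}
    (hV' : IsInert lam x V') :
    ∃ W : Submodule R B, IsInert lam x W ∧ (Submodule.span S (W : Set B)).FG ∧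
      ((hilbertLead lam x V).oplus (hilbertLead lam x V')).Le (hilbertLead lam x W) := by
  have hg' : Function.Surjective (g.restrictScalars R) := hg
  obtain ⟨F, hF, hEV⟩ := hV.2.exists_smul_eq_sup
  obtain ⟨F', hF', hEV'⟩ := hV'.2.exists_smul_eq_sup
  have hFg : F ≤ (LinearMap.ker g).restrictScalars R := by
    refine le_sup_right.trans (hEV.symm.le.trans ?_)
    exact (Submodule.smul_mono le_rfl hVg).trans (Submodule.smul_restrictScalars_le _ _)
  obtain ⟨t, ht⟩ := hF'
  choose i hi using id hg
  -- Only the finitely generated F' is lifted; V' itself has no useful lift.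
  let L : Submodule R B := Submodule.span R (i '' t)
  have hL : L.map (g.restrictScalars R) = F' := by
    rw [Submodule.map_span, ← ht, Set.image_image]
    congr 1
    simp [hi]
  have hG : (F ⊔ L).FG := hF.sup (Submodule.fg_span (t.finite_toSet.image i))
  obtain ⟨W, hW, hGW, hWG, h⟩ := hV.exists_extension hS hF hEV hG
  set Y := V'.comap (g.restrictScalars R) with hYdef
  have hY : IsInert lam x Y := hV'.comap hg
  -- Intersecting with the preimage Y of V' keeps the image in C below E^n0 V'. The bound n0 ≥ 1
  -- makes the intersection contain L, which maps into E V' but not necessarily into V'.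
  obtain ⟨n0, hn0, hZ, hZn⟩ := hW.exists_inf hY 1
  set Z := linForms R x ^ n0 • W ⊓ linForms R x ^ n0 • Y with hZdef
  have hGY : F ⊔ L ≤ linForms R x • Y := by
    rw [hYdef, Submodule.comap_smul_eq hg, ← Submodule.map_le_iff_le_comap, Submodule.map_sup, hL]
    refine sup_le ?_ (hEV'.symm ▸ le_sup_right)
    rintro _ ⟨f, hf, rfl⟩
    have : g f = 0 := hFg hf
    rw [LinearMap.restrictScalars_apply, this]
    exact zero_mem _
  have hGZ : F ⊔ L ≤ Z := by
    refine le_inf (hGW.trans (le_linForms_pow_smul n0 W)) (hGY.trans ?_)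
    have := pow_smul_le_pow_smul (x := x) hn0 Y
    rwa [pow_one] at this
  obtain ⟨b, hb⟩ := h n0
  have hbZ : ∀ a ∈ Z ⊓ (LinearMap.ker g).restrictScalars R, (∃ c, a ∈ linForms R x ^ c • V) →
      a ∈ linForms R x ^ b • V := fun a ha hc => hb a ha.1.1 hc
  have hbZ' : ∀ a ∈ Z.map (g.restrictScalars R), (∃ c, a ∈ linForms R x ^ c • V') →
      a ∈ linForms R x ^ n0 • V' := by
    intro a ha _
    have := Submodule.map_mono (f := g.restrictScalars R) (inf_le_right : Z ≤ _) ha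
    rwa [Submodule.map_smul_eq, hYdef, Submodule.map_comap_eq_of_surjective hg'] at this
  refine ⟨Z, hZ, ?_, hV.oplus_hilbertLead_le hV' hZ
    (ENNReal.add_ne_top.2 ⟨hV'.relLen_ne_top n0, hV.relLen_ne_top b⟩) fun n => ?_⟩
  · obtain ⟨s, hs⟩ := hG
    refine Submodule.span_fg_of_le (D := Submodule.span S s) ⟨s, rfl⟩ ?_
    refine inf_le_left.trans ?_
    rw [← Submodule.pow_smul_restrictScalars (R := R) (x := x) (Submodule.span S (s : Set B)) n0]
    refine Submodule.smul_mono le_rfl fun w hw => ?_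
    obtain ⟨n, hn⟩ := hWG w hw
    rw [← Submodule.pow_smul_restrictScalars (R := R) (x := x) (Submodule.span S (s : Set B)) n]
    refine Submodule.smul_mono le_rfl ?_ hn
    rw [← hs]
    exact Submodule.span_le_restrictScalars R S _
  -- The length for Z splits along g. The image part dominates the growth of V' through L, the
  -- kernel part that of V through F, each up to a fixed finite length.
  · rw [relLen_eq_add_of_map lam (g.restrictScalars R) (le_linForms_pow_smul n Z),
      add_comm (relLen lam V _), add_add_add_comm]
    refine add_le_add ((relLen_pow_le_of_inf_le hEV' hbZ' n).trans (add_le_add_left ?_ _))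
      ((relLen_pow_le_of_inf_le hEV hbZ n).trans (add_le_add_left ?_ _))
    · refine relLen_mono_right lam ?_
      rw [Submodule.map_smul_eq, ← hL]
      exact Submodule.smul_mono le_rfl (Submodule.map_mono (le_sup_right.trans hGZ))
    · refine relLen_mono_right lam (le_inf ?_ ?_)
      · exact Submodule.smul_mono le_rfl (le_sup_left.trans hGZ)
      · exact (Submodule.smul_mono le_rfl hFg).trans (Submodule.smul_restrictScalars_le _ _)

end Super

namespace LeadTerm

theorem bddAbove_deg {I : Set LeadTerm} {d : ℕ} (h : ∀ m ∈ I, m.deg ≤ d) :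
    BddAbove (deg '' I) := ⟨d, by rintro _ ⟨m, hm, rfl⟩; exact h m hm⟩

theorem sup_deg_le {I : Set LeadTerm} {d : ℕ} (h : ∀ m ∈ I, m.deg ≤ d) : (sup I).deg ≤ d := by
  rcases I.eq_empty_or_nonempty with rfl | hne
  · simp [sup]
  · obtain ⟨m, hm, e⟩ := exists_deg_eq_sup hne (bddAbove_deg h)
    exact e ▸ h m hm

/-- A multiple of the coefficient in a fixed degree. -/
noncomputable def coeffAt (c : ℝ≥0∞) (d : ℕ) (m : LeadTerm) : ℝ≥0∞ :=
  if m.deg = d then c * m.coeff else 0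

variable {c : ℝ≥0∞} {d : ℕ}

theorem coeffAt_oplus {a b : LeadTerm} (ha : a.deg ≤ d) (hb : b.deg ≤ d) :
    coeffAt c d (oplus a b) = coeffAt c d a + coeffAt c d b := by
  unfold oplus coeffAt
  rcases lt_trichotomy a.deg b.deg with h | h | h
  · simp [h, h.not_gt, (h.trans_le hb).ne]
  · simp only [h, lt_irrefl, if_false]
    split_ifs <;> simp [mul_add]
  · simp [h, (h.trans_le ha).ne]

theorem coeffAt_sup {I : Set LeadTerm} (h : ∀ m ∈ I, m.deg ≤ d) :
    coeffAt c d (sup I) = ⨆ m ∈ I, coeffAt c d m := by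
  apply le_antisymm
  · unfold coeffAt
    split_ifs with hd
    · have : (sup I).coeff = sSup {r | ∃ m ∈ I, m.deg = (sup I).deg ∧ m.coeff = r} := rfl
      rw [this, ENNReal.mul_sSup]
      refine iSup₂_le ?_
      rintro _ ⟨m, hm, hmd, rfl⟩
      refine le_iSup₂_of_le m hm ?_
      rw [if_pos (hmd.trans hd)]
    · exact bot_le
  · refine iSup₂_le fun m hm => ?_
    unfold coeffAt
    split_ifs with h1 h2 h2
    · rcases le_sup (bddAbove_deg h) hm with h3 | ⟨-, h3⟩
      · omega
      · exact mul_le_mul_right h3 c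
    · have h3 := sup_deg_le h
      rcases le_sup (bddAbove_deg h) hm with h4 | ⟨h4, -⟩
      · omega
      · omega
    · exact bot_le
    · exact bot_le

end LeadTerm

/-! ### The invariant and its additivity -/

section Invariant

variable {R : Type u} {S : Type*} {A B C : Type v} [CommRing R] [IsNoetherianRing R] [CommRing S]
  [Algebra R S] [AddCommGroup A] [Module R A] [Module S A] [IsScalarTower R S A]
  [AddCommGroup B] [Module R B] [Module S B] [IsScalarTower R S B]
  [AddCommGroup C] [Module R C] [Module S C] [IsScalarTower R S C]
  (lam : LengthFunction.{u, v} R) {k : ℕ} (x : Fin k → S)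

variable (A) in
/-- The leading monomials of the inert submodules generating a finitely generated module. -/
def hilbertLeads : Set LeadTerm :=
  {m | ∃ V : Submodule R A, IsInert lam x V ∧ (Submodule.span S (V : Set A)).FG ∧
    m = hilbertLead lam x V}

variable (A) in
/-- The supremum of the leading monomials of the Hilbert polynomials. -/
noncomputable def hilbertSup : LeadTerm := LeadTerm.sup (hilbertLeads A lam x)

variable {lam x}

theorem hilbertLeads_deg_le : ∀ m ∈ hilbertLeads A lam x, m.deg ≤ k - 1 := by
  rintro _ ⟨V, hV, -, rfl⟩
  exact hV.hilbertLead_deg_le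

theorem hilbertLeads_nonempty : (hilbertLeads A lam x).Nonempty :=
  ⟨_, ⊥, isInert_bot, by simpa using Submodule.fg_bot, rfl⟩

theorem hilbertSup_deg_le : (hilbertSup A lam x).deg ≤ k - 1 :=
  LeadTerm.sup_deg_le hilbertLeads_deg_le

theorem IsInert.hilbertLead_le_hilbertSup {V : Submodule R A} (hV : IsInert lam x V)
    (h : (Submodule.span S (V : Set A)).FG) : (hilbertLead lam x V).Le (hilbertSup A lam x) :=
  LeadTerm.le_sup (LeadTerm.bddAbove_deg hilbertLeads_deg_le) ⟨V, hV, h, rfl⟩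

theorem hilbertSup_le {m : LeadTerm} (h : ∀ V : Submodule R A, IsInert lam x V →
    (Submodule.span S (V : Set A)).FG → (hilbertLead lam x V).Le m) :
    (hilbertSup A lam x).Le m := by
  refine LeadTerm.sup_le hilbertLeads_nonempty (LeadTerm.bddAbove_deg hilbertLeads_deg_le) ?_
  rintro _ ⟨V, hV, hfg, rfl⟩
  exact h V hV hfg

theorem span_map_restrictScalars (f : A →ₗ[S] B) (V : Submodule R A) :
    Submodule.span S (V.map (f.restrictScalars R) : Set B) =
      (Submodule.span S (V : Set A)).map f := by
  rw [Submodule.map_span]; rfl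

theorem hilbertSup_le_of_injective (f : A →ₗ[S] B) (hf : Function.Injective f) :
    (hilbertSup A lam x).Le (hilbertSup B lam x) := by
  refine hilbertSup_le fun V hV hfg => ?_
  rw [← hilbertLead_map hf]
  refine (hV.map f).hilbertLead_le_hilbertSup ?_
  rw [span_map_restrictScalars]
  exact hfg.map f

theorem hilbertSup_congr (e : A ≃ₗ[S] B) : hilbertSup A lam x = hilbertSup B lam x :=
  (hilbertSup_le_of_injective e.toLinearMap e.injective).antisymm
    (hilbertSup_le_of_injective e.symm.toLinearMap e.symm.injective)

theorem hilbertSup_of_subsingleton [Subsingleton A] : hilbertSup A lam x = LeadTerm.zero := by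
  refine LeadTerm.Le.antisymm (hilbertSup_le fun V _ _ => ?_) (LeadTerm.zero_le _)
  rw [hilbertLead_eq_zero]
  · exact .refl _
  · intro a _
    rw [Subsingleton.elim a 0]
    exact zero_mem _

/-- An inert submodule lying in the range of an injective map is the image of one. -/
theorem IsInert.hilbertLead_le_of_le_range {f : A →ₗ[S] B} (hf : Function.Injective f)
    {V : Submodule R B} (hV : IsInert lam x V) (hfg : (Submodule.span S (V : Set B)).FG)
    (h : V ≤ (LinearMap.range f).restrictScalars R) :
    (hilbertLead lam x V).Le (hilbertSup A lam x) := by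
  obtain ⟨V, rfl⟩ : ∃ U : Submodule R A, V = U.map (f.restrictScalars R) :=
    ⟨V.comap (f.restrictScalars R), (Submodule.map_comap_eq_self h).symm⟩
  rw [hilbertLead_map hf]
  refine ((isInert_map_iff hf).1 hV).hilbertLead_le_hilbertSup ?_
  rw [span_map_restrictScalars] at hfg
  exact Submodule.fg_of_fg_map_injective f hf hfg

theorem hilbertSup_eq_sup_fg :
    hilbertSup A lam x =
      LeadTerm.sup {m | ∃ B : Submodule S A, B.FG ∧ m = hilbertSup B lam x} := by
  have hd : ∀ m ∈ {m | ∃ B : Submodule S A, B.FG ∧ m = hilbertSup B lam x}, m.deg ≤ k - 1 := by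
    rintro _ ⟨B, -, rfl⟩
    exact hilbertSup_deg_le
  have hne : {m | ∃ B : Submodule S A, B.FG ∧ m = hilbertSup B lam x}.Nonempty :=
    ⟨_, ⊥, Submodule.fg_bot, rfl⟩
  refine LeadTerm.Le.antisymm (hilbertSup_le fun V hV hfg => ?_)
    (LeadTerm.sup_le hne (LeadTerm.bddAbove_deg hd) ?_)
  · refine LeadTerm.Le.trans (b := hilbertSup (Submodule.span S (V : Set A)) lam x) ?_
      (LeadTerm.le_sup (LeadTerm.bddAbove_deg hd) ⟨_, hfg, rfl⟩)
    refine hV.hilbertLead_le_of_le_range (Submodule.subtype_injective _) hfg ?_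
    rw [Submodule.range_subtype]
    exact Submodule.subset_span
  · rintro _ ⟨B, -, rfl⟩
    exact hilbertSup_le_of_injective B.subtype (Submodule.subtype_injective B)

variable (hS : ∀ s : S, ∃ n : ℕ, s ∈ linForms R x ^ n)

include hS in
theorem hilbertSup_eq_of_finite [Module.Finite S A] :
    hilbertSup A lam x = LeadTerm.sup {m | ∃ V : Submodule R A, IsInert lam x V ∧
      Submodule.span S (V : Set A) = ⊤ ∧ m = hilbertLead lam x V} := by
  have hfg : (⊤ : Submodule S A).FG := Module.Finite.fg_top
  have hd : ∀ m ∈ {m | ∃ V : Submodule R A, IsInert lam x V ∧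
      Submodule.span S (V : Set A) = ⊤ ∧ m = hilbertLead lam x V}, m.deg ≤ k - 1 := by
    rintro _ ⟨V, hV, -, rfl⟩
    exact hV.hilbertLead_deg_le
  refine LeadTerm.Le.antisymm (hilbertSup_le fun V hV _ => ?_)
    (LeadTerm.sup_le ?_ (LeadTerm.bddAbove_deg hd) ?_)
  · obtain ⟨W, hW, hWt, hle⟩ := hV.exists_generating hS
    exact hle.trans (LeadTerm.le_sup (LeadTerm.bddAbove_deg hd) ⟨W, hW, hWt, rfl⟩)
  · refine ⟨_, ⊤, .of_smul_le le_top, ?_, rfl⟩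
    rw [Submodule.top_coe, Submodule.span_univ]
  · rintro _ ⟨V, hV, hVt, rfl⟩
    exact hV.hilbertLead_le_hilbertSup (hVt ▸ hfg)

include hS in
-- For ≤, each V in B decomposes exactly along g. For ≥, any pair from A and C is glued by
-- `IsInert.exists_oplus_le`, and `LeadTerm.oplus_sup_le` passes to suprema.
theorem hilbertSup_add [IsNoetherianRing S] {f : A →ₗ[S] B} {g : B →ₗ[S] C}
    (hf : Function.Injective f) (hg : Function.Surjective g) (hfg : Function.Exact f g) :
    hilbertSup B lam x = (hilbertSup A lam x).oplus (hilbertSup C lam x) := by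
  have hker : LinearMap.ker g = LinearMap.range f := LinearMap.exact_iff.1 hfg
  refine LeadTerm.Le.antisymm (hilbertSup_le fun V hV hVfg => ?_) ?_
  · obtain ⟨n, X, hX, hXn, e⟩ := hV.exists_hilbertLead_eq_oplus g
    rw [e]
    refine LeadTerm.oplus_mono ?_ ?_
    · refine hX.hilbertLead_le_of_le_range hf ?_ (hker ▸ hXn.le.trans inf_le_right)
      refine Submodule.span_fg_of_le hVfg (hXn.le.trans (inf_le_left.trans ?_))
      conv_rhs => rw [← Submodule.pow_smul_restrictScalars (R := R) (x := x) _ n]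
      exact Submodule.smul_mono le_rfl Submodule.subset_span
    · refine (hV.map g).hilbertLead_le_hilbertSup ?_
      rw [span_map_restrictScalars]
      exact hVfg.map g
  · refine LeadTerm.oplus_sup_le hilbertLeads_nonempty hilbertLeads_nonempty
      (LeadTerm.bddAbove_deg hilbertLeads_deg_le) (LeadTerm.bddAbove_deg hilbertLeads_deg_le) ?_
    rintro _ ⟨V, hV, -, rfl⟩ _ ⟨V', hV', -, rfl⟩
    rw [← hilbertLead_map hf]
    have hVg : V.map (f.restrictScalars R) ≤ (LinearMap.ker g).restrictScalars R := by
      rintro _ ⟨a, -, rfl⟩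
      exact hfg.apply_apply_eq_zero a
    obtain ⟨W, hW, hWfg, hle⟩ := (hV.map f).exists_oplus_le hS hg hVg hV'
    exact hle.trans (hW.hilbertLead_le_hilbertSup hWfg)

end Invariant

/-! ### Intrinsic entropy -/

section Entropy

variable {R : Type u} {S : Type*} {A : Type v} [CommRing R] [IsNoetherianRing R] [CommRing S]
  [Algebra R S] [AddCommGroup A] [Module R A] [Module S A] [IsScalarTower R S A]
  {lam : LengthFunction.{u, v} R} {k : ℕ} {x : Fin k → S}

theorem IsEventuallyPoly.tendsto_div_pow {a : ℕ → ℝ≥0∞} {q : ℝ[X]} (h : IsEventuallyPoly a q)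
    (hd : q.natDegree ≤ k) :
    Tendsto (fun n : ℕ => (k ! : ℝ≥0∞) * a n / (n : ℝ≥0∞) ^ k) atTop
      (𝓝 (ENNReal.ofReal (k ! * q.coeff k))) := by
  have h1 : Tendsto (fun n : ℕ => q.eval (n : ℝ) / (n : ℝ) ^ k) atTop (𝓝 (q.coeff k)) := by
    have h2 : Tendsto (fun y : ℝ => q.eval y / (Polynomial.X ^ k : ℝ[X]).eval y) atTop
        (𝓝 (q.coeff k)) := by
      by_cases h0 : q.coeff k = 0
      · rw [h0]
        refine Polynomial.div_tendsto_atTop_zero_of_degree_lt _ _ ?_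
        rw [Polynomial.degree_X_pow]
        exact lt_of_le_of_ne (Polynomial.natDegree_le_iff_degree_le.1 hd)
          fun h => Polynomial.coeff_ne_zero_of_eq_degree h h0
      · have hdk : q.natDegree = k := le_antisymm hd (Polynomial.le_natDegree_of_ne_zero h0)
        have hq0 : q ≠ 0 := fun h => h0 (by simp [h])
        have := Polynomial.div_tendsto_atTop_leadingCoeff_div_of_degree_eq q (Polynomial.X ^ k)
          (by rw [Polynomial.degree_X_pow, Polynomial.degree_eq_natDegree hq0, hdk])
        rwa [(Polynomial.monic_X_pow k).leadingCoeff, div_one, Polynomial.leadingCoeff, hdk] at this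
    refine (h2.comp tendsto_natCast_atTop_atTop).congr fun n => ?_
    simp
  have h2 : Tendsto (fun n : ℕ => ENNReal.ofReal (k ! * (q.eval (n : ℝ) / (n : ℝ) ^ k))) atTop
      (𝓝 (ENNReal.ofReal (k ! * q.coeff k))) :=
    ENNReal.tendsto_ofReal (h1.const_mul _)
  refine h2.congr' ?_
  filter_upwards [h, eventually_gt_atTop 0] with n hn hn0
  have hn' : (0 : ℝ) < n := Nat.cast_pos.2 hn0
  rw [hn.2, ENNReal.ofReal_mul (by positivity), ENNReal.ofReal_div_of_pos (by positivity),
    ENNReal.ofReal_pow hn'.le, ENNReal.ofReal_natCast, ENNReal.ofReal_natCast, mul_div_assoc]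

/-- The entropy of an inert submodule is a coefficient of its Hilbert polynomial. -/
theorem IsInert.tendsto_entropy {V : Submodule R A} (hV : IsInert lam x V) (hk : 0 < k) :
    Tendsto (fun n : ℕ => (k ! : ℝ≥0∞) * relLen lam V (linForms R x ^ n • V) / (n : ℝ≥0∞) ^ k)
      atTop (𝓝 (LeadTerm.coeffAt ((k - 1)! : ℕ) (k - 1) (hilbertLead lam x V))) := by
  obtain ⟨d, rfl⟩ : ∃ d, k = d + 1 := ⟨k - 1, by omega⟩
  obtain ⟨q, hd, hq⟩ := hV.exists_isHilbertPoly
  obtain ⟨Q, hdQ, hQq, hQ⟩ := hV.exists_sum_isEventuallyPoly hq hd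
  have hdQ' : Q.natDegree ≤ d + 1 := Polynomial.natDegree_le_of_degree_le (Order.le_of_lt_succ hdQ)
  have h := hQ.tendsto_div_pow hdQ'
  have hc := coeff_forwardDiff hdQ'
  rw [hQq] at hc
  -- Q is a discrete integral of q, so its top coefficient is that of q divided by d + 1; this turns
  -- k! into (k - 1)!.
  have e : ((d + 1)! : ℝ) * Q.coeff (d + 1) = d ! * q.coeff d := by
    rw [hc.1, Nat.factorial_succ]
    push_cast
    ring
  rw [e] at h
  convert h using 2
  rw [hq.hilbertLead_eq, LeadTerm.coeffAt, Nat.add_sub_cancel]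
  have h2 : (LeadTerm.ofPoly q).deg = q.natDegree := rfl
  have h3 : (LeadTerm.ofPoly q).coeff = ENNReal.ofReal q.leadingCoeff := rfl
  by_cases h1 : q.natDegree = d
  · rw [if_pos (h2.trans h1), h3, ENNReal.ofReal_mul (by positivity), ENNReal.ofReal_natCast,
      Polynomial.leadingCoeff, h1]
  · rw [if_neg fun h => h1 (h2.symm.trans h),
      Polynomial.coeff_eq_zero_of_natDegree_lt (lt_of_le_of_ne hc.2 h1), mul_zero,
      ENNReal.ofReal_zero]

/-- The supremum defining the entropy does not require S V to be finitely generated;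
`IsInert.exists_fg_span` replaces any V by one that satisfies this and has the same leading
monomial. -/
theorem coeffAt_hilbertSup [IsNoetherianRing S] (c : ℝ≥0∞) :
    LeadTerm.coeffAt c (k - 1) (hilbertSup A lam x) =
      ⨆ (V : Submodule R A) (_ : IsInert lam x V),
        LeadTerm.coeffAt c (k - 1) (hilbertLead lam x V) := by
  rw [hilbertSup, LeadTerm.coeffAt_sup hilbertLeads_deg_le]
  apply le_antisymm
  · refine iSup₂_le ?_
    rintro _ ⟨V, hV, -, rfl⟩
    exact le_iSup₂_of_le V hV le_rfl
  · refine iSup₂_le fun V hV => ?_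
    obtain ⟨X, hX, hfg, e⟩ := hV.exists_fg_span
    rw [← e]
    exact le_iSup₂_of_le _ ⟨X, hX, hfg, rfl⟩ le_rfl

end Entropy

/-! ### Translation to the polynomial ring -/

section MvPolynomial

variable {R : Type u} [CommRing R] {k : ℕ}

theorem mem_linForms_X_pow {n : ℕ} {s : MvPolynomial (Fin k) R} :
    s ∈ linForms R (MvPolynomial.X : Fin k → MvPolynomial (Fin k) R) ^ n ↔ s.totalDegree ≤ n := by
  have hE := one_le_linForms R (MvPolynomial.X : Fin k → MvPolynomial (Fin k) R)
  have hX := mem_linForms R (MvPolynomial.X : Fin k → MvPolynomial (Fin k) R)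
  constructor
  · have h1 : linForms R (MvPolynomial.X : Fin k → MvPolynomial (Fin k) R) ≤
        MvPolynomial.restrictTotalDegree (Fin k) R 1 := by
      rw [linForms, Submodule.span_le]
      rintro _ (rfl | ⟨i, rfl⟩)
      · simp [MvPolynomial.mem_restrictTotalDegree]
      · rw [SetLike.mem_coe, MvPolynomial.mem_restrictTotalDegree]
        rcases subsingleton_or_nontrivial R with _ | _
        · simp [Subsingleton.elim (MvPolynomial.X i : MvPolynomial (Fin k) R) 0]
        · exact (MvPolynomial.totalDegree_X i).le
    have h2 : linForms R (MvPolynomial.X : Fin k → MvPolynomial (Fin k) R) ^ n ≤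
        MvPolynomial.restrictTotalDegree (Fin k) R n := by
      induction n with
      | zero =>
        rw [pow_zero, Submodule.one_le, MvPolynomial.mem_restrictTotalDegree]
        simp
      | succ n ih =>
        rw [pow_succ]
        refine (mul_le_mul' ih h1).trans (Submodule.mul_le.2 fun a ha b hb => ?_)
        rw [MvPolynomial.mem_restrictTotalDegree] at ha hb ⊢
        exact (MvPolynomial.totalDegree_mul a b).trans (add_le_add ha hb)
    intro hs
    exact (MvPolynomial.mem_restrictTotalDegree _ _ _).1 (h2 hs)
  · intro hs
    have key : ∀ m : Fin k →₀ ℕ, MvPolynomial.monomial m (1 : R) ∈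
        linForms R (MvPolynomial.X : Fin k → MvPolynomial (Fin k) R) ^ m.degree := by
      intro m
      induction m using Finsupp.induction_linear with
      | zero => rw [map_zero, pow_zero]; exact Submodule.one_le.1 le_rfl
      | add a b ha hb =>
        rw [map_add, pow_add, ← one_mul (1 : R), ← MvPolynomial.monomial_mul]
        exact Submodule.mul_mem_mul ha hb
      | single i e =>
        rw [← MvPolynomial.X_pow_eq_monomial, Finsupp.degree_single]
        exact Submodule.pow_mem_pow _ (hX i) e
    rw [s.as_sum]
    refine Submodule.sum_mem _ fun m hm => ?_
    rw [← mul_one (s.coeff m), ← smul_eq_mul, ← MvPolynomial.smul_monomial]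
    refine Submodule.smul_mem _ _ (pow_le_pow_right₀ hE ?_ (key m))
    exact (MvPolynomial.le_totalDegree hm).trans hs

end MvPolynomial

section Bridge

variable {R : Type u} [CommRing R] {k : ℕ} {A : Type v} [AddCommGroup A] [Module R A]
  [Module (MvPolynomial (Fin k) R) A] [IsScalarTower R (MvPolynomial (Fin k) R) A]
  (lam : LengthFunction.{u, v} R)

theorem polyAct_eq (n : ℕ) (V : Submodule R A) :
    polyAct k n V = linForms R (MvPolynomial.X : Fin k → MvPolynomial (Fin k) R) ^ n • V := by
  apply le_antisymm
  · refine Submodule.span_le.2 ?_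
    rintro _ ⟨s, hs, v, hv, rfl⟩
    exact Submodule.smul_mem_smul (mem_linForms_X_pow.2 hs) hv
  · rw [Submodule.smul_le]
    exact fun s hs v hv => Submodule.subset_span ⟨s, mem_linForms_X_pow.1 hs, v, hv, rfl⟩

variable [IsNoetherianRing R] {lam}

theorem isInertFG_iff {V : Submodule R A} :
    IsInertFG lam k V ↔ IsInert lam (MvPolynomial.X : Fin k → MvPolynomial (Fin k) R) V := by
  rw [IsInertFG, IsInert, polyAct_eq, pow_one, lt_top_iff_ne_top, relFG_iff_finite]
  rfl

theorem isIntrinsicHilbertPoly_iff {V : Submodule R A} {q : ℝ[X]} :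
    IsIntrinsicHilbertPoly lam k V q ↔
      IsHilbertPoly lam (MvPolynomial.X : Fin k → MvPolynomial (Fin k) R) V q := by
  change (∀ᶠ n : ℕ in atTop, 0 ≤ q.eval (n : ℝ) ∧ relLen lam (polyAct k n V)
    (polyAct k (n + 1) V) = ENNReal.ofReal (q.eval (n : ℝ))) ↔ _
  simp only [polyAct_eq]
  rfl

theorem isIntrinsicLeadTerm_iff {V : Submodule R A} (hV : IsInertFG lam k V) {m : LeadTerm} :
    IsIntrinsicLeadTerm lam k V m ↔
      m = hilbertLead lam (MvPolynomial.X : Fin k → MvPolynomial (Fin k) R) V := by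
  simp only [IsIntrinsicLeadTerm, isIntrinsicHilbertPoly_iff]
  constructor
  · rintro ⟨q, hq, rfl⟩
    exact hq.hilbertLead_eq.symm
  · rintro rfl
    obtain ⟨q, -, hq⟩ := (isInertFG_iff.1 hV).exists_isHilbertPoly
    exact ⟨q, hq, hq.hilbertLead_eq⟩

variable (A) in
theorem muTilde_eq : muTilde lam k A =
    hilbertSup A lam (MvPolynomial.X : Fin k → MvPolynomial (Fin k) R) := by
  unfold muTilde hilbertSup hilbertLeads
  congr 1
  ext m
  refine exists_congr fun V => ?_
  rw [← isInertFG_iff]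
  exact and_congr_right fun hV => and_congr_right fun _ => isIntrinsicLeadTerm_iff hV

variable (A) in
theorem muTildeGen_eq : muTildeGen lam k A =
    LeadTerm.sup {m | ∃ V : Submodule R A,
      IsInert lam (MvPolynomial.X : Fin k → MvPolynomial (Fin k) R) V ∧
      Submodule.span (MvPolynomial (Fin k) R) (V : Set A) = ⊤ ∧
      m = hilbertLead lam (MvPolynomial.X : Fin k → MvPolynomial (Fin k) R) V} := by
  unfold muTildeGen
  congr 1
  ext m
  refine exists_congr fun V => ?_
  rw [← isInertFG_iff]
  exact and_congr_right fun hV => and_congr_right fun _ => isIntrinsicLeadTerm_iff hV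

theorem entropySeq_eq (V : Submodule R A) : entropySeq lam k V = fun n : ℕ =>
    (k ! : ℝ≥0∞) * relLen lam V
      (linForms R (MvPolynomial.X : Fin k → MvPolynomial (Fin k) R) ^ n • V) / (n : ℝ≥0∞) ^ k := by
  funext n
  rw [entropySeq, polyAct_eq]
  rfl

theorem tendsto_entropySeq (hk : 0 < k) {V : Submodule R A} (hV : IsInertFG lam k V) :
    Tendsto (entropySeq lam k V) atTop (𝓝 (LeadTerm.coeffAt ((k - 1)! : ℕ) (k - 1)
      (hilbertLead lam (MvPolynomial.X : Fin k → MvPolynomial (Fin k) R) V))) := by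
  rw [entropySeq_eq]
  exact (isInertFG_iff.1 hV).tendsto_entropy hk

theorem entropySeq_zero {A : Type v} [AddCommGroup A] [Module R A]
    [Module (MvPolynomial (Fin 0) R) A] [IsScalarTower R (MvPolynomial (Fin 0) R) A]
    (V : Submodule R A) : entropySeq lam 0 V = 0 := by
  funext n
  rw [entropySeq_eq]
  dsimp only
  rw [relLen_eq_zero]
  · simp
  · have : linForms R (MvPolynomial.X : Fin 0 → MvPolynomial (Fin 0) R) = 1 := by
      rw [linForms_eq, Set.range_eq_empty, Submodule.span_empty, sup_bot_eq]
    rw [this, one_pow, Submodule.one_smul]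

variable (A) in
theorem intrinsicEntropy_eq (hk : 0 < k) : intrinsicEntropy lam k A =
    LeadTerm.coeffAt ((k - 1)! : ℕ) (k - 1) (muTilde lam k A) := by
  rw [muTilde_eq, coeffAt_hilbertSup, intrinsicEntropy]
  refine iSup_congr fun V => iSup_congr_Prop isInertFG_iff fun hV => ?_
  exact (tendsto_entropySeq hk (isInertFG_iff.2 hV)).limsup_eq

theorem linForms_X_exhaustive (s : MvPolynomial (Fin k) R) :
    ∃ n : ℕ, s ∈ linForms R (MvPolynomial.X : Fin k → MvPolynomial (Fin k) R) ^ n :=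
  ⟨s.totalDegree, mem_linForms_X_pow.2 le_rfl⟩

theorem muTilde_congr {B : Type v} [AddCommGroup B] [Module R B]
    [Module (MvPolynomial (Fin k) R) B] [IsScalarTower R (MvPolynomial (Fin k) R) B]
    (e : A ≃ₗ[MvPolynomial (Fin k) R] B) : muTilde lam k A = muTilde lam k B := by
  rw [muTilde_eq, muTilde_eq]
  exact hilbertSup_congr e

theorem muTilde_deg_le : (muTilde lam k A).deg ≤ k - 1 := by
  rw [muTilde_eq]; exact hilbertSup_deg_le

theorem muTilde_add {B C : Type v} [AddCommGroup B] [AddCommGroup C] [Module R B] [Module R C]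
    [Module (MvPolynomial (Fin k) R) B] [Module (MvPolynomial (Fin k) R) C]
    [IsScalarTower R (MvPolynomial (Fin k) R) B] [IsScalarTower R (MvPolynomial (Fin k) R) C]
    {f : A →ₗ[MvPolynomial (Fin k) R] B} {g : B →ₗ[MvPolynomial (Fin k) R] C}
    (hf : Function.Injective f) (hg : Function.Surjective g) (hfg : Function.Exact f g) :
    muTilde lam k B = (muTilde lam k A).oplus (muTilde lam k C) := by
  rw [muTilde_eq, muTilde_eq, muTilde_eq]
  exact hilbertSup_add linForms_X_exhaustive hf hg hfg

theorem muTilde_of_subsingleton [Subsingleton A] : muTilde lam k A = LeadTerm.zero := by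
  rw [muTilde_eq]; exact hilbertSup_of_subsingleton

variable (A) in
theorem muTilde_eq_sup_fg : muTilde lam k A =
    LeadTerm.sup {m | ∃ B : Submodule (MvPolynomial (Fin k) R) A,
      B.FG ∧ m = muTilde lam k B} := by
  simp only [muTilde_eq]
  exact hilbertSup_eq_sup_fg

variable (lam k) in
/-- The intrinsic entropy of a module over the polynomial ring, the action of the base ring being
the induced one. -/
noncomputable def entropyLen (M : Type v) [AddCommGroup M] [Module (MvPolynomial (Fin k) R) M] :
    ℝ≥0∞ :=
  letI : Module R M := Module.compHom M (algebraMap R (MvPolynomial (Fin k) R))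
  intrinsicEntropy lam k M

variable (A) in
-- The scalar tower condition forces the R-action to be the one induced from S, so a length function
-- defined from the S-structure alone computes the intrinsic entropy.
theorem entropyLen_eq : entropyLen k lam A = intrinsicEntropy lam k A := by
  have : ‹Module R A› = Module.compHom A (algebraMap R (MvPolynomial (Fin k) R)) := by
    refine Module.ext' _ _ fun r a => ?_
    exact (algebraMap_smul (MvPolynomial (Fin k) R) r a).symm
  subst this
  rfl

variable (lam k) in
/-- The intrinsic entropy, as a length function. -/
noncomputable def entropyLength (hk : 0 < k) : LengthFunction.{u, v} (MvPolynomial (Fin k) R) where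
  len M := entropyLen k lam M
  len_zero M := by
    intros
    let : Module R M := Module.compHom M (algebraMap R (MvPolynomial (Fin k) R))
    have : IsScalarTower R (MvPolynomial (Fin k) R) M := .of_algebraMap_smul fun _ _ => rfl
    rw [entropyLen_eq, intrinsicEntropy_eq M hk, muTilde_of_subsingleton]
    simp [LeadTerm.coeffAt, LeadTerm.zero]
  len_congr M N := by
    intro _ _ _ _ e
    let : Module R M := Module.compHom M (algebraMap R (MvPolynomial (Fin k) R))
    have : IsScalarTower R (MvPolynomial (Fin k) R) M := .of_algebraMap_smul fun _ _ => rfl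
    let : Module R N := Module.compHom N (algebraMap R (MvPolynomial (Fin k) R))
    have : IsScalarTower R (MvPolynomial (Fin k) R) N := .of_algebraMap_smul fun _ _ => rfl
    rw [entropyLen_eq, entropyLen_eq, intrinsicEntropy_eq M hk, intrinsicEntropy_eq N hk,
      muTilde_congr e]
  len_add M N P := by
    intro _ _ _ _ _ _ f g hf hg hfg
    let : Module R M := Module.compHom M (algebraMap R (MvPolynomial (Fin k) R))
    have : IsScalarTower R (MvPolynomial (Fin k) R) M := .of_algebraMap_smul fun _ _ => rfl
    let : Module R N := Module.compHom N (algebraMap R (MvPolynomial (Fin k) R))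
    have : IsScalarTower R (MvPolynomial (Fin k) R) N := .of_algebraMap_smul fun _ _ => rfl
    let : Module R P := Module.compHom P (algebraMap R (MvPolynomial (Fin k) R))
    have : IsScalarTower R (MvPolynomial (Fin k) R) P := .of_algebraMap_smul fun _ _ => rfl
    rw [entropyLen_eq, entropyLen_eq, entropyLen_eq, intrinsicEntropy_eq M hk,
      intrinsicEntropy_eq N hk, intrinsicEntropy_eq P hk, muTilde_add hf hg hfg]
    exact LeadTerm.coeffAt_oplus muTilde_deg_le muTilde_deg_le
  len_sup M := by
    intros
    let : Module R M := Module.compHom M (algebraMap R (MvPolynomial (Fin k) R))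
    have : IsScalarTower R (MvPolynomial (Fin k) R) M := .of_algebraMap_smul fun _ _ => rfl
    simp only [entropyLen_eq]
    rw [intrinsicEntropy_eq M hk, muTilde_eq_sup_fg, LeadTerm.coeffAt_sup]
    · apply le_antisymm
      · refine iSup₂_le ?_
        rintro _ ⟨N, hN, rfl⟩
        exact le_iSup₂_of_le N hN (intrinsicEntropy_eq N hk).ge
      · exact iSup₂_le fun N hN => le_iSup₂_of_le _ ⟨N, hN, rfl⟩ (intrinsicEntropy_eq N hk).le
    · rintro _ ⟨N, -, rfl⟩
      exact muTilde_deg_le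

end Bridge

/-- The zero length function. -/
def LengthFunction.zero (S : Type u) [CommRing S] : LengthFunction.{u, v} S where
  len _ := 0
  len_zero _ := rfl
  len_congr _ _ := fun _ => rfl
  len_add _ _ _ := fun _ _ _ _ _ => (add_zero 0).symm
  len_sup _ := by simp

theorem mainTheorem7 {R : Type u} [CommRing R] [IsNoetherianRing R]
    (lam : LengthFunction.{u, v} R) (k : ℕ) :
    -- the intrinsic Hilbert polynomial exists, is unique, and has degree at most `k - 1`
    (∀ (A : Type v) [AddCommGroup A] [Module R A] [Module (MvPolynomial (Fin k) R) A]
      [IsScalarTower R (MvPolynomial (Fin k) R) A] (V : Submodule R A),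
      IsInertFG lam k V →
        ∃ q : ℝ[X], q.degree < (k : WithBot ℕ) ∧ 0 ≤ q.leadingCoeff ∧
          ∀ p : ℝ[X], IsIntrinsicHilbertPoly lam k V p ↔ p = q) ∧
    -- on finitely generated modules, only generating submodules need to be considered
    (∀ (A : Type v) [AddCommGroup A] [Module R A] [Module (MvPolynomial (Fin k) R) A]
      [IsScalarTower R (MvPolynomial (Fin k) R) A],
      Module.Finite (MvPolynomial (Fin k) R) A → muTilde lam k A = muTildeGen lam k A) ∧
    -- additivity on all short exact sequences of modules over the polynomial ring
    (∀ (A B C : Type v) [AddCommGroup A] [AddCommGroup B] [AddCommGroup C]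
      [Module R A] [Module R B] [Module R C]
      [Module (MvPolynomial (Fin k) R) A] [Module (MvPolynomial (Fin k) R) B]
      [Module (MvPolynomial (Fin k) R) C]
      [IsScalarTower R (MvPolynomial (Fin k) R) A] [IsScalarTower R (MvPolynomial (Fin k) R) B]
      [IsScalarTower R (MvPolynomial (Fin k) R) C]
      (f : A →ₗ[MvPolynomial (Fin k) R] B) (g : B →ₗ[MvPolynomial (Fin k) R] C),
      Function.Injective f → Function.Surjective g → Function.Exact f g →
        muTilde lam k B = (muTilde lam k A).oplus (muTilde lam k C)) ∧
    -- the other axioms of a length function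
    (∀ (A : Type v) [AddCommGroup A] [Module R A] [Module (MvPolynomial (Fin k) R) A]
      [IsScalarTower R (MvPolynomial (Fin k) R) A] [Subsingleton A],
      muTilde lam k A = LeadTerm.zero) ∧
    (∀ (A B : Type v) [AddCommGroup A] [AddCommGroup B] [Module R A] [Module R B]
      [Module (MvPolynomial (Fin k) R) A] [Module (MvPolynomial (Fin k) R) B]
      [IsScalarTower R (MvPolynomial (Fin k) R) A] [IsScalarTower R (MvPolynomial (Fin k) R) B],
      (A ≃ₗ[MvPolynomial (Fin k) R] B) → muTilde lam k A = muTilde lam k B) ∧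
    (∀ (A : Type v) [AddCommGroup A] [Module R A] [Module (MvPolynomial (Fin k) R) A]
      [IsScalarTower R (MvPolynomial (Fin k) R) A],
      muTilde lam k A =
        LeadTerm.sup {m | ∃ B : Submodule (MvPolynomial (Fin k) R) A,
          B.FG ∧ m = muTilde lam k B}) ∧
    -- the coefficient in the top degree `k - 1` is, up to a constant, the intrinsic entropy
    (∀ (A : Type v) [AddCommGroup A] [Module R A] [Module (MvPolynomial (Fin k) R) A]
      [IsScalarTower R (MvPolynomial (Fin k) R) A],
      (∀ V : Submodule R A, IsInertFG lam k V →
        ∃ c : ℝ≥0∞, Tendsto (entropySeq lam k V) atTop (𝓝 c)) ∧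
      (0 < k → intrinsicEntropy lam k A =
        if (muTilde lam k A).deg = k - 1 then ((k - 1)! : ℝ≥0∞) * (muTilde lam k A).coeff
        else 0)) ∧
    -- the intrinsic entropy is a length function with values in `[0, ∞]`
    (∃ L : LengthFunction.{u, v} (MvPolynomial (Fin k) R),
      ∀ (A : Type v) [AddCommGroup A] [Module R A] [Module (MvPolynomial (Fin k) R) A]
        [IsScalarTower R (MvPolynomial (Fin k) R) A],
        L.len A = intrinsicEntropy lam k A) := by
  refine ⟨fun A _ _ _ _ V hV => ?_, fun A _ _ _ _ hA => ?_,
    fun A B C _ _ _ _ _ _ _ _ _ _ _ _ f g hf hg hfg => muTilde_add hf hg hfg,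
    fun A _ _ _ _ _ => muTilde_of_subsingleton, fun A B _ _ _ _ _ _ _ _ e => muTilde_congr e,
    fun A _ _ _ _ => muTilde_eq_sup_fg A, fun A _ _ _ _ => ⟨fun V hV => ?_, fun hk => ?_⟩, ?_⟩
  · obtain ⟨q, hd, hq⟩ := (isInertFG_iff.1 hV).exists_isHilbertPoly
    refine ⟨q, hd, hq.leadingCoeff_nonneg, fun p => ?_⟩
    rw [isIntrinsicHilbertPoly_iff]
    exact ⟨fun hp => hp.unique hq, fun h => h ▸ hq⟩
  · rw [muTilde_eq, muTildeGen_eq]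
    exact hilbertSup_eq_of_finite linForms_X_exhaustive
  · rcases Nat.eq_zero_or_pos k with rfl | hk
    · exact ⟨0, by rw [entropySeq_zero]; exact tendsto_const_nhds⟩
    · exact ⟨_, tendsto_entropySeq hk hV⟩
  · exact intrinsicEntropy_eq A hk
  -- For k = 0 one has S_n V = V, so the entropy vanishes identically; the formula in terms of (k -
  -- 1)! is available only for positive k.
  · rcases Nat.eq_zero_or_pos k with rfl | hk
    · refine ⟨.zero _, fun A _ _ _ _ => ?_⟩
      rw [intrinsicEntropy]
      simp only [entropySeq_zero]
      refine (le_antisymm (iSup₂_le fun V _ => ?_) bot_le).symm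
      exact (tendsto_const_nhds (x := (0 : ℝ≥0∞)) (f := (atTop : Filter ℕ))).limsup_eq.le
    · exact ⟨entropyLength k lam hk, fun A _ _ _ _ => entropyLen_eq A⟩
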